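/- **Setting.** Let $I=[0,1]$, $\varepsilon>0$, and let $\mathcal R$ be the anti-clockwise rotation of $\mathbb R^2$ by $\pi/2$. For $\gamma\in H^2(I;\mathbb R^2)$ (identified with its $C^1$ representative) let $L_\gamma=\int_0^1|\gamma_s|\,ds$ and $\kappa_\gamma=\langle\gamma_{ss},\mathcal R(\gamma_s)\rangle/|\gamma_s|^3$. Let $$\mathcal{AC}=\{\gamma\in H^2(I;\mathbb R^2): |\gamma_s|\equiv L_\gamma,\ \gamma(0)\ne\gamma(1)\},\qquad \mathcal{AC}_{\tilde\gamma}=\{\gamma\in\mathcal{AC}:\langle\gamma_s,\tilde\gamma_s\rangle\ge 0\text{ on } I\}\quad(\tilde\gamma\in\mathcal{AC}),$$ $$E(\gamma)=L_\gamma+\frac{\varepsilon}{2}\int_0^1\kappa_\gamma^2|\gamma_s|\,ds-\log|\gamma(1)-\gamma(0)|,$$ $$D(\gamma,\tilde\gamma)=\frac1{4L_{\tilde\gamma}}\int_0^1\langle\gamma-\tilde\gamma,\mathcal R(\tilde\gamma_s)\rangle^2ds+\frac1{4L_\gamma}\int_0^1\langle\gamma-\tilde\gamma,\mathcal R(\gamma_s)\rangle^2ds+\frac12|\gamma(0)-\tilde\gamma(0)|^2+\frac12|\gamma(1)-\tilde\gamma(1)|^2.$$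 Fix $\gamma_0\in\mathcal{AC}$. For every time step $\tau\in(0,1)$ let $(\gamma^\tau_n)_{n\ge0}$ be a sequence of step-by-step minimizers, i.e. $\gamma^\tau_0=\gamma_0$ and $$\gamma^\tau_{n+1}\in\operatorname*{argmin}_{\gamma\in\mathcal{AC}_{\gamma^\tau_n}}\Big\{E(\gamma)+\frac1\tau D(\gamma,\gamma^\tau_n)\Big\}\qquad(n\ge0).$$ For $s\in I$ and $t\in\mathbb R_+=[0,\infty)$ define the piecewise constant and the piecewise affine interpolations $$\gamma^\tau(s,t)=\gamma^\tau_{\lceil t/\tau\rceil}(s),\qquad \hat\gamma^\tau(s,t)=\big(1-(t/\tau-\lfloor t/\tau\rfloor)\big)\,\gamma^\tau_{\lfloor t/\tau\rfloor}(s)+\big(t/\tau-\lfloor t/\tau\rfloor\big)\,\gamma^\tau_{\lceil t/\tau\rceil}(s).$$ **Theorem (Initial compactness).** For every sequence of time steps in $(0,1)$ converging to $0$ there are a subsequence $(\tau_k)_k$ and a map $\gamma:I\times\mathbb R_+\to\mathbb R^2$ such that, as $k\to\infty$, for every $T>0$: 1. $\hat\gamma^{\tau_k}\to\gamma$ in $C^{0,\beta}([0,T];C^{1,\alpha}(I;\mathbb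 R^2))$ for all $\alpha\in(0,\frac12)$ and $\beta\in(0,\frac{1-2\alpha}8)$; 2. $\gamma^{\tau_k}\to\gamma$ in $L^\infty(0,T;C^{1,\alpha}(I;\mathbb R^2))$ for all $\alpha\in(0,\frac12)$; 3. $\hat\gamma^{\tau_k}\rightharpoonup\gamma$ weakly in $H^1(0,T;L^2(I;\mathbb R^2))$; 4. $\hat\gamma^{\tau_k}(0,\cdot)\rightharpoonup\gamma(0,\cdot)$ and $\hat\gamma^{\tau_k}(1,\cdot)\rightharpoonup\gamma(1,\cdot)$ weakly in $H^1(0,T;\mathbb R^2)$. -/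

import Mathlib

open Set Filter Topology MeasureTheory
open scoped NNReal ENNReal ContDiff

noncomputable section

namespace ElasticFlow

/-! ### Weak derivatives on an interval and the Sobolev space `H¹(0, T; X)` -/

/-- `v` is the weak derivative of `u` on the open interval `(a, b)`; `u` and `v` take values in a
Banach space. -/
def HasWeakDeriv {X : Type*} [NormedAddCommGroup X] [NormedSpace ℝ X] [CompleteSpace X]
    (a b : ℝ) (u v : ℝ → X) : Prop :=
  LocallyIntegrableOn u (Ioo a b) ∧ LocallyIntegrableOn v (Ioo a b) ∧
    ∀ φ : ℝ → ℝ, ContDiff ℝ ∞ φ → HasCompactSupport φ → tsupport φ ⊆ Ioo a b →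
      ∫ t in Ioo a b, deriv φ t • u t = - ∫ t in Ioo a b, φ t • v t

open Classical in
/-- A representative of the weak derivative on `(a, b)`, which is unique up to a null set
(the zero function if there is none). -/
def weakDeriv {X : Type*} [NormedAddCommGroup X] [NormedSpace ℝ X] [CompleteSpace X]
    (a b : ℝ) (u : ℝ → X) : ℝ → X :=
  if h : ∃ v, HasWeakDeriv a b u v then h.choose else 0

section H1

variable {X : Type*} [NormedAddCommGroup X] [InnerProductSpace ℝ X] [CompleteSpace X]

/-- The Bochner space `L²(0, T; X)`. -/
abbrev L2Time (T : ℝ) (X : Type*) [NormedAddCommGroup X] : Type _ :=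
  Lp X 2 (volume.restrict (Ioo (0 : ℝ) T))

theorem L2Time.integrableOn {X : Type*} [NormedAddCommGroup X] {T : ℝ} (u : L2Time T X) : IntegrableOn u (Ioo 0 T) :=
  (Lp.memLp u).integrable (by norm_num)

theorem integrable_test_smul {X : Type*} [NormedAddCommGroup X] [InnerProductSpace ℝ X] {T : ℝ}
    {ψ : ℝ → ℝ} (hψ : Continuous ψ) (hs : HasCompactSupport ψ)
    (u : L2Time T X) : Integrable (fun t => ψ t • u t) (volume.restrict (Ioo 0 T)) := by
  obtain ⟨C, hC⟩ := hψ.bounded_above_of_compact_support hs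
  exact (L2Time.integrableOn u).bdd_smul C hψ.aestronglyMeasurable (Eventually.of_forall hC)

theorem hasWeakDeriv_congr {T : ℝ} {u u' v v' : ℝ → X}
    (hu : u =ᵐ[volume.restrict (Ioo 0 T)] u') (hv : v =ᵐ[volume.restrict (Ioo 0 T)] v')
    (hu' : LocallyIntegrableOn u' (Ioo 0 T)) (hv' : LocallyIntegrableOn v' (Ioo 0 T))
    (h : HasWeakDeriv 0 T u v) : HasWeakDeriv 0 T u' v' := by
  refine ⟨hu', hv', fun φ h1 h2 h3 => ?_⟩
  have e1 : ∫ t in Ioo 0 T, deriv φ t • u' t = ∫ t in Ioo 0 T, deriv φ t • u t :=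
    integral_congr_ae (hu.mono fun t ht => by simp only [ht])
  have e2 : ∫ t in Ioo 0 T, φ t • v' t = ∫ t in Ioo 0 T, φ t • v t :=
    integral_congr_ae (hv.mono fun t ht => by simp only [ht])
  rw [e1, e2]
  exact h.2.2 φ h1 h2 h3

variable (X) in
/-- The Hilbert space `H¹(0, T; X)` of pairs `(u, u')` in `L²(0, T; X)²` such that `u'` is the weak
derivative of `u`, with the norm `(‖u‖² + ‖u'‖²)^(1/2)`. -/
def H1Time (T : ℝ) : Submodule ℝ (WithLp 2 (L2Time T X × L2Time T X)) where
  carrier := {p | HasWeakDeriv 0 T p.fst p.snd}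
  zero_mem' := by
    have h0 : HasWeakDeriv 0 T (0 : ℝ → X) 0 :=
      ⟨integrableOn_zero.locallyIntegrableOn, integrableOn_zero.locallyIntegrableOn,
        fun φ _ _ _ => by simp⟩
    refine hasWeakDeriv_congr ?_ ?_ (L2Time.integrableOn _).locallyIntegrableOn
      (L2Time.integrableOn _).locallyIntegrableOn h0
    · exact (Lp.coeFn_zero X 2 _).symm
    · exact (Lp.coeFn_zero X 2 _).symm
  add_mem' := by
    intro p q hp hq
    have h0 : HasWeakDeriv 0 T (fun t => p.fst t + q.fst t) (fun t => p.snd t + q.snd t) := by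
      refine ⟨((L2Time.integrableOn p.fst).add (L2Time.integrableOn q.fst)).locallyIntegrableOn,
        ((L2Time.integrableOn p.snd).add (L2Time.integrableOn q.snd)).locallyIntegrableOn,
        fun φ h1 h2 h3 => ?_⟩
      have hd : Continuous (deriv φ) := h1.continuous_deriv (by simp)
      simp only [smul_add]
      rw [integral_add (integrable_test_smul hd h2.deriv _) (integrable_test_smul hd h2.deriv _),
        integral_add (integrable_test_smul h1.continuous h2 _)
          (integrable_test_smul h1.continuous h2 _), hp.2.2 φ h1 h2 h3, hq.2.2 φ h1 h2 h3, neg_add]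
    refine hasWeakDeriv_congr ?_ ?_ (L2Time.integrableOn _).locallyIntegrableOn
      (L2Time.integrableOn _).locallyIntegrableOn h0
    · exact (Lp.coeFn_add p.fst q.fst).symm
    · exact (Lp.coeFn_add p.snd q.snd).symm
  smul_mem' := by
    intro r p hp
    have h0 : HasWeakDeriv 0 T (fun t => r • p.fst t) (fun t => r • p.snd t) := by
      refine ⟨IntegrableOn.locallyIntegrableOn ((L2Time.integrableOn p.fst).smul r),
        IntegrableOn.locallyIntegrableOn ((L2Time.integrableOn p.snd).smul r), fun φ h1 h2 h3 => ?_⟩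
      simp only [smul_comm _ r]
      rw [integral_smul, integral_smul, hp.2.2 φ h1 h2 h3, smul_neg]
    refine hasWeakDeriv_congr ?_ ?_ (L2Time.integrableOn _).locallyIntegrableOn
      (L2Time.integrableOn _).locallyIntegrableOn h0
    · exact (Lp.coeFn_smul r p.fst).symm
    · exact (Lp.coeFn_smul r p.snd).symm

/-- The functions `u k` and `u'` of time belong to `H¹(0, T; X)`, and `u k` converges to `u'`
weakly in `H¹(0, T; X)`. -/
def TendstoWeaklyH1 (T : ℝ) (u : ℕ → ℝ → X) (u' : ℝ → X) : Prop :=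
  ∃ (U : ℕ → H1Time X T) (U' : H1Time X T),
    (∀ k, (U k : WithLp 2 (L2Time T X × L2Time T X)).fst =ᵐ[volume.restrict (Ioo 0 T)] u k) ∧
    ((U' : WithLp 2 (L2Time T X × L2Time T X)).fst =ᵐ[volume.restrict (Ioo 0 T)] u') ∧
    ∀ l : H1Time X T →L[ℝ] ℝ, Tendsto (fun k => l (U k)) atTop (𝓝 (l U'))

end H1

/-! ### Planar curves. A curve on `I = [0, 1]` is a function on `ℝ` of which only the values on
`I` matter. -/

abbrev Plane : Type := EuclideanSpace ℝ (Fin 2)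

/-- The parameter interval `I = [0, 1]`. -/
abbrev I : Set ℝ := Icc 0 1

/-- Anti-clockwise rotation by `π / 2`. -/
def rot (a : Plane) : Plane := !₂[-a 1, a 0]

/-- The first derivative `γ_s` on `I`, one-sided at the endpoints. -/
def vel (γ : ℝ → Plane) : ℝ → Plane := derivWithin γ I

/-- The second derivative `γ_ss`: the weak derivative of `γ_s`. -/
def acc (γ : ℝ → Plane) : ℝ → Plane := weakDeriv 0 1 (vel γ)

/-- `γ ∈ H²(I; ℝ²)`, where `γ` is the `C¹` representative on `[0, 1]` of its class (which exists by
the Sobolev embedding): the weak derivative of `γ_s` exists and is square integrable. -/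
def MemH2 (γ : ℝ → Plane) : Prop :=
  ContDiffOn ℝ 1 γ I ∧
    ∃ h : ℝ → Plane, MemLp h 2 (volume.restrict (Ioo 0 1)) ∧ HasWeakDeriv 0 1 (vel γ) h

def length (γ : ℝ → Plane) : ℝ := ∫ s in (0 : ℝ)..1, ‖vel γ s‖

def curvature (γ : ℝ → Plane) (s : ℝ) : ℝ :=
  inner ℝ (acc γ s) (rot (vel γ s)) / ‖vel γ s‖ ^ 3

/-- The set `AC` of admissible curves. -/
def AC : Set (ℝ → Plane) :=
  {γ | MemH2 γ ∧ (∀ s ∈ I, ‖vel γ s‖ = length γ) ∧ γ 0 ≠ γ 1}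

/-- The subset of `AC` of curves satisfying the angle constraint relative to `γ'`. -/
def ACAngle (γ' : ℝ → Plane) : Set (ℝ → Plane) :=
  {γ | γ ∈ AC ∧ ∀ s ∈ I, 0 ≤ inner ℝ (vel γ s) (vel γ' s)}

def energy (ε : ℝ) (γ : ℝ → Plane) : ℝ :=
  length γ + ε / 2 * (∫ s in (0 : ℝ)..1, curvature γ s ^ 2 * ‖vel γ s‖) - Real.log ‖γ 1 - γ 0‖

def dissipation (γ γ' : ℝ → Plane) : ℝ :=
  1 / (4 * length γ') * (∫ s in (0 : ℝ)..1, inner ℝ (γ s - γ' s) (rot (vel γ' s)) ^ 2)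
    + 1 / (4 * length γ) * (∫ s in (0 : ℝ)..1, inner ℝ (γ s - γ' s) (rot (vel γ s)) ^ 2)
    + 1 / 2 * ‖γ 0 - γ' 0‖ ^ 2 + 1 / 2 * ‖γ 1 - γ' 1‖ ^ 2

/-- `c` is a sequence of step-by-step minimizers with time step `τ` starting from `γ₀`. -/
def IsMinimizingMovement (ε τ : ℝ) (γ₀ : ℝ → Plane) (c : ℕ → ℝ → Plane) : Prop :=
  c 0 = γ₀ ∧ ∀ n, c (n + 1) ∈ ACAngle (c n) ∧
    IsMinOn (fun γ => energy ε γ + 1 / τ * dissipation γ (c n)) (ACAngle (c n)) (c (n + 1))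

/-! ### Interpolations in time. Evolutions are written with the time variable first, so that
`u t` is the curve at time `t`. -/

/-- Piecewise constant interpolation. -/
def pwConst (τ : ℝ) (c : ℕ → ℝ → Plane) (t : ℝ) : ℝ → Plane := c ⌈t / τ⌉₊

/-- Piecewise affine interpolation; its value at `t = n τ` is `c n`. -/
def pwAffine (τ : ℝ) (c : ℕ → ℝ → Plane) (t : ℝ) : ℝ → Plane :=
  (1 - (t / τ - ⌊t / τ⌋₊)) • c ⌊t / τ⌋₊ + (t / τ - ⌊t / τ⌋₊) • c ⌈t / τ⌉₊

/-! ### Function spaces -/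

open Classical in
/-- The norm of `C^{1,α}(I; ℝ²)`, equal to `∞` outside of this space. -/
def c1Norm (α : ℝ≥0) (u : ℝ → Plane) : ℝ≥0∞ :=
  if ContDiffOn ℝ 1 u I then
    (⨆ s ∈ I, ‖u s‖ₑ) + (⨆ s ∈ I, ‖vel u s‖ₑ) + eHolderNorm α (I.domRestrict (vel u))
  else ⊤

/-- The norm of `C^{0,β}([0, T]; C^{1,α}(I; ℝ²))`, equal to `∞` outside of this space. -/
def holderC1Norm (T : ℝ) (β α : ℝ≥0) (u : ℝ → ℝ → Plane) : ℝ≥0∞ :=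
  (⨆ t ∈ Icc 0 T, c1Norm α (u t)) +
    ⨆ (t₁ ∈ Icc 0 T) (t₂ ∈ Icc 0 T) (_ : t₁ < t₂),
      c1Norm α (u t₂ - u t₁) / ENNReal.ofReal (t₂ - t₁) ^ (β : ℝ)

/-- Convergence `u k → u'` in `C^{0,β}([0, T]; C^{1,α}(I; ℝ²))` of elements of this space. -/
def TendstoHolderC1 (T : ℝ) (β α : ℝ≥0) (u : ℕ → ℝ → ℝ → Plane) (u' : ℝ → ℝ → Plane) : Prop :=
  (∀ k, holderC1Norm T β α (u k) < ⊤) ∧ holderC1Norm T β α u' < ⊤ ∧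
    Tendsto (fun k => holderC1Norm T β α (u k - u')) atTop (𝓝 0)

/-- The norm of `L^∞(0, T; C^{1,α}(I; ℝ²))`. -/
def linftyC1Norm (T : ℝ) (α : ℝ≥0) (u : ℝ → ℝ → Plane) : ℝ≥0∞ :=
  essSup (fun t => c1Norm α (u t)) (volume.restrict (Ioo 0 T))

/-- `u ∈ L^∞(0, T; C^{1,α}(I; ℝ²))`: `u` is strongly measurable, that is, almost everywhere the
limit in `C^{1,α}` of simple functions, and essentially bounded. -/
def MemLinftyC1 (T : ℝ) (α : ℝ≥0) (u : ℝ → ℝ → Plane) : Prop :=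
  (∃ f : ℕ → SimpleFunc ℝ (ℝ → Plane), (∀ j t, c1Norm α (f j t) < ⊤) ∧
    ∀ᵐ t ∂(volume.restrict (Ioo 0 T)), Tendsto (fun j => c1Norm α (f j t - u t)) atTop (𝓝 0)) ∧
  linftyC1Norm T α u < ⊤

/-- Convergence `u k → u'` in `L^∞(0, T; C^{1,α}(I; ℝ²))` of elements of this space. -/
def TendstoLinftyC1 (T : ℝ) (α : ℝ≥0) (u : ℕ → ℝ → ℝ → Plane) (u' : ℝ → ℝ → Plane) : Prop :=
  (∀ k, MemLinftyC1 T α (u k)) ∧ MemLinftyC1 T α u' ∧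
    Tendsto (fun k => linftyC1Norm T α (u k - u')) atTop (𝓝 0)

/-- The space `L²(I; ℝ²)`. -/
abbrev L2Curve : Type := Lp Plane 2 (volume.restrict (Ioo (0 : ℝ) 1))

open Classical in
/-- The class in `L²(I; ℝ²)` of a curve that is square integrable on `I`, in particular of every
curve that is continuous on `I` (zero for all other curves). -/
def toL2 (u : ℝ → Plane) : L2Curve :=
  if h : MemLp u 2 (volume.restrict (Ioo 0 1)) then h.toLp u else 0

end ElasticFlow

end

/-! The previous iterate is an admissible competitor and `D(γ,γ) = 0`, so `D(γ_{n+1},γ_n) ≤ τ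
(E(γ_n) - E(γ_{n+1}))`. The energy is bounded below because `log |γ(1)-γ(0)| ≤ log L ≤ L - 1`; hence
the dissipations sum to `O(τ)`. Bounded energy also pins `L` between positive constants and bounds
`γ_ss` in `L²`, since at constant speed `γ_ss ⟂ γ_s` and the bending energy is `‖γ_ss‖²/L³` up to a
factor (`exists_energy_bounds`). So all iterates have `γ_s` uniformly 1/2-Hölder.

The main point is that `D`, which sees only normal displacements and the endpoints, controls the
full `L²` distance (`exists_dissipation_bound`). Put `f = γ - γ'` and `w = L' γ_s + L γ'_s`. The
angle constraint keeps `|w|` away from zero, and `⟨f, rot w⟩` is controlled by `D`. For the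
tangential part `G = ⟨f, w⟩`, one has `G' = (L - L')(L L' + ⟨γ_s, γ'_s⟩) + ⟨f, L' γ_ss + L γ'_ss⟩`,
whose last term again involves only normal components of `f`. Integrating over `[0,1]`, with the
endpoint terms of `D`, bounds `|L - L'|` by `√D`; integrating up to `t` then bounds `G` by `√D`.

Consequently the affine interpolants have a time derivative bounded in `L²(0,T;L²)`, so they are
1/2-Hölder in time with values in `L²`. Interpolating `L²` against `C^{1,1/2}`
(`HalfHolder.norm_vel_le`) costs a factor 1/4 in the exponent and gives 1/8-Hölder in time with
values in `C¹`. Arzelà-Ascoli, applied to `(t,s) ↦ (γ, γ_s)`, yields a locally uniform limit.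
Interpolating once more against the uniform Hölder bounds upgrades this to `C^{0,β}(C^{1,α})` for `β
< (1-2α)/8`. The piecewise constant interpolant is the affine one read at the next node. Weak `H¹`
convergence follows from uniform convergence and the bound on the derivatives, without a further
subsequence. -/

namespace ElasticFlow

/-! ### Primitives of integrable functions and weak derivatives -/

section Primitive

variable {X : Type*} [NormedAddCommGroup X] [NormedSpace ℝ X]

/-- On `[0, 1]` the function `f` is a primitive of the integrable function `f'`. -/
def IsPrimitive (f f' : ℝ → X) : Prop :=
  IntervalIntegrable f' volume 0 1 ∧ ∀ t ∈ I, f t = f 0 + ∫ s in (0 : ℝ)..t, f' s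

theorem IsPrimitive.intervalIntegrable {f f' : ℝ → X} (h : IsPrimitive f f') {a b : ℝ}
    (ha : a ∈ I) (hb : b ∈ I) : IntervalIntegrable f' volume a b :=
  h.1.mono_set (by rw [uIcc_of_le (zero_le_one' ℝ)]; exact uIcc_subset_Icc ha hb)

theorem IsPrimitive.sub_eq {f f' : ℝ → X} (h : IsPrimitive f f') {a b : ℝ}
    (ha : a ∈ I) (hb : b ∈ I) : f b - f a = ∫ s in a..b, f' s := by
  have h0 : (0 : ℝ) ∈ I := ⟨le_rfl, zero_le_one⟩
  rw [h.2 a ha, h.2 b hb, ← intervalIntegral.integral_add_adjacent_intervals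
    (h.intervalIntegrable h0 ha) (h.intervalIntegrable ha hb)]
  abel

theorem IsPrimitive.add {f f' g g' : ℝ → X} (hf : IsPrimitive f f') (hg : IsPrimitive g g') :
    IsPrimitive (fun t => f t + g t) (fun t => f' t + g' t) := by
  have h0 : (0 : ℝ) ∈ I := ⟨le_rfl, zero_le_one⟩
  refine ⟨hf.1.add hg.1, fun t ht => ?_⟩
  simp only
  rw [intervalIntegral.integral_add (hf.intervalIntegrable h0 ht) (hg.intervalIntegrable h0 ht),
    hf.2 t ht, hg.2 t ht]
  abel

theorem IsPrimitive.const_smul {f f' : ℝ → X} (hf : IsPrimitive f f') (r : ℝ) :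
    IsPrimitive (fun t => r • f t) (fun t => r • f' t) := by
  refine ⟨hf.1.smul r, fun t ht => ?_⟩
  simp only
  rw [intervalIntegral.integral_smul, hf.2 t ht, smul_add]

theorem IsPrimitive.sub {f f' g g' : ℝ → X} (hf : IsPrimitive f f') (hg : IsPrimitive g g') :
    IsPrimitive (fun t => f t - g t) (fun t => f' t - g' t) := by
  simpa [sub_eq_add_neg] using hf.add (hg.const_smul (-1))

theorem IsPrimitive.continuousOn {f f' : ℝ → X} (hf : IsPrimitive f f') : ContinuousOn f I := by
  have h := intervalIntegral.continuousOn_primitive_interval (a := (0 : ℝ)) (b := 1) (f := f')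
    (μ := volume) (by rw [uIcc_of_le zero_le_one, integrableOn_Icc_iff_integrableOn_Ioc]
                      exact hf.1.1)
  rw [uIcc_of_le zero_le_one] at h
  exact (continuousOn_const.add h).congr hf.2

theorem isPrimitive_of_hasDerivWithinAt [CompleteSpace X] {f f' : ℝ → X}
    (hf : ∀ s ∈ I, HasDerivWithinAt f (f' s) I s) (hc : ContinuousOn f' I) : IsPrimitive f f' := by
  refine ⟨hc.intervalIntegrable_of_Icc zero_le_one,
    fun t ht => ?_⟩
  have hsub : Icc 0 t ⊆ I := Icc_subset_Icc le_rfl ht.2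
  rw [intervalIntegral.integral_eq_sub_of_hasDerivAt_of_le ht.1
    (fun s hs => ((hf s (hsub hs)).continuousWithinAt).mono hsub)
    (fun s hs => (hf s (hsub (Ioo_subset_Icc_self hs))).hasDerivAt
      (Icc_mem_nhds hs.1 (hs.2.trans_le ht.2)))
    ((hc.mono (by rw [uIcc_of_le ht.1]; exact hsub)).intervalIntegrable)]
  abel

theorem IsPrimitive.hasDerivWithinAt [CompleteSpace X] {f f' : ℝ → X} (hf : IsPrimitive f f')
    (hc : ContinuousOn f' I) {s : ℝ} (hs : s ∈ I) : HasDerivWithinAt f (f' s) I s := by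
  -- Constant extension beyond `I`, so that the two-sided differentiation theorem also covers the
  -- endpoints.
  set g : ℝ → X := fun s => f' (projIcc 0 1 zero_le_one s) with hg
  have hgc : Continuous g :=
    (continuousOn_iff_continuous_domRestrict.1 hc).comp continuous_projIcc
  have hgf : ∀ s ∈ I, g s = f' s := fun s hs => by simp [hg, projIcc_of_mem _ hs]
  have h1 : HasDerivAt (fun t => f 0 + ∫ s in (0 : ℝ)..t, g s) (g s) s :=
    (intervalIntegral.integral_hasDerivAt_right (hgc.intervalIntegrable _ _)
      (hgc.stronglyMeasurableAtFilter _ _) hgc.continuousAt).const_add _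
  rw [hgf s hs] at h1
  refine h1.hasDerivWithinAt.congr (fun t ht => ?_) ?_
  all_goals
    rw [hf.2 _ (by assumption)]
    congr 1
    refine intervalIntegral.integral_congr fun x hx => (hgf x ?_).symm
    exact uIcc_subset_Icc ⟨le_rfl, zero_le_one⟩ (by assumption) hx

/-- Integrals of products of absolutely continuous functions. -/
theorem IsPrimitive.integral_mul {f f' g g' : ℝ → ℝ} (hf : IsPrimitive f f')
    (hg : IsPrimitive g g') {t : ℝ} (ht : t ∈ I) :
    ∫ s in (0 : ℝ)..t, (f' s * g s + f s * g' s) = f t * g t - f 0 * g 0 := by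
  have h0 : (0 : ℝ) ∈ I := ⟨le_rfl, zero_le_one⟩
  -- The values of `f` outside `I` are arbitrary; the integral expression agrees with `f` on `I` and
  -- is absolutely continuous.
  have key : ∀ {f f' : ℝ → ℝ}, IsPrimitive f f' →
      AbsolutelyContinuousOnInterval (fun x => f 0 + ∫ s in (0 : ℝ)..x, f' s) 0 t := by
    intro f f' hf
    have hc : AbsolutelyContinuousOnInterval (fun _ : ℝ => f 0) 0 t :=
      ((LipschitzWith.const (f 0)).lipschitzOnWith (s := uIcc 0 t)).absolutelyContinuousOnInterval
    exact hc.add ((hf.intervalIntegrable h0 ht).absolutelyContinuousOnInterval_intervalIntegral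
      left_mem_uIcc)
  have h := (key hf).integral_deriv_mul_eq_sub (key hg)
  simp only [intervalIntegral.integral_same, add_zero] at h
  rw [← hf.2 t ht, ← hg.2 t ht] at h
  rw [← h]
  refine intervalIntegral.integral_congr_ae ?_
  filter_upwards [(hf.intervalIntegrable h0 ht).ae_hasDerivAt_integral,
    (hg.intervalIntegrable h0 ht).ae_hasDerivAt_integral] with x h1 h2 hx
  have hx' : x ∈ uIcc 0 t := uIoc_subset_uIcc hx
  have hxI : x ∈ I := uIcc_subset_Icc h0 ht hx'
  rw [((h1 hx' 0 left_mem_uIcc).const_add (f 0)).deriv,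
    ((h2 hx' 0 left_mem_uIcc).const_add (g 0)).deriv, ← hf.2 x hxI, ← hg.2 x hxI]

end Primitive

theorem IsPrimitive.coord {f f' : ℝ → Plane} (hf : IsPrimitive f f') (i : Fin 2) :
    IsPrimitive (fun t => f t i) (fun t => f' t i) := by
  have h0 : (0 : ℝ) ∈ I := ⟨le_rfl, zero_le_one⟩
  set p : Plane →L[ℝ] ℝ := EuclideanSpace.proj i
  refine ⟨?_, fun t ht => ?_⟩
  · exact ⟨p.integrable_comp hf.1.1, p.integrable_comp hf.1.2⟩
  · have h := p.intervalIntegral_comp_comm (hf.intervalIntegrable h0 ht)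
    have h2 : (p (f t)) = p (f 0) + p (∫ s in (0 : ℝ)..t, f' s) := by rw [hf.2 t ht, map_add]
    rw [← h] at h2
    exact h2

theorem inner_plane (a b : Plane) : inner ℝ a b = a 0 * b 0 + a 1 * b 1 := by
  simp [PiLp.inner_apply, Fin.sum_univ_two, mul_comm]

/-- The product rule for the inner product of absolutely continuous maps into the plane. -/
theorem IsPrimitive.integral_inner {f f' g g' : ℝ → Plane} (hf : IsPrimitive f f')
    (hg : IsPrimitive g g') {t : ℝ} (ht : t ∈ I) :
    ∫ s in (0 : ℝ)..t, (inner ℝ (f' s) (g s) + inner ℝ (f s) (g' s))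
      = inner ℝ (f t) (g t) - inner ℝ (f 0) (g 0) := by
  have h0 : (0 : ℝ) ∈ I := ⟨le_rfl, zero_le_one⟩
  have hint : ∀ i : Fin 2, IntervalIntegrable (fun s => f' s i * g s i + f s i * g' s i)
      volume 0 t := fun i => by
    have hsub : uIcc 0 t ⊆ I := uIcc_subset_Icc h0 ht
    exact (((hf.coord i).intervalIntegrable h0 ht).mul_continuousOn
      ((hg.coord i).continuousOn.mono hsub)).add
      (((hg.coord i).intervalIntegrable h0 ht).continuousOn_mul
      ((hf.coord i).continuousOn.mono hsub))
  simp only [inner_plane]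
  have e : ∀ s, f' s 0 * g s 0 + f' s 1 * g s 1 + (f s 0 * g' s 0 + f s 1 * g' s 1)
      = (f' s 0 * g s 0 + f s 0 * g' s 0) + (f' s 1 * g s 1 + f s 1 * g' s 1) := fun s => by ring
  simp only [e]
  rw [intervalIntegral.integral_add (hint 0) (hint 1), (hf.coord 0).integral_mul (hg.coord 0) ht,
    (hf.coord 1).integral_mul (hg.coord 1) ht]
  ring

/-! ### From weak derivatives to absolute continuity -/

section WeakDeriv

theorem setIntegral_Ioo_eq {X : Type*} [NormedAddCommGroup X] [NormedSpace ℝ X] (f : ℝ → X)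
    {a b : ℝ} (h : a ≤ b) : ∫ t in Ioo a b, f t = ∫ t in a..b, f t := by
  rw [intervalIntegral.integral_of_le h, integral_Ioc_eq_integral_Ioo]

variable {X : Type*} [NormedAddCommGroup X] [NormedSpace ℝ X] [CompleteSpace X]

/-- The fundamental lemma of the calculus of variations. It transfers the square integrability in
`MemH2` to the representative chosen by `weakDeriv`. -/
theorem HasWeakDeriv.unique {a b : ℝ} {u v v' : ℝ → X} (h : HasWeakDeriv a b u v)
    (h' : HasWeakDeriv a b u v') : v =ᵐ[volume.restrict (Ioo a b)] v' := by
  have key := isOpen_Ioo.ae_eq_zero_of_integral_contDiff_smul_eq_zero (μ := volume)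
    (f := fun t => v t - v' t) (U := Ioo a b) (h.2.1.sub h'.2.1) ?_
  · rw [EventuallyEq, ae_restrict_iff' measurableSet_Ioo]
    filter_upwards [key] with t ht hm
    exact sub_eq_zero.1 (ht hm)
  · intro g hg hs hsub
    have hz : ∀ w : ℝ → X, ∫ x, g x • w x = ∫ x in Ioo a b, g x • w x := fun w => by
      rw [setIntegral_eq_integral_of_forall_compl_eq_zero]
      intro x hx
      rw [image_eq_zero_of_notMem_tsupport (fun hx' => hx (hsub hx')), zero_smul]
    have hi : ∀ w : ℝ → X, LocallyIntegrableOn w (Ioo a b) →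
        IntegrableOn (fun x => g x • w x) (Ioo a b) := fun w hw => by
      have h1 : IntegrableOn (fun x => g x • w x) (tsupport g) :=
        (hw.integrableOn_compact_subset hsub hs.isCompact).continuousOn_smul
          hg.continuous.continuousOn hs.isCompact
      refine (integrableOn_iff_integrable_of_support_subset ?_).1 h1 |>.integrableOn
      intro x hx
      exact subset_tsupport g fun h0 => hx (by simp [h0])
    rw [hz]
    simp only [smul_sub]
    rw [integral_sub (hi _ h.2.1) (hi _ h'.2.1), sub_eq_zero]
    exact neg_injective ((h.2.2 g hg hs hsub).symm.trans (h'.2.2 g hg hs hsub))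

/-- A smooth function with compact support in `(0, 1)` and zero mean is the derivative of such a
function. -/
theorem exists_test_primitive {ψ : ℝ → ℝ} (h1 : ContDiff ℝ ∞ ψ) (h2 : HasCompactSupport ψ)
    (h3 : tsupport ψ ⊆ Ioo 0 1) (h4 : ∫ t in (0 : ℝ)..1, ψ t = 0) :
    ∃ φ : ℝ → ℝ, ContDiff ℝ ∞ φ ∧ HasCompactSupport φ ∧ tsupport φ ⊆ Ioo 0 1 ∧
      ∀ t, HasDerivAt φ (ψ t) t := by
  obtain ⟨a, b, ha, hb, hab⟩ : ∃ a b : ℝ, 0 < a ∧ b < 1 ∧ tsupport ψ ⊆ Icc a b := by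
    rcases (tsupport ψ).eq_empty_or_nonempty with he | hne
    · exact ⟨1, 0, by norm_num, by norm_num, by simp [he]⟩
    · obtain ⟨x, hx, hx'⟩ := h2.isCompact.exists_isLeast hne
      obtain ⟨y, hy, hy'⟩ := h2.isCompact.exists_isGreatest hne
      exact ⟨x, y, (h3 hx).1, (h3 hy).2, fun z hz => ⟨hx' hz, hy' hz⟩⟩
  have hd : ∀ t, HasDerivAt (fun t => ∫ s in (0 : ℝ)..t, ψ s) (ψ t) t := fun t =>
    intervalIntegral.integral_hasDerivAt_right (h1.continuous.intervalIntegrable _ _)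
      (h1.continuous.stronglyMeasurableAtFilter _ _) h1.continuous.continuousAt
  have hz : ∀ s, s ∉ Icc a b → ψ s = 0 := fun s hs =>
    image_eq_zero_of_notMem_tsupport fun h => hs (hab h)
  have hsupp : Function.support (fun t => ∫ s in (0 : ℝ)..t, ψ s) ⊆ Icc a b := by
    intro t ht
    by_contra hn
    apply ht
    rcases not_and_or.1 hn with h | h
    · have : ∫ s in (0 : ℝ)..t, ψ s = ∫ s in (0 : ℝ)..t, (0 : ℝ) :=
        intervalIntegral.integral_congr fun s hs => hz s fun hs' => by
          rcases le_max_iff.1 hs.2 with h' | h'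
          · linarith [hs'.1]
          · linarith [hs'.1]
      simp [this]
    · have h5 : ∫ s in t..1, ψ s = ∫ s in t..1, (0 : ℝ) :=
        intervalIntegral.integral_congr fun s hs => hz s fun hs' => by
          rcases min_le_iff.1 hs.1 with h' | h'
          · linarith [hs'.2]
          · linarith [hs'.2]
      have h6 := intervalIntegral.integral_add_adjacent_intervals
        (h1.continuous.intervalIntegrable (μ := volume) 0 t)
        (h1.continuous.intervalIntegrable t 1)
      rw [h4, h5] at h6
      simpa using h6
  have hts : tsupport (fun t => ∫ s in (0 : ℝ)..t, ψ s) ⊆ Icc a b :=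
    closure_minimal hsupp isClosed_Icc
  refine ⟨_, ?_, ?_, hts.trans (Icc_subset_Ioo ha hb), hd⟩
  · refine contDiff_infty_iff_deriv.2 ⟨fun t => (hd t).differentiableAt, ?_⟩
    rw [show deriv (fun t => ∫ s in (0 : ℝ)..t, ψ s) = ψ from funext fun t => (hd t).deriv]
    exact h1
  · exact isCompact_Icc.of_isClosed_subset (isClosed_tsupport _) hts

/-- A continuous function with integrable weak derivative is absolutely continuous. -/
theorem isPrimitive_of_hasWeakDeriv_real {u v : ℝ → ℝ} (hu : ContinuousOn u I)
    (hv : IntegrableOn v (Ioo 0 1)) (h : HasWeakDeriv 0 1 u v) : IsPrimitive u v := by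
  have h0 : (0 : ℝ) ∈ I := ⟨le_rfl, zero_le_one⟩
  have h1 : (1 : ℝ) ∈ I := ⟨zero_le_one, le_rfl⟩
  have hv' : IntervalIntegrable v volume 0 1 := by
    rw [intervalIntegrable_iff_integrableOn_Ioo_of_le zero_le_one]; exact hv
  set V : ℝ → ℝ := fun t => ∫ s in (0 : ℝ)..t, v s with hV
  have hVp : IsPrimitive V v := ⟨hv', fun t _ => by simp [hV]⟩
  -- Du Bois-Reymond: `w` has zero weak derivative, so it is orthogonal to all test functions of
  -- zero mean and must be constant.
  set w : ℝ → ℝ := fun t => u t - V t with hw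
  have hwc : ContinuousOn w I := hu.sub hVp.continuousOn
  have hwi : ∀ g : ℝ → ℝ, Continuous g → IntervalIntegrable (fun t => g t * w t) volume 0 1 :=
    fun g hg => ((hg.continuousOn.mul hwc).mono
      (by rw [uIcc_of_le (zero_le_one' ℝ)])).intervalIntegrable
  have mean_zero : ∀ ψ : ℝ → ℝ, ContDiff ℝ ∞ ψ → HasCompactSupport ψ → tsupport ψ ⊆ Ioo 0 1 →
      ∫ t in (0 : ℝ)..1, ψ t = 0 → ∫ t in (0 : ℝ)..1, ψ t * w t = 0 := by
    intro ψ p1 p2 p3 p4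
    obtain ⟨φ, q1, q2, q3, q4⟩ := exists_test_primitive p1 p2 p3 p4
    have hφp : IsPrimitive φ ψ :=
      isPrimitive_of_hasDerivWithinAt (fun s _ => (q4 s).hasDerivWithinAt)
        p1.continuous.continuousOn
    have e1 := hφp.integral_mul hVp h1
    have hb0 : φ 0 = 0 := image_eq_zero_of_notMem_tsupport fun h => lt_irrefl _ (q3 h).1
    have hb1 : φ 1 = 0 := image_eq_zero_of_notMem_tsupport fun h => lt_irrefl _ (q3 h).2
    have e2 := h.2.2 φ q1 q2 q3
    rw [setIntegral_Ioo_eq _ zero_le_one, setIntegral_Ioo_eq _ zero_le_one] at e2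
    simp only [(q4 _).deriv, smul_eq_mul] at e2
    have hi1 : IntervalIntegrable (fun t => ψ t * V t) volume 0 1 :=
      ((p1.continuous.continuousOn.mul hVp.continuousOn).mono
      (by rw [uIcc_of_le (zero_le_one' ℝ)])).intervalIntegrable
    have hi2 : IntervalIntegrable (fun t => φ t * v t) volume 0 1 :=
      hv'.continuousOn_mul q1.continuous.continuousOn
    have hi3 : IntervalIntegrable (fun t => ψ t * u t) volume 0 1 :=
      ((p1.continuous.continuousOn.mul hu).mono
      (by rw [uIcc_of_le (zero_le_one' ℝ)])).intervalIntegrable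
    rw [intervalIntegral.integral_add hi1 hi2, hb0, hb1] at e1
    simp only [hw, mul_sub]
    rw [intervalIntegral.integral_sub hi3 hi1]
    linarith
  -- A bump of mass one: subtracting `m * ψ₀` gives any test function of integral `m` zero mean. It
  -- also fixes the constant `k` that `w` must equal.
  obtain ⟨ψ₀, p1, p2, p3, p4⟩ : ∃ ψ : ℝ → ℝ, ContDiff ℝ ∞ ψ ∧ HasCompactSupport ψ ∧
      tsupport ψ ⊆ Ioo 0 1 ∧ ∫ t in (0 : ℝ)..1, ψ t = 1 := by
    let B : ContDiffBump (1 / 2 : ℝ) := ⟨1 / 8, 1 / 4, by norm_num, by norm_num⟩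
    have hsub : tsupport (B.normed volume) ⊆ Ioo 0 1 := by
      rw [B.tsupport_normed_eq, Real.closedBall_eq_Icc]
      exact Icc_subset_Ioo (by norm_num [B]) (by norm_num [B])
    refine ⟨B.normed volume, B.contDiff_normed, B.hasCompactSupport_normed, hsub, ?_⟩
    rw [← setIntegral_Ioo_eq _ zero_le_one, setIntegral_eq_integral_of_forall_compl_eq_zero,
      B.integral_normed]
    exact fun x hx => image_eq_zero_of_notMem_tsupport fun h => hx (hsub h)
  set k : ℝ := ∫ t in (0 : ℝ)..1, ψ₀ t * w t with hk
  have hae := isOpen_Ioo.ae_eq_zero_of_integral_contDiff_smul_eq_zero (μ := volume)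
    (f := fun t => w t - k) (U := Ioo (0 : ℝ) 1)
    (((hwc.sub continuousOn_const).mono Ioo_subset_Icc_self).locallyIntegrableOn
      measurableSet_Ioo) ?_
  · have hwk : ∀ t ∈ I, w t = k := by
      have hcl : EqOn w (fun _ => k) (Icc 0 1) := by
        refine Measure.eqOn_Icc_of_ae_eq volume zero_ne_one ?_ hwc continuousOn_const
        rw [EventuallyEq, ae_restrict_iff' measurableSet_Icc]
        have hne : ∀ x : ℝ, ∀ᵐ t ∂(volume : Measure ℝ), t ≠ x := fun x => by
          simp [ae_iff, measure_singleton]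
        filter_upwards [hae, hne 0, hne 1] with t ht h0 h1 hm
        exact sub_eq_zero.1 (ht ⟨lt_of_le_of_ne hm.1 h0.symm, lt_of_le_of_ne hm.2 h1⟩)
      exact hcl
    refine ⟨hv', fun t ht => ?_⟩
    have a1 := hwk t ht
    have a2 := hwk 0 h0
    simp only [hw, hV, intervalIntegral.integral_same] at a1 a2
    linarith
  · intro g g1 g2 g3
    have hz : ∫ x, g x • (w x - k) = ∫ x in (0 : ℝ)..1, g x • (w x - k) := by
      rw [← setIntegral_Ioo_eq _ zero_le_one, setIntegral_eq_integral_of_forall_compl_eq_zero]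
      intro x hx
      rw [image_eq_zero_of_notMem_tsupport (fun hx' => hx (g3 hx')), zero_smul]
    rw [hz]
    set m : ℝ := ∫ t in (0 : ℝ)..1, g t with hm
    have hmz := mean_zero (fun t => g t - m * ψ₀ t) (g1.sub (contDiff_const.mul p1))
      (g2.sub p2.mul_left)
      ((tsupport_sub _ _).trans (union_subset g3
        ((tsupport_mul_subset_right).trans p3))) ?_
    · have e : ∀ t, (g t - m * ψ₀ t) * w t = g t * w t - m * (ψ₀ t * w t) := fun t => by ring
      simp only [e] at hmz
      rw [intervalIntegral.integral_sub (hwi g g1.continuous)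
        ((hwi ψ₀ p1.continuous).const_mul m), intervalIntegral.integral_const_mul, ← hk] at hmz
      simp only [smul_eq_mul, mul_sub]
      rw [intervalIntegral.integral_sub (hwi g g1.continuous)
        ((g1.continuous.intervalIntegrable _ _).mul_const k),
        intervalIntegral.integral_mul_const, ← hm]
      exact hmz
    · rw [intervalIntegral.integral_sub (g1.continuous.intervalIntegrable _ _)
        ((p1.continuous.intervalIntegrable _ _).const_mul m),
        intervalIntegral.integral_const_mul, p4, ← hm]
      ring

theorem isPrimitive_of_hasWeakDeriv {u v : ℝ → Plane} (hu : ContinuousOn u I)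
    (hv : IntegrableOn v (Ioo 0 1)) (h : HasWeakDeriv 0 1 u v) : IsPrimitive u v := by
  have h0 : (0 : ℝ) ∈ I := ⟨le_rfl, zero_le_one⟩
  have hui : IntegrableOn u (Ioo 0 1) :=
    (hu.integrableOn_Icc (μ := volume)).mono_set Ioo_subset_Icc_self
  have hv' : IntervalIntegrable v volume 0 1 := by
    rw [intervalIntegrable_iff_integrableOn_Ioo_of_le zero_le_one]; exact hv
  have hcoord : ∀ i : Fin 2, IsPrimitive (fun t => u t i) (fun t => v t i) := by
    intro i
    set p : Plane →L[ℝ] ℝ := EuclideanSpace.proj i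
    have hpu : IntegrableOn (fun t => u t i) (Ioo 0 1) := p.integrable_comp hui
    have hpv : IntegrableOn (fun t => v t i) (Ioo 0 1) := p.integrable_comp hv
    refine isPrimitive_of_hasWeakDeriv_real (p.continuous.comp_continuousOn hu) hpv
      ⟨hpu.locallyIntegrableOn, hpv.locallyIntegrableOn, fun φ h1 h2 h3 => ?_⟩
    have hb : ∀ (ψ : ℝ → ℝ) (w : ℝ → Plane), Continuous ψ → HasCompactSupport ψ →
        IntegrableOn w (Ioo 0 1) → ∫ t in Ioo (0 : ℝ) 1, ψ t • (w t i)
          = p (∫ t in Ioo (0 : ℝ) 1, ψ t • w t) := by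
      intro ψ w hψ hs hw
      obtain ⟨C, hC⟩ := hψ.bounded_above_of_compact_support hs
      rw [← p.integral_comp_comm]
      · rfl
      · exact hw.bdd_smul C hψ.aestronglyMeasurable (Eventually.of_forall hC)
    rw [hb _ _ (h1.continuous_deriv (by simp)) h2.deriv hui, hb _ _ h1.continuous h2 hv,
      h.2.2 φ h1 h2 h3, map_neg]
  refine ⟨hv', fun t ht => ?_⟩
  have hvt : IntervalIntegrable v volume 0 t :=
    hv'.mono_set (by rw [uIcc_of_le (zero_le_one' ℝ)]; exact uIcc_subset_Icc h0 ht)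
  ext i
  have h2 : ∫ s in (0 : ℝ)..t, v s i = (∫ s in (0 : ℝ)..t, v s) i :=
    (EuclideanSpace.proj i : Plane →L[ℝ] ℝ).intervalIntegral_comp_comm hvt
  have h3 := (hcoord i).2 t ht
  rw [PiLp.add_apply, ← h2]
  exact h3

theorem hasWeakDeriv_weakDeriv {a b : ℝ} {u v : ℝ → X} (h : HasWeakDeriv a b u v) :
    HasWeakDeriv a b u (weakDeriv a b u) := by
  have hex : ∃ v, HasWeakDeriv a b u v := ⟨v, h⟩
  rw [weakDeriv, dif_pos hex]
  exact hex.choose_spec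

end WeakDeriv

/-! ### The Cauchy-Schwarz inequality for integrals -/

section CauchySchwarz

theorem integral_norm_mul_norm_le {α E F : Type*} [MeasurableSpace α] {μ : Measure α}
    [NormedAddCommGroup E] [NormedAddCommGroup F] {f : α → E} {g : α → F} (hf : MemLp f 2 μ)
    (hg : MemLp g 2 μ) :
    ∫ x, ‖f x‖ * ‖g x‖ ∂μ ≤ √(∫ x, ‖f x‖ ^ 2 ∂μ) * √(∫ x, ‖g x‖ ^ 2 ∂μ) := by
  have h := integral_mul_norm_le_Lp_mul_Lq (μ := μ) (f := fun x => ‖f x‖) (g := fun x => ‖g x‖)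
    (p := 2) (q := 2) ⟨by norm_num, by norm_num, by norm_num⟩
    (by simpa using hf.norm) (by simpa using hg.norm)
  simpa [Real.sqrt_eq_rpow] using h

variable {X : Type*} [NormedAddCommGroup X]

theorem integrable_norm_sq {α : Type*} [MeasurableSpace α] {μ : Measure α} {f : α → X}
    (hf : MemLp f 2 μ) : Integrable (fun x => ‖f x‖ ^ 2) μ := by
  simpa using hf.integrable_norm_pow (p := 2) (by norm_num)

theorem setIntegral_norm_le {v : ℝ → X} {a b : ℝ} (hab : a ≤ b)
    (hv : MemLp v 2 (volume.restrict (Ioo a b))) :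
    ∫ s in Ioo a b, ‖v s‖ ≤ √(b - a) * √(∫ s in Ioo a b, ‖v s‖ ^ 2) := by
  have h := integral_norm_mul_norm_le (memLp_const (μ := volume.restrict (Ioo a b)) (1 : ℝ)) hv
  simpa [hab] using h

theorem norm_integral_le_sqrt [NormedSpace ℝ X] {v : ℝ → X} {a b : ℝ} (hab : a ≤ b)
    (hv : MemLp v 2 (volume.restrict (Ioo a b))) :
    ‖∫ s in a..b, v s‖ ≤ √(b - a) * √(∫ s in Ioo a b, ‖v s‖ ^ 2) := by
  rw [← setIntegral_Ioo_eq _ hab]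
  exact (norm_integral_le_integral_norm _).trans (setIntegral_norm_le hab hv)

/-- The source of both 1/2-Hölder estimates: for `γ_s` in the curve parameter and for the affine
interpolants in time. -/
theorem norm_integral_le_sqrt_of_subset [NormedSpace ℝ X] {v : ℝ → X} {a b c d : ℝ} (hab : a ≤ b)
    (hsub : Ioo a b ⊆ Ioo c d) (hv : MemLp v 2 (volume.restrict (Ioo c d))) :
    ‖∫ s in a..b, v s‖ ≤ √(b - a) * √(∫ s in Ioo c d, ‖v s‖ ^ 2) := by
  refine (norm_integral_le_sqrt hab (hv.mono_measure (Measure.restrict_mono hsub le_rfl))).trans ?_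
  exact mul_le_mul_of_nonneg_left (Real.sqrt_le_sqrt (setIntegral_mono_set (integrable_norm_sq hv)
    (ae_of_all _ fun _ => by positivity) hsub.eventuallyLE)) (Real.sqrt_nonneg _)

end CauchySchwarz

/-! ### Geometry of the plane -/

section Plane

theorem norm_sq_plane (a : Plane) : ‖a‖ ^ 2 = a 0 ^ 2 + a 1 ^ 2 := by
  rw [← real_inner_self_eq_norm_sq, inner_plane]; ring

@[simp] theorem rot_apply_zero (a : Plane) : rot a 0 = -a 1 := by simp [rot]

@[simp] theorem rot_apply_one (a : Plane) : rot a 1 = a 0 := by simp [rot]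

theorem norm_rot (a : Plane) : ‖rot a‖ = ‖a‖ := by
  have h : ‖rot a‖ ^ 2 = ‖a‖ ^ 2 := by
    rw [norm_sq_plane, norm_sq_plane, rot_apply_zero, rot_apply_one]; ring
  exact (sq_eq_sq₀ (norm_nonneg _) (norm_nonneg _)).1 h

theorem inner_sq_add_inner_rot_sq (a b : Plane) :
    inner ℝ a b ^ 2 + inner ℝ a (rot b) ^ 2 = ‖a‖ ^ 2 * ‖b‖ ^ 2 := by
  rw [inner_plane, inner_plane, norm_sq_plane, norm_sq_plane, rot_apply_zero, rot_apply_one]; ring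

/-- Parseval in the orthogonal frame `c`, `rot c`. When `b ⟂ c`, it expresses `⟨a, b⟩` through
normal components only. -/
theorem inner_rot_mul_inner_rot (a b c : Plane) :
    inner ℝ a (rot c) * inner ℝ b (rot c) + inner ℝ a c * inner ℝ b c
      = inner ℝ a b * ‖c‖ ^ 2 := by
  simp only [inner_plane, norm_sq_plane, rot_apply_zero, rot_apply_one]; ring

theorem continuous_rot : Continuous rot := by
  unfold rot
  fun_prop

theorem rot_add (a b : Plane) : rot (a + b) = rot a + rot b := by
  ext i; fin_cases i <;> simp [rot]; ring

theorem rot_smul (r : ℝ) (a : Plane) : rot (r • a) = r • rot a := by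
  ext i; fin_cases i <;> simp [rot]

end Plane

/-! ### Regularity of admissible curves -/

section Curves

variable {γ : ℝ → Plane}

theorem ContDiffOn.hasDerivWithinAt_vel (h : ContDiffOn ℝ 1 γ I) {s : ℝ} (hs : s ∈ I) :
    HasDerivWithinAt γ (vel γ s) I s :=
  ((h.differentiableOn (by norm_num)) s hs).hasDerivWithinAt

theorem ContDiffOn.continuousOn_vel (h : ContDiffOn ℝ 1 γ I) : ContinuousOn (vel γ) I :=
  h.continuousOn_derivWithin (uniqueDiffOn_Icc zero_lt_one) le_rfl

theorem ContDiffOn.isPrimitive (h : ContDiffOn ℝ 1 γ I) : IsPrimitive γ (vel γ) :=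
  isPrimitive_of_hasDerivWithinAt (fun _ hs => ContDiffOn.hasDerivWithinAt_vel h hs)
    (ContDiffOn.continuousOn_vel h)

theorem MemH2.memLp_acc (h : MemH2 γ) : MemLp (acc γ) 2 (volume.restrict (Ioo 0 1)) := by
  obtain ⟨_, a, ha, hw⟩ := h
  exact ha.ae_eq (hw.unique (hasWeakDeriv_weakDeriv hw))

theorem MemH2.isPrimitive_vel (h : MemH2 γ) : IsPrimitive (vel γ) (acc γ) := by
  have ha := h.memLp_acc
  obtain ⟨hc, a, _, hw⟩ := h
  exact isPrimitive_of_hasWeakDeriv (ContDiffOn.continuousOn_vel hc)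
    (ha.integrable (by norm_num)) (hasWeakDeriv_weakDeriv hw)

/-- A curve of zero length has zero velocity, so its endpoints would coincide. -/
theorem length_pos (h : γ ∈ AC) : 0 < length γ := by
  obtain ⟨hH, hL, hne⟩ := h
  have h0 : 0 ≤ length γ := by rw [← hL 0 ⟨le_rfl, zero_le_one⟩]; exact norm_nonneg _
  refine h0.lt_of_ne' fun hz => hne ?_
  have h1 := (ContDiffOn.isPrimitive hH.1).2 1 ⟨zero_le_one, le_rfl⟩
  rw [h1, intervalIntegral.integral_congr (g := fun _ => 0)]
  · simp
  · intro s hs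
    rw [uIcc_of_le zero_le_one] at hs
    have := hL s hs
    rw [hz] at this
    exact norm_eq_zero.1 this

theorem norm_sub_le_length (h : γ ∈ AC) : ‖γ 1 - γ 0‖ ≤ length γ := by
  obtain ⟨hH, hL, hne⟩ := h
  rw [(ContDiffOn.isPrimitive hH.1).sub_eq ⟨le_rfl, zero_le_one⟩ ⟨zero_le_one, le_rfl⟩]
  exact intervalIntegral.norm_integral_le_integral_norm zero_le_one

theorem ae_eq_zero_of_integral_eq_zero {q : ℝ → ℝ} (hq : IntervalIntegrable q volume 0 1)
    (h : ∀ t ∈ I, ∫ s in (0 : ℝ)..t, q s = 0) : ∀ᵐ t ∂volume.restrict (Ioo (0 : ℝ) 1), q t = 0 := by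
  rw [ae_restrict_iff' measurableSet_Ioo]
  filter_upwards [hq.ae_hasDerivAt_integral] with x hx hm
  have h1 := hx (by rw [uIcc_of_le zero_le_one]; exact Ioo_subset_Icc_self hm) 0 left_mem_uIcc
  have h2 : HasDerivAt (fun x => ∫ t in (0 : ℝ)..x, q t) 0 x := by
    refine (hasDerivAt_const x (0 : ℝ)).congr_of_eventuallyEq ?_
    filter_upwards [Icc_mem_nhds hm.1 hm.2] with y hy using h y hy
  exact h1.unique h2

/-- Differentiate `|γ_s|² = L²`. As `γ_s` is only absolutely continuous, the product rule is used in
integrated form on every `[0, t]`. -/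
theorem inner_acc_vel (h : γ ∈ AC) :
    ∀ᵐ s ∂volume.restrict (Ioo (0 : ℝ) 1), inner ℝ (acc γ s) (vel γ s) = 0 := by
  obtain ⟨hH, hL, hne⟩ := h
  have hp := hH.isPrimitive_vel
  have hint : IntervalIntegrable (fun s => inner ℝ (acc γ s) (vel γ s)) volume 0 1 := by
    have hsub : uIcc (0 : ℝ) 1 ⊆ I := by rw [uIcc_of_le (zero_le_one' ℝ)]
    simp only [inner_plane]
    exact ((hp.coord 0).1.mul_continuousOn ((hp.coord 0).continuousOn.mono hsub)).add
      ((hp.coord 1).1.mul_continuousOn ((hp.coord 1).continuousOn.mono hsub))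
  refine ae_eq_zero_of_integral_eq_zero hint fun t ht => ?_
  have h1 := hp.integral_inner hp ht
  simp only [real_inner_self_eq_norm_sq, hL t ht, hL 0 ⟨le_rfl, zero_le_one⟩, sub_self,
    real_inner_comm (acc γ _) (vel γ _)] at h1
  simp only [← two_mul, intervalIntegral.integral_const_mul] at h1
  simpa using h1

theorem integral_curvature (h : γ ∈ AC) :
    ∫ s in (0 : ℝ)..1, curvature γ s ^ 2 * ‖vel γ s‖
      = (∫ s in Ioo (0 : ℝ) 1, ‖acc γ s‖ ^ 2) / length γ ^ 3 := by
  have hL := length_pos h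
  rw [← setIntegral_Ioo_eq _ zero_le_one, ← integral_div]
  refine integral_congr_ae ?_
  filter_upwards [inner_acc_vel h, ae_restrict_mem measurableSet_Ioo] with s hs hm
  have h1 := inner_sq_add_inner_rot_sq (acc γ s) (vel γ s)
  have h2 := h.2.1 s (Ioo_subset_Icc_self hm)
  rw [hs, h2] at h1
  simp only [curvature, h2, div_pow]
  have h3 : inner ℝ (acc γ s) (rot (vel γ s)) ^ 2 = ‖acc γ s‖ ^ 2 * length γ ^ 2 := by linarith
  rw [h3]
  field_simp

/-- The energy controls the length from above and below and the bending energy. -/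
theorem exists_energy_bounds {ε : ℝ} (hε : 0 < ε) (E₀ : ℝ) : ∃ l Λ M : ℝ, 0 < l ∧ 0 < Λ ∧ 0 < M ∧
    ∀ γ ∈ AC, energy ε γ ≤ E₀ → l ≤ length γ ∧ length γ ≤ Λ ∧
      √(∫ s in Ioo (0 : ℝ) 1, ‖acc γ s‖ ^ 2) ≤ M := by
  obtain ⟨E₁, hE0, hE1⟩ : ∃ E₁, E₀ ≤ E₁ ∧ 1 ≤ E₁ := ⟨_, le_max_left E₀ 1, le_max_right _ _⟩
  have hE2 : 0 < E₁ := by linarith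
  refine ⟨Real.exp (-E₁), 2 * E₁, √(2 * E₁ * (2 * E₁) ^ 3 / ε), Real.exp_pos _, by positivity,
    by positivity, fun γ hγ hE => ?_⟩
  have hE' : energy ε γ ≤ E₁ := hE.trans hE0
  have hL := length_pos hγ
  have hpos : 0 < ‖γ 1 - γ 0‖ := norm_pos_iff.2 (sub_ne_zero.2 hγ.2.2.symm)
  have hlog : Real.log ‖γ 1 - γ 0‖ ≤ Real.log (length γ) :=
    Real.log_le_log hpos (norm_sub_le_length hγ)
  have hlog1 : Real.log (length γ) ≤ length γ - 1 := Real.log_le_sub_one_of_pos hL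
  -- This gives `E ≥ L / 2`, hence the upper length bound. The lower one comes from `E ≥ -log L`,
  -- and the bending bound from `L - log L ≥ 0`.
  have hlog2 : Real.log (length γ) ≤ length γ / 2 := by
    have h1 := Real.log_le_sub_one_of_pos (half_pos hL)
    rw [Real.log_div hL.ne' two_ne_zero] at h1
    have := Real.log_two_lt_d9
    linarith
  have hA : 0 ≤ ∫ s in Ioo (0 : ℝ) 1, ‖acc γ s‖ ^ 2 := integral_nonneg fun _ => by positivity
  rw [energy, integral_curvature hγ] at hE'
  generalize (∫ s in Ioo (0 : ℝ) 1, ‖acc γ s‖ ^ 2) = A at *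
  generalize length γ = L at *
  generalize Real.log ‖γ 1 - γ 0‖ = d at *
  have hnn : 0 ≤ ε / 2 * (A / L ^ 3) := by positivity
  have hup : L ≤ 2 * E₁ := by linarith
  refine ⟨?_, hup, ?_⟩
  · rw [← Real.le_log_iff_exp_le hL]
    linarith
  · refine Real.sqrt_le_sqrt ?_
    have h1 : ε / 2 * (A / L ^ 3) ≤ E₁ := by linarith
    have h2 : A * ε ≤ 2 * E₁ * L ^ 3 := by
      have : ε / 2 * (A / L ^ 3)
        = A * ε / 2 / L ^ 3 := by ring
      rw [this, div_le_iff₀ (by positivity)] at h1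
      linarith
    rw [le_div_iff₀ hε]
    refine h2.trans ?_
    gcongr

theorem norm_vel_sub_le (h : MemH2 γ) {M : ℝ}
    (hM : √(∫ s in Ioo (0 : ℝ) 1, ‖acc γ s‖ ^ 2) ≤ M) {s t : ℝ} (hs : s ∈ I) (ht : t ∈ I) :
    ‖vel γ t - vel γ s‖ ≤ M * √|t - s| := by
  wlog hst : s ≤ t generalizing s t
  · rw [norm_sub_rev, abs_sub_comm]
    exact this ht hs (le_of_not_ge hst)
  rw [h.isPrimitive_vel.sub_eq hs ht, abs_of_nonneg (by linarith), mul_comm]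
  refine (norm_integral_le_sqrt_of_subset hst (Ioo_subset_Ioo hs.1 ht.2) h.memLp_acc).trans ?_
  gcongr

end Curves

/-! ### The dissipation controls the `L²` distance -/

section Dissipation

theorem dissipation_self (γ : ℝ → Plane) : dissipation γ γ = 0 := by simp [dissipation]

variable {γ γ' : ℝ → Plane}

theorem dissipation_nonneg (h : γ ∈ AC) (h' : γ' ∈ AC) : 0 ≤ dissipation γ γ' := by
  have := length_pos h
  have := length_pos h'
  have h1 : 0 ≤ ∫ s in (0 : ℝ)..1, inner ℝ (γ s - γ' s) (rot (vel γ' s)) ^ 2 :=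
    intervalIntegral.integral_nonneg zero_le_one fun _ _ => by positivity
  have h2 : 0 ≤ ∫ s in (0 : ℝ)..1, inner ℝ (γ s - γ' s) (rot (vel γ s)) ^ 2 :=
    intervalIntegral.integral_nonneg zero_le_one fun _ _ => by positivity
  unfold dissipation
  positivity

theorem dissipation_terms_le (h : γ ∈ AC) (h' : γ' ∈ AC) :
    ∫ s in (0 : ℝ)..1, inner ℝ (γ s - γ' s) (rot (vel γ' s)) ^ 2
        ≤ 4 * length γ' * dissipation γ γ' ∧
    ∫ s in (0 : ℝ)..1, inner ℝ (γ s - γ' s) (rot (vel γ s)) ^ 2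
        ≤ 4 * length γ * dissipation γ γ' ∧
    ‖γ 0 - γ' 0‖ ^ 2 ≤ 2 * dissipation γ γ' ∧ ‖γ 1 - γ' 1‖ ^ 2 ≤ 2 * dissipation γ γ' := by
  have hl := length_pos h
  have hl' := length_pos h'
  have h1 : 0 ≤ ∫ s in (0 : ℝ)..1, inner ℝ (γ s - γ' s) (rot (vel γ' s)) ^ 2 :=
    intervalIntegral.integral_nonneg zero_le_one fun _ _ => by positivity
  have h2 : 0 ≤ ∫ s in (0 : ℝ)..1, inner ℝ (γ s - γ' s) (rot (vel γ s)) ^ 2 :=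
    intervalIntegral.integral_nonneg zero_le_one fun _ _ => by positivity
  unfold dissipation
  set A := ∫ s in (0 : ℝ)..1, inner ℝ (γ s - γ' s) (rot (vel γ' s)) ^ 2
  set B := ∫ s in (0 : ℝ)..1, inner ℝ (γ s - γ' s) (rot (vel γ s)) ^ 2
  have hA : 0 ≤ 1 / (4 * length γ') * A := by positivity
  have hB : 0 ≤ 1 / (4 * length γ) * B := by positivity
  have h3 : 0 ≤ ‖γ 0 - γ' 0‖ ^ 2 := by positivity
  have h4 : 0 ≤ ‖γ 1 - γ' 1‖ ^ 2 := by positivity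
  refine ⟨?_, ?_, by linarith, by linarith⟩
  · calc A = 4 * length γ' * (1 / (4 * length γ') * A) := by field_simp
      _ ≤ _ := by gcongr; linarith
  · calc B = 4 * length γ * (1 / (4 * length γ) * B) := by field_simp
      _ ≤ _ := by gcongr; linarith

/-- Since `γ_ss` is normal to the curve, `⟨f, γ_ss⟩` involves only the normal component of `f`, the
one controlled by the dissipation: pointwise `|⟨f, γ_ss⟩| ≤ |⟨f, rot γ_s⟩| |γ_ss| / L`.
Cauchy-Schwarz does the rest. -/
theorem integral_abs_inner_acc_le (h : γ ∈ AC) {f : ℝ → Plane} (hf : ContinuousOn f I) :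
    IntegrableOn (fun s => inner ℝ (f s) (acc γ s)) (Ioo 0 1) ∧
    ∫ s in Ioo (0 : ℝ) 1, |inner ℝ (f s) (acc γ s)| ≤ 1 / length γ *
      (√(∫ s in Ioo (0 : ℝ) 1, ‖acc γ s‖ ^ 2) *
        √(∫ s in (0 : ℝ)..1, inner ℝ (f s) (rot (vel γ s)) ^ 2)) := by
  have hL := length_pos h
  have ha := h.1.memLp_acc
  have hpc : ContinuousOn (fun s => inner ℝ (f s) (rot (vel γ s))) I :=
    hf.inner (continuous_rot.comp_continuousOn (ContDiffOn.continuousOn_vel h.1.1))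
  have hp : MemLp (fun s => inner ℝ (f s) (rot (vel γ s))) 2 (volume.restrict (Ioo (0 : ℝ) 1)) := by
    obtain ⟨C, hC⟩ := isCompact_Icc.exists_bound_of_continuousOn hpc
    refine MemLp.of_bound ((hpc.mono Ioo_subset_Icc_self).aestronglyMeasurable measurableSet_Ioo)
      C ?_
    filter_upwards [ae_restrict_mem measurableSet_Ioo] with s hs using hC s (Ioo_subset_Icc_self hs)
  have hint : IntegrableOn (fun s => inner ℝ (f s) (acc γ s)) (Ioo 0 1) := by
    obtain ⟨C, hC⟩ := isCompact_Icc.exists_bound_of_continuousOn hf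
    refine Integrable.mono' ((ha.integrable (by norm_num)).norm.const_mul C)
      (((hf.mono Ioo_subset_Icc_self).aestronglyMeasurable measurableSet_Ioo).inner
        ha.aestronglyMeasurable) ?_
    filter_upwards [ae_restrict_mem measurableSet_Ioo] with s hs
    refine (norm_inner_le_norm _ _).trans ?_
    gcongr
    exact hC s (Ioo_subset_Icc_self hs)
  refine ⟨hint, ?_⟩
  have hcs := integral_norm_mul_norm_le ha hp
  have e : ∫ s in (0 : ℝ)..1, inner ℝ (f s) (rot (vel γ s)) ^ 2
      = ∫ s in Ioo (0 : ℝ) 1, ‖inner ℝ (f s) (rot (vel γ s))‖ ^ 2 := by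
    rw [← setIntegral_Ioo_eq _ zero_le_one]
    simp
  rw [e]
  refine le_trans ?_ (mul_le_mul_of_nonneg_left hcs (by positivity))
  rw [← integral_const_mul]
  refine integral_mono_ae hint.abs ((ha.norm.integrable_mul hp.norm).const_mul _) ?_
  filter_upwards [inner_acc_vel h, ae_restrict_mem measurableSet_Ioo] with s hs hm
  have h2 := h.2.1 s (Ioo_subset_Icc_self hm)
  have h1 := inner_rot_mul_inner_rot (f s) (acc γ s) (vel γ s)
  rw [hs, h2, mul_zero, add_zero] at h1
  have h3 : |inner ℝ (acc γ s) (rot (vel γ s))| ≤ ‖acc γ s‖ * length γ := by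
    refine (abs_real_inner_le_norm _ _).trans_eq ?_
    rw [norm_rot, h2]
  have h4 : |inner ℝ (f s) (acc γ s)| * length γ ^ 2
      = |inner ℝ (f s) (rot (vel γ s))| * |inner ℝ (acc γ s) (rot (vel γ s))| := by
    rw [← abs_mul, h1, abs_mul, abs_of_nonneg (sq_nonneg (length γ))]
  have h5 : |inner ℝ (f s) (acc γ s)| * length γ ^ 2
      ≤ |inner ℝ (f s) (rot (vel γ s))| * (‖acc γ s‖ * length γ) := by
    rw [h4]; gcongr
  simp only [Real.norm_eq_abs]
  rw [one_div, ← div_eq_inv_mul, le_div_iff₀ hL]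
  refine le_of_mul_le_mul_right ?_ hL
  linarith

end Dissipation

/-- Under the angle constraint, the dissipation controls the squared `L²` distance of curves of
bounded energy. -/
theorem exists_dissipation_bound {l Λ M : ℝ} (hl : 0 < l) (hΛ : 0 < Λ) (hM : 0 < M) :
    ∃ C, 0 < C ∧ ∀ γ γ' : ℝ → Plane, γ' ∈ AC → γ ∈ ACAngle γ' →
      l ≤ length γ → length γ ≤ Λ → √(∫ s in Ioo (0 : ℝ) 1, ‖acc γ s‖ ^ 2) ≤ M →
      l ≤ length γ' → length γ' ≤ Λ → √(∫ s in Ioo (0 : ℝ) 1, ‖acc γ' s‖ ^ 2) ≤ M →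
      ∫ s in Ioo (0 : ℝ) 1, ‖γ s - γ' s‖ ^ 2 ≤ C * dissipation γ γ' := by
  -- With `r = √D`: `k r` bounds the `L²` norms of the normal components, `K1 r` the curvature
  -- remainder `R`, `K2 r` the endpoint values of `G`, `K3 r` the length difference and `K4 r` all
  -- of `G`.
  obtain ⟨k, hk⟩ : ∃ k, k = 2 * √Λ := ⟨_, rfl⟩
  obtain ⟨K1, hK1⟩ : ∃ K, K = 2 * Λ * (M * k / l) := ⟨_, rfl⟩
  obtain ⟨K2, hK2⟩ : ∃ K, K = 4 * Λ ^ 2 := ⟨_, rfl⟩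
  obtain ⟨K3, hK3⟩ : ∃ K, K = (2 * K2 + K1) / l ^ 2 := ⟨_, rfl⟩
  obtain ⟨K4, hK4⟩ : ∃ K, K = K2 + K3 * (2 * Λ ^ 2) + K1 := ⟨_, rfl⟩
  have hkp : 0 < k := by rw [hk]; positivity
  have hK1p : 0 < K1 := by rw [hK1]; positivity
  have hK2p : 0 < K2 := by rw [hK2]; positivity
  have hK3p : 0 < K3 := by rw [hK3]; positivity
  have hK4p : 0 < K4 := by rw [hK4]; positivity
  refine ⟨(K4 ^ 2 + 16 * Λ ^ 3) / (2 * l ^ 4), by positivity,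
    fun γ γ' hγ' hγa hlγ hΛγ hMγ hlγ' hΛγ' hMγ' => ?_⟩
  have h0 : (0 : ℝ) ∈ I := ⟨le_rfl, zero_le_one⟩
  have h1 : (1 : ℝ) ∈ I := ⟨zero_le_one, le_rfl⟩
  obtain ⟨hγ, hang⟩ := hγa
  have hD0 := dissipation_nonneg hγ hγ'
  obtain ⟨t1, t2, t3, t4⟩ := dissipation_terms_le hγ hγ'
  have hLp := length_pos hγ
  have hLp' := length_pos hγ'
  have hv := hγ.2.1
  have hv' := hγ'.2.1
  have hfp : IsPrimitive (fun s => γ s - γ' s) (fun s => vel γ s - vel γ' s) :=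
    (ContDiffOn.isPrimitive hγ.1.1).sub (ContDiffOn.isPrimitive hγ'.1.1)
  have hfc := hfp.continuousOn
  have hvp := hγ.1.isPrimitive_vel
  have hvp' := hγ'.1.isPrimitive_vel
  obtain ⟨i1, b1⟩ := integral_abs_inner_acc_le hγ hfc
  obtain ⟨i2, b2⟩ := integral_abs_inner_acc_le hγ' hfc
  have hwp := (hvp.const_smul (length γ')).add (hvp'.const_smul (length γ))
  have hG := fun t (ht : t ∈ I) => hfp.integral_inner hwp ht
  obtain ⟨r, hr0, hr⟩ : ∃ r, 0 ≤ r ∧ r ^ 2 = dissipation γ γ' :=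
    ⟨√(dissipation γ γ'), Real.sqrt_nonneg _, Real.sq_sqrt hD0⟩
  rw [← hr] at t1 t2 t3 t4 ⊢
  generalize length γ = L at *
  generalize length γ' = L' at *
  have hsq : ∀ {x L : ℝ}, L ≤ Λ → x ≤ 4 * L * r ^ 2 → √x ≤ k * r := fun {x L} h hx => by
    rw [Real.sqrt_le_left (by positivity), hk, mul_pow, mul_pow, Real.sq_sqrt hΛ.le]
    have : L * r ^ 2 ≤ Λ * r ^ 2 := by gcongr
    linarith
  have c1 : ∫ s in Ioo (0 : ℝ) 1, |inner ℝ (γ s - γ' s) (acc γ s)| ≤ M * k / l * r := by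
    refine b1.trans ?_
    calc _ ≤ 1 / l * (M * (k * r)) := by gcongr; exact hsq hΛγ t2
      _ = _ := by ring
  have c2 : ∫ s in Ioo (0 : ℝ) 1, |inner ℝ (γ s - γ' s) (acc γ' s)| ≤ M * k / l * r := by
    refine b2.trans ?_
    calc _ ≤ 1 / l * (M * (k * r)) := by gcongr; exact hsq hΛγ' t1
      _ = _ := by ring
  have cR : ∀ {g : ℝ → ℝ} {t : ℝ}, t ∈ I → IntegrableOn g (Ioo 0 1) →
      |∫ s in (0 : ℝ)..t, g s| ≤ ∫ s in Ioo (0 : ℝ) 1, |g s| := by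
    intro g t ht hg
    rw [← setIntegral_Ioo_eq _ ht.1]
    refine abs_integral_le_integral_abs.trans ?_
    exact setIntegral_mono_set hg.abs (ae_of_all _ fun _ => abs_nonneg _)
      (Ioo_subset_Ioo le_rfl ht.2).eventuallyLE
  have iI : ∀ {g : ℝ → ℝ} {t : ℝ}, t ∈ I → IntegrableOn g (Ioo 0 1) →
      IntervalIntegrable g volume 0 t := by
    intro g t ht hg
    rw [intervalIntegrable_iff_integrableOn_Ioo_of_le ht.1]
    exact hg.mono_set (Ioo_subset_Ioo le_rfl ht.2)
  -- The weights in `w = L' γ_s + L γ'_s` are chosen so that `⟨γ_s - γ'_s, w⟩ = (L - L') κ`; the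
  -- angle constraint makes `κ ≥ l²`.
  obtain ⟨κ, hκ⟩ : ∃ κ : ℝ → ℝ, κ = fun s => L * L' + inner ℝ (vel γ s) (vel γ' s) := ⟨_, rfl⟩
  have hκl : ∀ s ∈ I, l ^ 2 ≤ κ s := fun s hs => by
    have := hang s hs
    have : l * l ≤ L * L' := by gcongr
    simp only [hκ]; linarith
  have hκu : ∀ s ∈ I, κ s ≤ 2 * Λ ^ 2 := fun s hs => by
    have e1 : inner ℝ (vel γ s) (vel γ' s) ≤ L * L' := by
      rw [← hv s hs, ← hv' s hs]; exact real_inner_le_norm _ _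
    have : L * L' ≤ Λ * Λ := by gcongr
    simp only [hκ]; linarith
  have hκc : ContinuousOn κ I := by
    rw [hκ]
    exact continuousOn_const.add (hvp.continuousOn.inner hvp'.continuousOn)
  have hκi : ∀ t ∈ I, IntervalIntegrable κ volume 0 t := fun t ht =>
    (hκc.mono (uIcc_subset_Icc h0 ht)).intervalIntegrable
  obtain ⟨R, hR⟩ : ∃ R : ℝ → ℝ, R = fun t => L' * (∫ s in (0 : ℝ)..t, inner ℝ (γ s - γ' s) (acc γ s))
      + L * ∫ s in (0 : ℝ)..t, inner ℝ (γ s - γ' s) (acc γ' s) := ⟨_, rfl⟩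
  have hRb : ∀ t ∈ I, |R t| ≤ K1 * r := fun t ht => by
    have d1 := (cR ht i1).trans c1
    have d2 := (cR ht i2).trans c2
    have hp : 0 ≤ M * k / l * r := by positivity
    rw [hR, hK1]
    refine (abs_add_le _ _).trans ?_
    rw [abs_mul, abs_mul, abs_of_pos hLp, abs_of_pos hLp']
    calc _ ≤ Λ * (M * k / l * r) + Λ * (M * k / l * r) := by gcongr
      _ = _ := by ring
  obtain ⟨w, hw⟩ : ∃ w : ℝ → Plane, w = fun s => L' • vel γ s + L • vel γ' s := ⟨_, rfl⟩
  obtain ⟨G, hGd⟩ : ∃ G : ℝ → ℝ, G = fun s => inner ℝ (γ s - γ' s) (w s) := ⟨_, rfl⟩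
  have hGt : ∀ t ∈ I, G t - G 0 = (L - L') * (∫ s in (0 : ℝ)..t, κ s) + R t := by
    intro t ht
    simp only [hGd, hw]
    rw [← hG t ht, hR]
    simp only
    rw [← intervalIntegral.integral_const_mul, ← intervalIntegral.integral_const_mul,
      ← intervalIntegral.integral_const_mul, ← intervalIntegral.integral_add
        ((iI ht i1).const_mul L') ((iI ht i2).const_mul L),
      ← intervalIntegral.integral_add ((hκi t ht).const_mul _)
        (((iI ht i1).const_mul L').add ((iI ht i2).const_mul L))]
    refine intervalIntegral.integral_congr fun s hs => ?_
    have hs' : s ∈ I := uIcc_subset_Icc h0 ht hs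
    have e1 := real_inner_self_eq_norm_sq (vel γ s)
    have e2 := real_inner_self_eq_norm_sq (vel γ' s)
    rw [hv s hs'] at e1
    rw [hv' s hs'] at e2
    simp only [hκ, inner_add_right, inner_smul_right, inner_sub_left, e1, e2,
      real_inner_comm (vel γ s) (vel γ' s)]
    ring
  have hwn : ∀ s ∈ I, ‖w s‖ ≤ 2 * Λ ^ 2 := fun s hs => by
    simp only [hw]
    refine (norm_add_le _ _).trans ?_
    rw [norm_smul, norm_smul, hv s hs, hv' s hs, Real.norm_of_nonneg hLp.le,
      Real.norm_of_nonneg hLp'.le]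
    have : L' * L ≤ Λ * Λ := by gcongr
    linarith
  have hend : ∀ s ∈ I, ‖γ s - γ' s‖ ^ 2 ≤ 2 * r ^ 2 → |G s| ≤ K2 * r := fun s hs h => by
    have h2 : ‖γ s - γ' s‖ ≤ 2 * r := by
      refine le_of_sq_le_sq ?_ (by positivity)
      linarith [sq_nonneg r]
    rw [hGd, hK2]
    refine (abs_real_inner_le_norm _ _).trans ?_
    calc _ ≤ 2 * r * (2 * Λ ^ 2) := by gcongr; exact hwn s hs
      _ = _ := by ring
  have hG0 := hend 0 h0 t3
  have hG1 := hend 1 h1 t4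
  have hκint : l ^ 2 ≤ ∫ s in (0 : ℝ)..1, κ s := by
    have := intervalIntegral.integral_mono_on zero_le_one
      (intervalIntegrable_const (c := l ^ 2)) (hκi 1 h1) hκl
    simpa using this
  -- At `t = 1` the identity for `G` determines `L - L'`: the endpoint values of `G` and `R` are
  -- known to be `O(r)`, and `∫ κ` is bounded below.
  have hLL : |L - L'| ≤ K3 * r := by
    have e := hGt 1 h1
    have e2 : |L - L'| * l ^ 2 ≤ (2 * K2 + K1) * r := by
      calc |L - L'| * l ^ 2 ≤ |L - L'| * ∫ s in (0 : ℝ)..1, κ s := by gcongr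
        _ = |(L - L') * ∫ s in (0 : ℝ)..1, κ s| := by
          rw [abs_mul, abs_of_nonneg (le_trans (by positivity) hκint)]
        _ = |G 1 - G 0 - R 1| := by rw [e]; congr 1; ring
        _ ≤ |G 1| + |G 0| + |R 1| := (abs_sub _ _).trans (by gcongr; exact abs_sub _ _)
        _ ≤ K2 * r + K2 * r + K1 * r := by gcongr; exact hRb 1 h1
        _ = _ := by ring
    rw [hK3, div_mul_eq_mul_div, le_div_iff₀ (by positivity)]
    exact e2
  have hGb : ∀ t ∈ I, |G t| ≤ K4 * r := fun t ht => by
    have e := hGt t ht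
    have hk1 : |∫ s in (0 : ℝ)..t, κ s| ≤ 2 * Λ ^ 2 := by
      have := intervalIntegral.norm_integral_le_of_norm_le_const (a := 0) (b := t) (f := κ)
        (C := 2 * Λ ^ 2) fun s hs => by
          have hs' : s ∈ I := uIcc_subset_Icc h0 ht (uIoc_subset_uIcc hs)
          rw [Real.norm_of_nonneg ((sq_nonneg l).trans (hκl s hs'))]
          exact hκu s hs'
      refine this.trans ?_
      rw [sub_zero, abs_of_nonneg ht.1]
      exact mul_le_of_le_one_right (by positivity) ht.2
    calc |G t| = |G 0 + ((L - L') * (∫ s in (0 : ℝ)..t, κ s) + R t)| := by rw [← e]; congr 1; ring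
      _ ≤ |G 0| + (|L - L'| * |∫ s in (0 : ℝ)..t, κ s| + |R t|) := by
        rw [← abs_mul]
        exact (abs_add_le _ _).trans (by gcongr; exact abs_add_le _ _)
      _ ≤ K2 * r + (K3 * r * (2 * Λ ^ 2) + K1 * r) := by gcongr; exact hRb t ht
      _ = _ := by rw [hK4]; ring
  have hpt : ∀ s ∈ I, ‖γ s - γ' s‖ ^ 2 * (2 * l ^ 4) ≤ K4 ^ 2 * r ^ 2
      + 2 * Λ ^ 2 * (inner ℝ (γ s - γ' s) (rot (vel γ s)) ^ 2
        + inner ℝ (γ s - γ' s) (rot (vel γ' s)) ^ 2) := by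
    intro s hs
    have e1 := real_inner_self_eq_norm_sq (vel γ s)
    have e2 := real_inner_self_eq_norm_sq (vel γ' s)
    rw [hv s hs] at e1
    rw [hv' s hs] at e2
    -- Here `‖w‖² = 2 L² L'² + 2 L L' ⟨γ_s, γ'_s⟩`, and the angle constraint rules out cancellation.
    have hwl : 2 * l ^ 4 ≤ ‖w s‖ ^ 2 := by
      have ea := hang s hs
      rw [← real_inner_self_eq_norm_sq]
      simp only [hw, inner_add_right, inner_smul_right, inner_add_left, real_inner_smul_left, e1,
        e2, real_inner_comm (vel γ s) (vel γ' s)]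
      have e3 : l ^ 2 * l ^ 2 ≤ L ^ 2 * L' ^ 2 := by gcongr
      have e4 : 0 ≤ L * L' * inner ℝ (vel γ s) (vel γ' s) := by positivity
      nlinarith
    -- Split the displacement along `w` and `rot w`: the first component is `G`, bounded pointwise,
    -- and the second is a combination of the two integrands in `D`.
    have hx := inner_sq_add_inner_rot_sq (γ s - γ' s) (w s)
    have hg : inner ℝ (γ s - γ' s) (w s) ^ 2 ≤ K4 ^ 2 * r ^ 2 := by
      have := hGb s hs
      rw [hGd] at this
      rw [← mul_pow, ← sq_abs]
      gcongr
    have hy : inner ℝ (γ s - γ' s) (rot (w s)) = L' * inner ℝ (γ s - γ' s) (rot (vel γ s))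
        + L * inner ℝ (γ s - γ' s) (rot (vel γ' s)) := by
      rw [hw, rot_add, rot_smul, rot_smul, inner_add_right, inner_smul_right, inner_smul_right]
    rw [hy] at hx
    generalize inner ℝ (γ s - γ' s) (rot (vel γ s)) = p at *
    generalize inner ℝ (γ s - γ' s) (rot (vel γ' s)) = q at *
    calc _ ≤ ‖γ s - γ' s‖ ^ 2 * ‖w s‖ ^ 2 := by gcongr
      _ ≤ K4 ^ 2 * r ^ 2 + (L' * p + L * q) ^ 2 := by rw [← hx]; gcongr
      _ ≤ K4 ^ 2 * r ^ 2 + 2 * ((L' * p) ^ 2 + (L * q) ^ 2) := by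
        gcongr; exact add_sq_le
      _ = K4 ^ 2 * r ^ 2 + 2 * (L' ^ 2 * p ^ 2 + L ^ 2 * q ^ 2) := by ring
      _ ≤ K4 ^ 2 * r ^ 2 + 2 * (Λ ^ 2 * p ^ 2 + Λ ^ 2 * q ^ 2) := by gcongr
      _ = _ := by ring
  have hci : ∀ {g : ℝ → ℝ}, ContinuousOn g I → IntervalIntegrable g volume 0 1 := fun hg =>
    hg.intervalIntegrable_of_Icc zero_le_one
  have hpc : ContinuousOn (fun s => inner ℝ (γ s - γ' s) (rot (vel γ s)) ^ 2) I :=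
    (hfc.inner (continuous_rot.comp_continuousOn hvp.continuousOn)).pow 2
  have hpc' : ContinuousOn (fun s => inner ℝ (γ s - γ' s) (rot (vel γ' s)) ^ 2) I :=
    (hfc.inner (continuous_rot.comp_continuousOn hvp'.continuousOn)).pow 2
  have hfin := intervalIntegral.integral_mono_on zero_le_one
    ((hci (hfc.norm.pow 2)).mul_const (2 * l ^ 4))
    (intervalIntegrable_const.add (((hci hpc).add (hci hpc')).const_mul (2 * Λ ^ 2))) hpt
  rw [intervalIntegral.integral_mul_const, intervalIntegral.integral_add intervalIntegrable_const
    (((hci hpc).add (hci hpc')).const_mul (2 * Λ ^ 2)), intervalIntegral.integral_const,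
    intervalIntegral.integral_const_mul (2 * Λ ^ 2),
    intervalIntegral.integral_add (hci hpc) (hci hpc')] at hfin
  rw [setIntegral_Ioo_eq _ zero_le_one, div_mul_eq_mul_div, le_div_iff₀ (by positivity)]
  refine hfin.trans ?_
  simp only [sub_zero, one_smul]
  have e1 : 4 * L * r ^ 2 ≤ 4 * Λ * r ^ 2 := by gcongr
  have e2 : 4 * L' * r ^ 2 ≤ 4 * Λ * r ^ 2 := by gcongr
  calc _ ≤ K4 ^ 2 * r ^ 2 + 2 * Λ ^ 2 * (4 * Λ * r ^ 2 + 4 * Λ * r ^ 2) := by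
        gcongr <;> linarith
    _ = _ := by ring

/-! ### A priori estimates for the discrete scheme -/

/-- Uniform bounds along minimizing movements. -/
theorem exists_minimizingMovement_bounds {ε : ℝ} (hε : 0 < ε) {γ₀ : ℝ → Plane} (hγ₀ : γ₀ ∈ AC) :
    ∃ M C : ℝ, 0 < M ∧ 0 < C ∧ ∀ τ : ℝ, 0 < τ → ∀ c, IsMinimizingMovement ε τ γ₀ c →
      (∀ n, ContDiffOn ℝ 1 (c n) I) ∧
      (∀ n, ∀ s ∈ I, ∀ t ∈ I, ‖vel (c n) t - vel (c n) s‖ ≤ M * √|t - s|) ∧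
      (∀ N, ∑ n ∈ Finset.range N,
        ∫ s in Ioo (0 : ℝ) 1, ‖c (n + 1) s - c n s‖ ^ 2 ≤ C * τ) ∧
      (∀ N, ∑ n ∈ Finset.range N, ‖c (n + 1) 0 - c n 0‖ ^ 2 ≤ C * τ) ∧
      (∀ N, ∑ n ∈ Finset.range N, ‖c (n + 1) 1 - c n 1‖ ^ 2 ≤ C * τ) := by
  obtain ⟨l, Λ, M, hl, hΛ, hM, hb⟩ := exists_energy_bounds hε (energy ε γ₀)
  obtain ⟨C, hC, hdis⟩ := exists_dissipation_bound hl hΛ hM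
  obtain ⟨m, hm⟩ : ∃ m : ℝ, ∀ γ ∈ AC, m ≤ energy ε γ := by
    refine ⟨0, fun γ hγ => ?_⟩
    have hL := length_pos hγ
    have hpos : 0 < ‖γ 1 - γ 0‖ := norm_pos_iff.2 (sub_ne_zero.2 hγ.2.2.symm)
    have h1 : Real.log ‖γ 1 - γ 0‖ ≤ Real.log (length γ) :=
      Real.log_le_log hpos (norm_sub_le_length hγ)
    have h2 : Real.log (length γ) ≤ length γ - 1 := Real.log_le_sub_one_of_pos hL
    have h3 : 0 ≤ ∫ s in (0 : ℝ)..1, curvature γ s ^ 2 * ‖vel γ s‖ :=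
      intervalIntegral.integral_nonneg zero_le_one fun _ _ => by positivity
    have h4 := mul_nonneg (half_pos hε).le h3
    unfold energy
    linarith
  set B := |energy ε γ₀ - m| + 1
  have hB : 0 < B := by positivity
  refine ⟨M, max C 2 * B, hM, by positivity, fun τ hτ c hc => ?_⟩
  obtain ⟨hc0, hc1⟩ := hc
  have hAC : ∀ n, c n ∈ AC := fun n => by
    cases n with
    | zero => rw [hc0]; exact hγ₀
    | succ n => exact (hc1 n).1.1
  -- Minimality is tested against `c n` itself, which satisfies its own angle constraint and has
  -- zero dissipation.
  have hstep : ∀ n, dissipation (c (n + 1)) (c n) ≤ τ * (energy ε (c n) - energy ε (c (n + 1))) := by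
    intro n
    have hself : c n ∈ ACAngle (c n) :=
      ⟨hAC n, fun s _ => by rw [real_inner_self_eq_norm_sq]; positivity⟩
    have h := (isMinOn_iff.1 (hc1 n).2) (c n) hself
    rw [dissipation_self, mul_zero, add_zero, one_div, inv_mul_eq_div] at h
    have h2 : dissipation (c (n + 1)) (c n) / τ ≤ energy ε (c n) - energy ε (c (n + 1)) := by
      linarith
    rw [div_le_iff₀ hτ] at h2
    linarith
  have hD0 : ∀ n, 0 ≤ dissipation (c (n + 1)) (c n) := fun n =>
    dissipation_nonneg (hAC _) (hAC _)
  have hE : ∀ n, energy ε (c n) ≤ energy ε γ₀ := by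
    intro n
    induction n with
    | zero => rw [hc0]
    | succ n ih =>
      have := (hD0 n).trans (hstep n)
      have := (mul_nonneg_iff_of_pos_left hτ).1 this
      linarith
  have hbn := fun n => hb (c n) (hAC n) (hE n)
  have hsum : ∀ N, ∑ n ∈ Finset.range N, dissipation (c (n + 1)) (c n) ≤ B * τ := by
    intro N
    have h1 : ∑ n ∈ Finset.range N, dissipation (c (n + 1)) (c n)
        ≤ τ * (energy ε (c 0) - energy ε (c N)) := by
      refine (Finset.sum_le_sum fun n _ => hstep n).trans_eq ?_
      rw [← Finset.mul_sum, Finset.sum_range_sub']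
    have h2 : energy ε (c 0) - energy ε (c N) ≤ B := by
      rw [hc0]
      have := hm (c N) (hAC N)
      have := le_abs_self (energy ε γ₀ - m)
      simp only [B]
      linarith
    calc _ ≤ τ * (energy ε (c 0) - energy ε (c N)) := h1
      _ ≤ τ * B := by gcongr
      _ = B * τ := mul_comm _ _
  -- A common constant for the three sums: `C` serves the `L²` distance, and `2` cancels the factor
  -- `1/2` of the endpoint terms.
  have hgen : ∀ (a : ℕ → ℝ) (K : ℝ), 0 ≤ K → K ≤ max C 2 →
      (∀ n, a n ≤ K * dissipation (c (n + 1)) (c n)) →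
      ∀ N, ∑ n ∈ Finset.range N, a n ≤ max C 2 * B * τ := by
    intro a K hK hKm ha N
    calc ∑ n ∈ Finset.range N, a n
        ≤ ∑ n ∈ Finset.range N, K * dissipation (c (n + 1)) (c n) :=
          Finset.sum_le_sum fun n _ => ha n
      _ = K * ∑ n ∈ Finset.range N, dissipation (c (n + 1)) (c n) := by rw [Finset.mul_sum]
      _ ≤ K * (B * τ) := by gcongr; exact hsum N
      _ ≤ max C 2 * (B * τ) := by gcongr
      _ = _ := by ring
  refine ⟨fun n => (hAC n).1.1, fun n s hs t ht => norm_vel_sub_le (hAC n).1 (hbn n).2.2 hs ht,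
    hgen _ C hC.le (le_max_left _ _) fun n => ?_, hgen _ 2 zero_le_two (le_max_right _ _) fun n => ?_,
    hgen _ 2 zero_le_two (le_max_right _ _) fun n => ?_⟩
  · obtain ⟨b1, b2, b3⟩ := hbn (n + 1)
    obtain ⟨d1, d2, d3⟩ := hbn n
    exact hdis _ _ (hAC n) (hc1 n).1 b1 b2 b3 d1 d2 d3
  · exact (dissipation_terms_le (hAC (n + 1)) (hAC n)).2.2.1
  · exact (dissipation_terms_le (hAC (n + 1)) (hAC n)).2.2.2

/-! ### Piecewise affine interpolation -/

section Interpolation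

/-- The piecewise affine interpolation of a sequence, with time step `τ`. -/
noncomputable def affInterp {X : Type*} [AddCommGroup X] [Module ℝ X] (τ : ℝ) (x : ℕ → X) (t : ℝ) :
    X :=
  (1 - (t / τ - ⌊t / τ⌋₊)) • x ⌊t / τ⌋₊ + (t / τ - ⌊t / τ⌋₊) • x ⌈t / τ⌉₊

/-- The derivative of the piecewise affine interpolation, apart from the nodes. -/
noncomputable def affDeriv {X : Type*} [AddCommGroup X] [Module ℝ X] (τ : ℝ) (x : ℕ → X) (t : ℝ) :
    X :=
  τ⁻¹ • (x (⌊t / τ⌋₊ + 1) - x ⌊t / τ⌋₊)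

/-- At a node floor and ceiling agree, so the formula holds on the closed step interval. Consecutive
pieces therefore match, which gives continuity. -/
theorem affInterp_eq {X : Type*} [AddCommGroup X] [Module ℝ X] {τ : ℝ} (hτ : 0 < τ) (x : ℕ → X)
    {n : ℕ} {t : ℝ} (ht : t ∈ Icc (n * τ) ((n + 1) * τ)) :
    affInterp τ x t = x n + (t / τ - n) • (x (n + 1) - x n) := by
  have h1 : (n : ℝ) ≤ t / τ := by rw [le_div_iff₀ hτ]; exact ht.1
  have h2 : t / τ ≤ n + 1 := by rw [div_le_iff₀ hτ]; exact ht.2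
  have h0 : 0 ≤ t / τ := n.cast_nonneg.trans h1
  unfold affInterp
  rcases h1.eq_or_lt with h | h
  · rw [← h]
    simp
  rcases h2.eq_or_lt with h' | h'
  · rw [h']
    have e1 : ⌊(n : ℝ) + 1⌋₊ = n + 1 := by exact_mod_cast Nat.floor_natCast (R := ℝ) (n + 1)
    have e2 : ⌈(n : ℝ) + 1⌉₊ = n + 1 := by exact_mod_cast Nat.ceil_natCast (R := ℝ) (n + 1)
    rw [e1, e2]
    simp
  · have e1 : ⌊t / τ⌋₊ = n := (Nat.floor_eq_iff h0).2 ⟨h.le, h'⟩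
    have e2 : ⌈t / τ⌉₊ = n + 1 := by
      rw [Nat.ceil_eq_iff (by omega)]
      exact ⟨by simpa using h, by simpa using h'.le⟩
    rw [e1, e2]
    module

theorem exists_mem_node_interval {τ : ℝ} (hτ : 0 < τ) {t : ℝ} (ht : 0 ≤ t) :
    ∃ n : ℕ, t ∈ Ico (n * τ) ((n + 1) * τ) := by
  refine ⟨⌊t / τ⌋₊, ?_, ?_⟩
  · rw [← le_div_iff₀ hτ]; exact Nat.floor_le (by positivity)
  · rw [← div_lt_iff₀ hτ]; exact Nat.lt_floor_add_one _

theorem affDeriv_eq {X : Type*} [AddCommGroup X] [Module ℝ X] {τ : ℝ} (hτ : 0 < τ) (x : ℕ → X)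
    {n : ℕ} {t : ℝ} (ht : t ∈ Ico (n * τ) ((n + 1) * τ)) :
    affDeriv τ x t = τ⁻¹ • (x (n + 1) - x n) := by
  have h1 : (n : ℝ) ≤ t / τ := by rw [le_div_iff₀ hτ]; exact ht.1
  have h2 : t / τ < n + 1 := by rw [div_lt_iff₀ hτ]; exact ht.2
  rw [affDeriv, (Nat.floor_eq_iff (n.cast_nonneg.trans h1)).2 ⟨h1, h2⟩]

theorem affInterp_zero {X : Type*} [AddCommGroup X] [Module ℝ X] (τ : ℝ) (x : ℕ → X) :
    affInterp τ x 0 = x 0 := by simp [affInterp]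

theorem memLp_of_continuousOn {X : Type*} [NormedAddCommGroup X] {u : ℝ → X} {a b : ℝ}
    (hu : ContinuousOn u (Icc a b)) :
    MemLp u 2 (volume.restrict (Ioo a b)) := by
  obtain ⟨C, hC⟩ := isCompact_Icc.exists_bound_of_continuousOn hu
  refine MemLp.of_bound ((hu.mono Ioo_subset_Icc_self).aestronglyMeasurable measurableSet_Ioo) C ?_
  filter_upwards [ae_restrict_mem measurableSet_Ioo] with t ht using hC t (Ioo_subset_Icc_self ht)

theorem intervalIntegrable_of_memLp {X : Type*} [NormedAddCommGroup X] {v : ℝ → X}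
    {T a b : ℝ}
    (hv : MemLp v 2 (volume.restrict (Ioo 0 T))) (ha : 0 ≤ a) (hab : a ≤ b) (hb : b ≤ T) :
    IntervalIntegrable v volume a b := by
  rw [intervalIntegrable_iff_integrableOn_Ioo_of_le hab]
  have h : IntegrableOn v (Ioo 0 T) := hv.integrable (by norm_num)
  exact h.mono_set (Ioo_subset_Ioo ha hb)

variable {X : Type*} [NormedAddCommGroup X] [NormedSpace ℝ X]

theorem continuousOn_affInterp {τ : ℝ} (hτ : 0 < τ) (x : ℕ → X) (T : ℝ) :
    ContinuousOn (affInterp τ x) (Icc 0 T) := by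
  have key : ∀ N : ℕ, ContinuousOn (affInterp τ x) (Icc 0 (N * τ)) := by
    intro N
    induction N with
    | zero => simp
    | succ N ih =>
      have h1 : ContinuousOn (affInterp τ x) (Icc (N * τ) ((N + 1) * τ)) := by
        have : ContinuousOn (fun t : ℝ => x N + (t / τ - N) • (x (N + 1) - x N))
          (Icc (N * τ) ((N + 1) * τ)) := by fun_prop
        exact this.congr fun t ht => affInterp_eq hτ x ht
      have h2 : Icc 0 ((N + 1 : ℕ) * τ) = Icc 0 (N * τ) ∪ Icc (N * τ) ((N + 1) * τ) := by
        rw [Icc_union_Icc_eq_Icc (by positivity) (by gcongr; linarith)]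
        push_cast; rfl
      rw [h2]
      exact ih.union_of_isClosed h1 isClosed_Icc isClosed_Icc
  refine (key ⌈T / τ⌉₊).mono (Icc_subset_Icc le_rfl ?_)
  rw [← div_le_iff₀ hτ]
  exact Nat.le_ceil _

theorem hasDerivAt_affInterp {τ : ℝ} (hτ : 0 < τ) (x : ℕ → X) {t : ℝ} (ht : 0 ≤ t)
    (hn : t ∉ range fun n : ℕ => (n : ℝ) * τ) : HasDerivAt (affInterp τ x) (affDeriv τ x t) t := by
  obtain ⟨n, hnt⟩ := exists_mem_node_interval hτ ht
  rw [affDeriv_eq hτ x hnt]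
  have h1 : (n : ℝ) * τ < t := lt_of_le_of_ne hnt.1 fun h => hn ⟨n, h⟩
  have h2 : HasDerivAt (fun t : ℝ => x n + (t / τ - n) • (x (n + 1) - x n))
      (τ⁻¹ • (x (n + 1) - x n)) t := by
    have h3 : HasDerivAt (fun t : ℝ => t / τ - n) τ⁻¹ t := by
      simpa using ((hasDerivAt_id t).div_const τ).sub_const (n : ℝ)
    exact (h3.smul_const _).const_add _
  refine h2.congr_of_eventuallyEq ?_
  filter_upwards [Icc_mem_nhds h1 hnt.2] with s hs using affInterp_eq hτ x hs

theorem stronglyMeasurable_affDeriv (τ : ℝ) (x : ℕ → X) : StronglyMeasurable (affDeriv τ x) := by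
  have h : StronglyMeasurable fun n : ℕ => τ⁻¹ • (x (n + 1) - x n) := .of_discrete
  exact h.comp_measurable (Nat.measurable_floor.comp (measurable_id.div_const τ))

theorem exists_affDeriv_bound {τ : ℝ} (hτ : 0 < τ) (x : ℕ → X) (T : ℝ) :
    ∃ C, ∀ t ∈ Icc 0 T, ‖affDeriv τ x t‖ ≤ C := by
  refine ⟨∑ n ∈ Finset.range (⌊T / τ⌋₊ + 1), ‖τ⁻¹ • (x (n + 1) - x n)‖, fun t ht => ?_⟩
  refine Finset.single_le_sum (f := fun n => ‖τ⁻¹ • (x (n + 1) - x n)‖)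
    (fun _ _ => norm_nonneg _) (Finset.mem_range.2 (Nat.lt_succ_of_le (Nat.floor_le_floor ?_)))
  exact div_le_div_of_nonneg_right ht.2 hτ.le

theorem memLp_affDeriv {τ : ℝ} (hτ : 0 < τ) (x : ℕ → X) (T : ℝ) :
    MemLp (affDeriv τ x) 2 (volume.restrict (Ioo 0 T)) := by
  obtain ⟨C, hC⟩ := exists_affDeriv_bound hτ x T
  refine MemLp.of_bound (stronglyMeasurable_affDeriv τ x).aestronglyMeasurable C ?_
  filter_upwards [ae_restrict_mem measurableSet_Ioo] with t ht using hC t (Ioo_subset_Icc_self ht)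

theorem affInterp_sub_eq [CompleteSpace X] {τ : ℝ} (hτ : 0 < τ) (x : ℕ → X) {a b : ℝ} (ha : 0 ≤ a)
    (hab : a ≤ b) : affInterp τ x b - affInterp τ x a = ∫ t in a..b, affDeriv τ x t := by
  refine (integral_eq_of_hasDerivAt_off_countable_of_le _ _ hab
    (countable_range fun n : ℕ => (n : ℝ) * τ)
    ((continuousOn_affInterp hτ x b).mono (Icc_subset_Icc ha le_rfl))
    (fun t ht => hasDerivAt_affInterp hτ x (ha.trans ht.1.1.le) ht.2) ?_).symm
  exact intervalIntegrable_of_memLp (memLp_affDeriv hτ x b) ha hab le_rfl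

/-- On each step the derivative is constant and contributes `τ (‖Δx‖ / τ)² = ‖Δx‖² / τ`. The bound
does not depend on `T`. -/
theorem integral_affDeriv_sq_le {τ : ℝ} (hτ : 0 < τ) (x : ℕ → X) {C : ℝ}
    (hC : ∀ N, ∑ n ∈ Finset.range N, ‖x (n + 1) - x n‖ ^ 2 ≤ C * τ) (T : ℝ) :
    ∫ t in Ioo 0 T, ‖affDeriv τ x t‖ ^ 2 ≤ C := by
  obtain ⟨N, hN⟩ : ∃ N : ℕ, T ≤ N * τ := ⟨⌈T / τ⌉₊, by
    rw [← div_le_iff₀ hτ]; exact Nat.le_ceil _⟩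
  have hii : ∀ n < N, IntervalIntegrable (fun t => ‖affDeriv τ x t‖ ^ 2) volume
      ((n : ℕ) * τ) ((n + 1 : ℕ) * τ) := by
    intro n _
    rw [intervalIntegrable_iff_integrableOn_Ioo_of_le (by gcongr; linarith)]
    have h : IntegrableOn (fun t => ‖affDeriv τ x t‖ ^ 2) (Ioo 0 ((n + 1 : ℕ) * τ)) :=
      integrable_norm_sq (memLp_affDeriv hτ x _)
    exact h.mono_set (Ioo_subset_Ioo (by positivity) le_rfl)
  calc ∫ t in Ioo 0 T, ‖affDeriv τ x t‖ ^ 2 ≤ ∫ t in Ioo 0 (N * τ), ‖affDeriv τ x t‖ ^ 2 :=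
        setIntegral_mono_set (integrable_norm_sq (memLp_affDeriv hτ x _))
          (ae_of_all _ fun _ => by positivity) (Ioo_subset_Ioo le_rfl hN).eventuallyLE
    _ = ∫ t in ((0 : ℕ) * τ)..(N * τ), ‖affDeriv τ x t‖ ^ 2 := by
        rw [setIntegral_Ioo_eq _ (by positivity)]; simp
    _ = ∑ n ∈ Finset.range N, ∫ t in ((n : ℕ) * τ)..((n + 1 : ℕ) * τ), ‖affDeriv τ x t‖ ^ 2 :=
        (intervalIntegral.sum_integral_adjacent_intervals hii).symm
    _ = ∑ n ∈ Finset.range N, τ⁻¹ * ‖x (n + 1) - x n‖ ^ 2 := by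
        refine Finset.sum_congr rfl fun n _ => ?_
        rw [← setIntegral_Ioo_eq _ (by gcongr; linarith), setIntegral_congr_fun measurableSet_Ioo
          (g := fun _ => (τ⁻¹ * ‖x (n + 1) - x n‖) ^ 2)]
        · rw [setIntegral_const, measureReal_def, Real.volume_Ioo, ENNReal.toReal_ofReal]
          · push_cast
            simp only [smul_eq_mul]
            field_simp
            ring
          · push_cast; linarith
        · intro t ht
          simp only
          rw [affDeriv_eq hτ x (n := n) ⟨ht.1.le, by simpa using ht.2⟩, norm_smul, norm_inv,
            Real.norm_of_nonneg hτ.le]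
    _ = τ⁻¹ * ∑ n ∈ Finset.range N, ‖x (n + 1) - x n‖ ^ 2 := by rw [Finset.mul_sum]
    _ ≤ τ⁻¹ * (C * τ) := by gcongr; exact hC N
    _ = C := by field_simp

theorem norm_affInterp_sub_le [CompleteSpace X] {τ : ℝ} (hτ : 0 < τ) (x : ℕ → X) {C : ℝ}
    (hC : ∀ N, ∑ n ∈ Finset.range N, ‖x (n + 1) - x n‖ ^ 2 ≤ C * τ) {a b : ℝ} (ha : 0 ≤ a)
    (hb : 0 ≤ b) : ‖affInterp τ x b - affInterp τ x a‖ ≤ √|b - a| * √C := by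
  wlog hab : a ≤ b generalizing a b
  · rw [norm_sub_rev, abs_sub_comm]
    exact this hb ha (le_of_not_ge hab)
  rw [affInterp_sub_eq hτ x ha hab, abs_of_nonneg (by linarith)]
  refine (norm_integral_le_sqrt_of_subset hab (Ioo_subset_Ioo ha le_rfl)
    (memLp_affDeriv hτ x b)).trans ?_
  gcongr
  exact integral_affDeriv_sq_le hτ x hC b

/-- The product of the interpolant with a test function is continuous, differentiable off the
countable set of nodes, and zero at both ends; its derivative integrates to zero. -/
theorem hasWeakDeriv_affInterp [CompleteSpace X] {τ : ℝ} (hτ : 0 < τ) (x : ℕ → X) {T : ℝ}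
    (hT : 0 < T) : HasWeakDeriv 0 T (affInterp τ x) (affDeriv τ x) := by
  have hu := continuousOn_affInterp hτ x T
  have hui : IntegrableOn (affInterp τ x) (Ioo 0 T) :=
    (memLp_of_continuousOn hu).integrable (by norm_num)
  have hvi : IntegrableOn (affDeriv τ x) (Ioo 0 T) := (memLp_affDeriv hτ x T).integrable (by norm_num)
  refine ⟨hui.locallyIntegrableOn, hvi.locallyIntegrableOn, fun φ h1 h2 h3 => ?_⟩
  have hi : ∀ {ψ : ℝ → ℝ} {w : ℝ → X}, Continuous ψ → HasCompactSupport ψ →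
      IntegrableOn w (Ioo 0 T) → IntegrableOn (fun t => ψ t • w t) (Ioo 0 T) := by
    intro ψ w hψ hs hw
    obtain ⟨C, hC⟩ := hψ.bounded_above_of_compact_support hs
    exact hw.bdd_smul C hψ.aestronglyMeasurable (Eventually.of_forall hC)
  have hd : Continuous (deriv φ) := h1.continuous_deriv (by simp)
  have i1 := hi hd h2.deriv hui
  have i2 := hi h1.continuous h2 hvi
  rw [eq_neg_iff_add_eq_zero, ← integral_add i1 i2, setIntegral_Ioo_eq _ hT.le,
    integral_eq_of_hasDerivAt_off_countable_of_le (fun t => φ t • affInterp τ x t) _ hT.le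
      (countable_range fun n : ℕ => (n : ℝ) * τ) (h1.continuous.continuousOn.smul hu)
      (fun t ht => ?_)]
  · rw [image_eq_zero_of_notMem_tsupport fun h => lt_irrefl _ (h3 h).1,
      image_eq_zero_of_notMem_tsupport fun h => lt_irrefl _ (h3 h).2]
    simp
  · rw [intervalIntegrable_iff_integrableOn_Ioo_of_le hT.le]
    exact i1.add i2
  · have := ((h1.differentiable (by simp)) t).hasDerivAt.smul
      (hasDerivAt_affInterp hτ x ht.1.1.le ht.2)
    rwa [add_comm] at this

end Interpolation

/-! ### Curves with `1/2`-Hölder derivative -/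

section HalfHolder

/-- `f` is continuously differentiable on `I`, and its derivative is `1/2`-Hölder with constant
`M`. -/
def HalfHolder (M : ℝ) (f : ℝ → Plane) : Prop :=
  ContDiffOn ℝ 1 f I ∧ ∀ s ∈ I, ∀ t ∈ I, ‖vel f t - vel f s‖ ≤ M * √|t - s|

variable {f g : ℝ → Plane}

theorem ContDiffOn.vel_add (hf : ContDiffOn ℝ 1 f I) (hg : ContDiffOn ℝ 1 g I) {s : ℝ}
    (hs : s ∈ I) : vel (f + g) s = vel f s + vel g s :=
  ((ContDiffOn.hasDerivWithinAt_vel hf hs).add (ContDiffOn.hasDerivWithinAt_vel hg hs)).derivWithin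
    (uniqueDiffOn_Icc zero_lt_one s hs)

theorem ContDiffOn.vel_sub (hf : ContDiffOn ℝ 1 f I) (hg : ContDiffOn ℝ 1 g I) {s : ℝ}
    (hs : s ∈ I) : vel (f - g) s = vel f s - vel g s :=
  ((ContDiffOn.hasDerivWithinAt_vel hf hs).sub (ContDiffOn.hasDerivWithinAt_vel hg hs)).derivWithin
    (uniqueDiffOn_Icc zero_lt_one s hs)

theorem ContDiffOn.vel_smul (hf : ContDiffOn ℝ 1 f I) (r : ℝ) {s : ℝ}
    (hs : s ∈ I) : vel (r • f) s = r • vel f s :=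
  ((ContDiffOn.hasDerivWithinAt_vel hf hs).const_smul r).derivWithin
    (uniqueDiffOn_Icc zero_lt_one s hs)

theorem HalfHolder.sub {M N : ℝ} (hf : HalfHolder M f) (hg : HalfHolder N g) :
    HalfHolder (M + N) (f - g) := by
  refine ⟨hf.1.sub hg.1, fun s hs t ht => ?_⟩
  rw [ContDiffOn.vel_sub hf.1 hg.1 hs, ContDiffOn.vel_sub hf.1 hg.1 ht, sub_sub_sub_comm, add_mul]
  exact (norm_sub_le _ _).trans (add_le_add (hf.2 s hs t ht) (hg.2 s hs t ht))

theorem HalfHolder.convex {M r : ℝ} (hf : HalfHolder M f) (hg : HalfHolder M g) (h0 : 0 ≤ r)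
    (h1 : r ≤ 1) : HalfHolder M ((1 - r) • f + r • g) := by
  have c1 : ContDiffOn ℝ 1 ((1 - r) • f) I := contDiffOn_const.smul hf.1
  have c2 : ContDiffOn ℝ 1 (r • g) I := contDiffOn_const.smul hg.1
  refine ⟨c1.add c2, fun s hs t ht => ?_⟩
  rw [ContDiffOn.vel_add c1 c2 hs, ContDiffOn.vel_add c1 c2 ht, ContDiffOn.vel_smul hf.1 _ hs,
    ContDiffOn.vel_smul hf.1 _ ht, ContDiffOn.vel_smul hg.1 _ hs, ContDiffOn.vel_smul hg.1 _ ht]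
  have e : (1 - r) • vel f t + r • vel g t - ((1 - r) • vel f s + r • vel g s)
      = (1 - r) • (vel f t - vel f s) + r • (vel g t - vel g s) := by module
  rw [e]
  refine (norm_add_le _ _).trans ?_
  rw [norm_smul, norm_smul, Real.norm_of_nonneg h0, Real.norm_of_nonneg (by linarith : 0 ≤ 1 - r)]
  have a1 := hf.2 s hs t ht
  have a2 := hg.2 s hs t ht
  have h1' : 0 ≤ 1 - r := by linarith
  calc _ ≤ (1 - r) * (M * √|t - s|) + r * (M * √|t - s|) := by gcongr
    _ = _ := by ring

/-- Interpolation between `L²` and `C^{1,1/2}`. -/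
theorem HalfHolder.norm_vel_le {M K h : ℝ} (hM : 0 ≤ M) (hf : HalfHolder M f)
    (h0 : 0 < h) (h4 : h ≤ 1 / 4) (hL : √(∫ s in Ioo (0 : ℝ) 1, ‖f s‖ ^ 2) ≤ K * h ^ 2) {s : ℝ}
    (hs : s ∈ I) : ‖vel f s‖ ≤ √2 * (K + M) * √h := by
  -- A window of length `2h` inside `I` containing `s`; it fits to the right or to the left of `s`
  -- because `2h ≤ 1/2`.
  obtain ⟨p, hp0, hp1, hps, hsp⟩ : ∃ p, 0 ≤ p ∧ p + 2 * h ≤ 1 ∧ p ≤ s ∧ s ≤ p + 2 * h := by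
    rcases le_total s (1 / 2) with h' | h'
    · exact ⟨s, hs.1, by linarith, le_rfl, by linarith⟩
    · exact ⟨s - 2 * h, by linarith, by linarith [hs.2], by linarith, by linarith⟩
  have hsub : Icc p (p + 2 * h) ⊆ I := Icc_subset_Icc hp0 hp1
  have hprim := ContDiffOn.isPrimitive hf.1
  have hfc : ContinuousOn f I := hf.1.continuousOn
  have hvs : ∀ y ∈ Icc p (p + 2 * h), ‖vel f y - vel f s‖ ≤ M * √(2 * h) := fun y hy => by
    refine (hf.2 s hs y (hsub hy)).trans ?_
    gcongr
    rw [abs_le]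
    constructor <;> linarith [hy.1, hy.2]
  -- Compare the velocity with a difference quotient of step `h`. Integrated over `x`, the two
  -- values of `f` together cover the window once, and Cauchy-Schwarz brings in the `L²` norm.
  have hpt : ∀ x ∈ Icc p (p + h), h * ‖vel f s‖ ≤ ‖f (x + h)‖ + ‖f x‖ + h * (M * √(2 * h)) := by
    intro x hx
    have hx1 : x ∈ I := hsub ⟨hx.1, by linarith [hx.2]⟩
    have hx2 : x + h ∈ I := hsub ⟨by linarith [hx.1], by linarith [hx.2]⟩
    have e1 := hprim.sub_eq hx1 hx2
    have e2 : f (x + h) - f x - h • vel f s = ∫ y in x..(x + h), (vel f y - vel f s) := by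
      rw [intervalIntegral.integral_sub (hprim.intervalIntegrable hx1 hx2)
        intervalIntegrable_const, e1]
      simp
    have e3 : ‖f (x + h) - f x - h • vel f s‖ ≤ h * (M * √(2 * h)) := by
      rw [e2]
      refine (intervalIntegral.norm_integral_le_of_norm_le_const (C := M * √(2 * h))
        fun y hy => ?_).trans_eq ?_
      · rw [uIoc_of_le (by linarith)] at hy
        exact hvs y ⟨by linarith [hx.1, hy.1], by linarith [hx.2, hy.2]⟩
      · rw [add_sub_cancel_left, abs_of_pos h0, mul_comm]
    calc h * ‖vel f s‖ = ‖h • vel f s‖ := by rw [norm_smul, Real.norm_of_nonneg h0.le]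
      _ = ‖f (x + h) - f x - (f (x + h) - f x - h • vel f s)‖ := by congr 1; abel
      _ ≤ ‖f (x + h)‖ + ‖f x‖ + ‖f (x + h) - f x - h • vel f s‖ :=
        (norm_sub_le _ _).trans (by gcongr; exact norm_sub_le _ _)
      _ ≤ _ := by gcongr
  have hnc : ContinuousOn (fun x => ‖f x‖) I := hfc.norm
  have i1 : IntervalIntegrable (fun x => ‖f x‖) volume p (p + h) :=
    (hnc.mono ((Icc_subset_Icc le_rfl (by linarith)).trans hsub)).intervalIntegrable_of_Icc
      (by linarith)
  have i2 : IntervalIntegrable (fun x => ‖f x‖) volume (p + h) (p + h + h) :=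
    (hnc.mono ((Icc_subset_Icc (by linarith) (by linarith)).trans hsub)).intervalIntegrable_of_Icc
      (by linarith)
  have i3 : IntervalIntegrable (fun x => ‖f (x + h)‖) volume p (p + h) := by
    have := i2.comp_add_right h
    simpa using this
  have hint := intervalIntegral.integral_mono_on (by linarith : p ≤ p + h)
    intervalIntegrable_const ((i3.add i1).add intervalIntegrable_const) hpt
  rw [intervalIntegral.integral_add (i3.add i1) intervalIntegrable_const,
    intervalIntegral.integral_add i3 i1,
    intervalIntegral.integral_comp_add_right (fun x => ‖f x‖) h, add_comm
      (∫ x in (p + h)..(p + h + h), ‖f x‖),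
    intervalIntegral.integral_add_adjacent_intervals i1 i2] at hint
  simp only [intervalIntegral.integral_const, add_sub_cancel_left, smul_eq_mul] at hint
  have hcs : ∫ x in p..(p + h + h), ‖f x‖ ≤ √(2 * h) * (K * h ^ 2) := by
    have hm := memLp_of_continuousOn hfc
    have hm' : MemLp (fun x => ‖f x‖) 2 (volume.restrict (Ioo 0 1)) := hm.norm
    have := norm_integral_le_sqrt_of_subset (a := p) (b := p + h + h) (by linarith)
      (Ioo_subset_Ioo hp0 (by linarith)) hm'
    refine (le_abs_self _).trans (this.trans ?_)
    simp only [norm_norm]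
    rw [show p + h + h - p = 2 * h by ring]
    gcongr
  have hfin : h ^ 2 * ‖vel f s‖ ≤ h ^ 2 * (√2 * (K + M) * √h) := by
    rw [Real.sqrt_mul zero_le_two] at hcs hint
    nlinarith
  exact le_of_mul_le_mul_left hfin (by positivity)

/-- The value at `s` differs from every other value by at most the supremum of the velocity.
Averaging over `I` leaves the mean of `‖f‖`, at most `K h² ≤ K √h`. -/
theorem HalfHolder.norm_le {M K h : ℝ} (hM : 0 ≤ M) (hf : HalfHolder M f) (hK : 0 ≤ K)
    (h0 : 0 < h) (h4 : h ≤ 1 / 4) (hL : √(∫ s in Ioo (0 : ℝ) 1, ‖f s‖ ^ 2) ≤ K * h ^ 2) {s : ℝ}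
    (hs : s ∈ I) : ‖f s‖ ≤ (K + √2 * (K + M)) * √h := by
  have hprim := ContDiffOn.isPrimitive hf.1
  have hfc : ContinuousOn f I := hf.1.continuousOn
  have hnc : IntervalIntegrable (fun x => ‖f x‖) volume 0 1 :=
    hfc.norm.intervalIntegrable_of_Icc zero_le_one
  have hv := fun {s} (hs : s ∈ I) => hf.norm_vel_le hM h0 h4 hL hs
  have hB : 0 ≤ √2 * (K + M) * √h := by positivity
  have hpt : ∀ y ∈ Icc (0 : ℝ) 1, ‖f s‖ ≤ ‖f y‖ + √2 * (K + M) * √h := fun y hy => by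
    have e1 := hprim.sub_eq hy hs
    have e2 : ‖f s - f y‖ ≤ √2 * (K + M) * √h := by
      rw [e1]
      refine (intervalIntegral.norm_integral_le_of_norm_le_const (C := √2 * (K + M) * √h)
        fun z hz => hv (uIcc_subset_Icc hy hs (uIoc_subset_uIcc hz))).trans ?_
      refine mul_le_of_le_one_right hB ?_
      rw [abs_le]; constructor <;> linarith [hy.1, hy.2, hs.1, hs.2]
    calc ‖f s‖ = ‖f y + (f s - f y)‖ := by congr 1; abel
      _ ≤ ‖f y‖ + ‖f s - f y‖ := norm_add_le _ _
      _ ≤ _ := by gcongr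
  have hint := intervalIntegral.integral_mono_on zero_le_one intervalIntegrable_const
    (hnc.add intervalIntegrable_const) hpt
  rw [intervalIntegral.integral_add hnc intervalIntegrable_const] at hint
  simp only [intervalIntegral.integral_const, sub_zero, smul_eq_mul, one_mul] at hint
  have hcs : ∫ x in (0 : ℝ)..1, ‖f x‖ ≤ K * h ^ 2 := by
    have hm' : MemLp (fun x => ‖f x‖) 2 (volume.restrict (Ioo 0 1)) :=
      (memLp_of_continuousOn hfc).norm
    have := norm_integral_le_sqrt (a := (0 : ℝ)) (b := 1) zero_le_one hm'
    refine (le_abs_self _).trans (this.trans ?_)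
    simpa using hL
  have hh : h ^ 2 ≤ √h := by
    refine Real.le_sqrt_of_sq_le ?_
    calc (h ^ 2) ^ 2 = h * h ^ 3 := by ring
      _ ≤ h * 1 := by gcongr; exact pow_le_one₀ h0.le (by linarith)
      _ = h := mul_one h
  have : K * h ^ 2 ≤ K * √h := by gcongr
  linarith

end HalfHolder

/-! ### Curves as elements of `L²` -/

section ToL2

variable {f g : ℝ → Plane}

theorem toL2_eq (hf : ContinuousOn f I) : toL2 f = (memLp_of_continuousOn hf).toLp f := by
  rw [toL2, dif_pos]

theorem norm_toLp_two {α X : Type*} [MeasurableSpace α] [NormedAddCommGroup X] {μ : Measure α}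
    {u : α → X} (hu : MemLp u 2 μ) : ‖hu.toLp u‖ = √(∫ t, ‖u t‖ ^ 2 ∂μ) := by
  rw [Lp.norm_toLp, hu.eLpNorm_eq_integral_rpow_norm two_ne_zero ENNReal.ofNat_ne_top,
    ENNReal.toReal_ofReal (by positivity), Real.sqrt_eq_rpow]
  simp

theorem norm_toL2 (hf : ContinuousOn f I) : ‖toL2 f‖ = √(∫ s in Ioo (0 : ℝ) 1, ‖f s‖ ^ 2) := by
  rw [toL2_eq hf, norm_toLp_two]

theorem toL2_add (hf : ContinuousOn f I) (hg : ContinuousOn g I) :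
    toL2 (f + g) = toL2 f + toL2 g := by
  rw [toL2_eq hf, toL2_eq hg, toL2_eq (hf.add hg)]
  rfl

theorem toL2_smul (hf : ContinuousOn f I) (r : ℝ) : toL2 (r • f) = r • toL2 f := by
  have h : ContinuousOn (r • f) I := continuousOn_const.smul hf
  rw [toL2_eq hf, toL2_eq h]
  rfl

theorem toL2_sub (hf : ContinuousOn f I) (hg : ContinuousOn g I) :
    toL2 (f - g) = toL2 f - toL2 g := by
  rw [toL2_eq hf, toL2_eq hg, toL2_eq (hf.sub hg)]
  rfl

theorem norm_toL2_sub_sq (hf : ContinuousOn f I) (hg : ContinuousOn g I) :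
    ‖toL2 f - toL2 g‖ ^ 2 = ∫ s in Ioo (0 : ℝ) 1, ‖f s - g s‖ ^ 2 := by
  rw [← toL2_sub hf hg, norm_toL2 (hf.sub hg),
    Real.sq_sqrt (integral_nonneg fun _ => by positivity)]
  rfl

theorem norm_toL2_le (hf : ContinuousOn f I) {C : ℝ} (hC : 0 ≤ C) (h : ∀ s ∈ I, ‖f s‖ ≤ C) :
    ‖toL2 f‖ ≤ C := by
  rw [norm_toL2 hf, Real.sqrt_le_left hC]
  have h1 := norm_setIntegral_le_of_norm_le_const (μ := volume) (s := Ioo (0 : ℝ) 1)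
    (f := fun s => ‖f s‖ ^ 2) (C := C ^ 2) (by simp) fun s hs => by
      rw [Real.norm_of_nonneg (by positivity)]
      have := h s (Ioo_subset_Icc_self hs)
      gcongr
  exact (le_abs_self _).trans (by simpa using h1)

theorem toL2_pwAffine (τ : ℝ) {c : ℕ → ℝ → Plane} (hc : ∀ n, ContDiffOn ℝ 1 (c n) I) (t : ℝ) :
    toL2 (pwAffine τ c t) = affInterp τ (fun n => toL2 (c n)) t := by
  have h : ∀ n, ContinuousOn (c n) I := fun n => (hc n).continuousOn
  have h' : ∀ n, ∀ r : ℝ, ContinuousOn (r • c n) I := fun n r => continuousOn_const.smul (h n)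
  rw [pwAffine, toL2_add (h' _ _) (h' _ _), toL2_smul (h _), toL2_smul (h _)]
  rfl

theorem halfHolder_pwAffine {M τ : ℝ} {c : ℕ → ℝ → Plane} (hτ : 0 < τ)
    (hc : ∀ n, HalfHolder M (c n)) {t : ℝ} (ht : 0 ≤ t) : HalfHolder M (pwAffine τ c t) :=
  (hc _).convex (hc _) (by linarith [Nat.floor_le (div_nonneg ht hτ.le)])
    (by linarith [Nat.lt_floor_add_one (t / τ)])

/-- The piecewise affine interpolation is `1/8`-Hölder in time with values in `C¹`. -/
theorem exists_pwAffine_holder {M C : ℝ} (hM : 0 < M) (hC : 0 < C) {T : ℝ} (hT : 0 < T) :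
    ∃ B, 0 < B ∧ ∀ τ, 0 < τ → ∀ c : ℕ → ℝ → Plane, (∀ n, HalfHolder M (c n)) →
      (∀ N, ∑ n ∈ Finset.range N, ∫ s in Ioo (0 : ℝ) 1, ‖c (n + 1) s - c n s‖ ^ 2 ≤ C * τ) →
      ∀ a ∈ Icc 0 T, ∀ b ∈ Icc 0 T, ∀ s ∈ I,
        ‖pwAffine τ c b s - pwAffine τ c a s‖ ≤ B * |b - a| ^ (1 / 8 : ℝ) ∧
        ‖vel (pwAffine τ c b) s - vel (pwAffine τ c a) s‖ ≤ B * |b - a| ^ (1 / 8 : ℝ) := by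
  -- The interpolation inequality is applied with `h = (y/2)²`, `y = (|b-a|/T)^(1/8)`. The
  -- normalisation by `T` ensures `h ≤ 1/4`, and the factor `16` turns `√|b-a| = √T y⁴` into a
  -- multiple of `h²`.
  obtain ⟨K, hK⟩ : ∃ K, K = 16 * (√T * √C) := ⟨_, rfl⟩
  have hKp : 0 < K := by rw [hK]; positivity
  obtain ⟨A, hA⟩ : ∃ A, A = K + √2 * (K + (M + M)) := ⟨_, rfl⟩
  have hAp : 0 < A := by rw [hA]; positivity
  refine ⟨A / 2 / T ^ (1 / 8 : ℝ), by positivity, fun τ hτ c hc hsum a ha b hb s hs => ?_⟩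
  have hcd : ∀ n, ContDiffOn ℝ 1 (c n) I := fun n => (hc n).1
  have hua := halfHolder_pwAffine hτ hc ha.1
  have hub := halfHolder_pwAffine hτ hc hb.1
  have hf := hub.sub hua
  have hrw : vel (pwAffine τ c b) s - vel (pwAffine τ c a) s
      = vel (pwAffine τ c b - pwAffine τ c a) s := (ContDiffOn.vel_sub hub.1 hua.1 hs).symm
  rcases eq_or_ne a b with rfl | hne
  · simp
  have hd : 0 < |b - a| := abs_pos.2 (sub_ne_zero.2 hne.symm)
  have hdT : |b - a| ≤ T := by rw [abs_le]; constructor <;> linarith [ha.1, ha.2, hb.1, hb.2]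
  obtain ⟨y, hy⟩ : ∃ y, y = (|b - a| / T) ^ (1 / 8 : ℝ) := ⟨_, rfl⟩
  have hy0 : 0 < y := by rw [hy]; positivity
  have hy1 : y ≤ 1 := by
    rw [hy]
    exact Real.rpow_le_one (by positivity) ((div_le_one hT).2 hdT) (by norm_num)
  have hy8 : y ^ 8 = |b - a| / T := by
    rw [hy, ← Real.rpow_natCast, ← Real.rpow_mul (by positivity)]
    norm_num
  have hyd : y = |b - a| ^ (1 / 8 : ℝ) / T ^ (1 / 8 : ℝ) := by
    rw [hy, Real.div_rpow hd.le hT.le]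
  have hsq : √|b - a| = √T * y ^ 4 := by
    rw [Real.sqrt_eq_iff_eq_sq (by positivity) (by positivity), mul_pow, Real.sq_sqrt hT.le,
      ← pow_mul, hy8]
    field_simp
  have hL : √(∫ s in Ioo (0 : ℝ) 1, ‖(pwAffine τ c b - pwAffine τ c a) s‖ ^ 2)
      ≤ K * ((y / 2) ^ 2) ^ 2 := by
    rw [← norm_toL2 hf.1.continuousOn, toL2_sub hub.1.continuousOn hua.1.continuousOn,
      toL2_pwAffine τ hcd, toL2_pwAffine τ hcd]
    refine (norm_affInterp_sub_le hτ _ (C := C) (fun N => ?_) ha.1 hb.1).trans_eq ?_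
    · refine le_trans (le_of_eq (Finset.sum_congr rfl fun n _ => ?_)) (hsum N)
      exact norm_toL2_sub_sq (hcd _).continuousOn (hcd _).continuousOn
    · rw [hsq, hK]; ring
  have hh0 : 0 < (y / 2) ^ 2 := by positivity
  have hh1 : (y / 2) ^ 2 ≤ 1 / 4 := by nlinarith
  have hMM : 0 ≤ M + M := by positivity
  have e : A / 2 / T ^ (1 / 8 : ℝ) * |b - a| ^ (1 / 8 : ℝ) = A * √((y / 2) ^ 2) := by
    rw [Real.sqrt_sq (by positivity), hyd]; ring
  rw [e, hrw]
  refine ⟨?_, ?_⟩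
  · rw [hA]
    exact hf.norm_le hMM hKp.le hh0 hh1 hL hs
  · refine (hf.norm_vel_le hMM hh0 hh1 hL hs).trans ?_
    rw [hA]
    gcongr
    linarith

end ToL2

/-! ### Compactness of equicontinuous sequences -/

/-- The Arzelà-Ascoli theorem for sequences on a separable space. -/
theorem exists_subseq_tendstoLocallyUniformly {X Y : Type*} [TopologicalSpace X]
    [TopologicalSpace.SeparableSpace X] [MetricSpace Y] [ProperSpace Y] {F : ℕ → X → Y} (hF : Equicontinuous F)
    (hb : ∀ x, ∃ K, IsCompact K ∧ ∀ k, F k x ∈ K) :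
    ∃ (φ : ℕ → ℕ) (G : X → Y), StrictMono φ ∧
      TendstoLocallyUniformly (fun k => F (φ k)) G atTop := by
  obtain ⟨D, hDc, hDd⟩ := TopologicalSpace.exists_countable_dense X
  have := hDc.to_subtype
  choose K hK hFK using hb
  -- Sequential compactness of a countable product replaces the diagonal argument.
  obtain ⟨g, -, φ, hφ, hg⟩ := (isCompact_univ_pi fun d : D => hK d).tendsto_subseq
    (x := fun k (d : D) => F k d) fun k d _ => hFK d k
  have hFe := fun x ε (hε : 0 < ε) => Metric.equicontinuousAt_iff_right.1 (hF x) ε hε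
  have hcs : ∀ x, CauchySeq fun k => F (φ k) x := fun x => by
    refine Metric.cauchySeq_iff'.2 fun ε hε => ?_
    obtain ⟨U, hU, hUo, hxU⟩ := mem_nhds_iff.1 (hFe x (ε / 4) (by positivity))
    obtain ⟨d, hdU, hdD⟩ := hDd.inter_open_nonempty U hUo ⟨x, hxU⟩
    have hd := (tendsto_pi_nhds.1 hg ⟨d, hdD⟩).cauchySeq
    obtain ⟨N, hN⟩ := Metric.cauchySeq_iff'.1 hd (ε / 4) (by positivity)
    refine ⟨N, fun n hn => ?_⟩
    have h1 : dist (F (φ n) x) (F (φ n) d) < ε / 4 := hU hdU (φ n)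
    have h2 : dist (F (φ N) x) (F (φ N) d) < ε / 4 := hU hdU (φ N)
    have h3 : dist (F (φ n) d) (F (φ N) d) < ε / 4 := hN n hn
    rw [dist_comm] at h2
    linarith [dist_triangle4 (F (φ n) x) (F (φ n) d) (F (φ N) d) (F (φ N) x)]
  choose G hG using fun x => cauchySeq_tendsto_of_complete (hcs x)
  refine ⟨φ, G, hφ, Metric.tendstoLocallyUniformly_iff.2 fun ε hε x => ?_⟩
  refine ⟨_, hFe x (ε / 4) (by positivity), ?_⟩
  filter_upwards [Metric.tendsto_nhds.1 (hG x) (ε / 4) (by positivity)] with n hn y hy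
  have h1 : dist (G x) (G y) ≤ ε / 4 :=
    le_of_tendsto ((hG x).dist (hG y)) (Eventually.of_forall fun k => (hy (φ k)).le)
  have h2 := hy (φ n)
  rw [dist_comm] at h1 hn
  linarith [dist_triangle4 (G y) (G x) (F (φ n) x) (F (φ n) y)]

/-! ### Evolutions Hölder in time and their limits -/

/-- The evolution `u` is `1/8`-Hölder on `[0, T]` with values in `C¹(I)`. -/
def TimeHolder (B T : ℝ) (u : ℝ → ℝ → Plane) : Prop :=
  ∀ a ∈ Icc 0 T, ∀ b ∈ Icc 0 T, ∀ s ∈ I, ‖u b s - u a s‖ ≤ B * |b - a| ^ (1 / 8 : ℝ) ∧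
    ‖vel (u b) s - vel (u a) s‖ ≤ B * |b - a| ^ (1 / 8 : ℝ)

theorem norm_sub_le_of_vel_le {f : ℝ → Plane} (hf : ContDiffOn ℝ 1 f I) {V : ℝ}
    (hV : ∀ s ∈ I, ‖vel f s‖ ≤ V) {s t : ℝ} (hs : s ∈ I) (ht : t ∈ I) :
    ‖f t - f s‖ ≤ V * |t - s| := by
  rw [(ContDiffOn.isPrimitive hf).sub_eq hs ht]
  exact intervalIntegral.norm_integral_le_of_norm_le_const fun z hz =>
    hV z (uIcc_subset_Icc hs ht (uIoc_subset_uIcc hz))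

theorem exists_c1_bound {f : ℝ → Plane} (hf : ContDiffOn ℝ 1 f I) :
    ∃ V, 0 ≤ V ∧ ∀ s ∈ I, ‖f s‖ ≤ V ∧ ‖vel f s‖ ≤ V := by
  obtain ⟨V₁, h1⟩ := isCompact_Icc.exists_bound_of_continuousOn hf.continuousOn
  obtain ⟨V₂, h2⟩ := isCompact_Icc.exists_bound_of_continuousOn (ContDiffOn.continuousOn_vel hf)
  have h0 : (0 : ℝ) ∈ I := ⟨le_rfl, zero_le_one⟩
  exact ⟨max V₁ V₂, (norm_nonneg _).trans ((h1 0 h0).trans (le_max_left _ _)),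
    fun s hs => ⟨(h1 s hs).trans (le_max_left _ _), (h2 s hs).trans (le_max_right _ _)⟩⟩

/-- The bound depends on the initial curve, `B` and `T` only, hence is uniform along the sequence.
-/
theorem TimeHolder.exists_bound {B T : ℝ} (hB : 0 < B) (hT : 0 < T) {γ₀ : ℝ → Plane}
    (h0 : ContDiffOn ℝ 1 γ₀ I) : ∃ V, 0 ≤ V ∧ ∀ u : ℝ → ℝ → Plane, TimeHolder B T u → u 0 = γ₀ →
      ∀ t ∈ Icc 0 T, ∀ s ∈ I, ‖u t s‖ ≤ V ∧ ‖vel (u t) s‖ ≤ V := by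
  obtain ⟨V, hV0, hV⟩ := exists_c1_bound h0
  refine ⟨V + B * T ^ (1 / 8 : ℝ), by positivity, fun u hu hu0 t ht s hs => ?_⟩
  obtain ⟨h1, h2⟩ := hu 0 ⟨le_rfl, hT.le⟩ t ht s hs
  rw [hu0, sub_zero] at h1 h2
  have h3 : B * |t| ^ (1 / 8 : ℝ) ≤ B * T ^ (1 / 8 : ℝ) := by
    rw [abs_of_nonneg ht.1]
    have := ht.1
    gcongr
    exact ht.2
  obtain ⟨h4, h5⟩ := hV s hs
  constructor
  · calc ‖u t s‖ = ‖γ₀ s + (u t s - γ₀ s)‖ := by congr 1; abel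
      _ ≤ ‖γ₀ s‖ + ‖u t s - γ₀ s‖ := norm_add_le _ _
      _ ≤ _ := by linarith
  · calc ‖vel (u t) s‖ = ‖vel γ₀ s + (vel (u t) s - vel γ₀ s)‖ := by congr 1; abel
      _ ≤ ‖vel γ₀ s‖ + ‖vel (u t) s - vel γ₀ s‖ := norm_add_le _ _
      _ ≤ _ := by linarith

/-- Compactness of evolutions which are locally Hölder in time and have uniformly Hölder
derivatives. -/
theorem exists_subseq_limit {M : ℝ} (hM : 0 < M) {γ₀ : ℝ → Plane} {u : ℕ → ℝ → ℝ → Plane}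
    (hu : ∀ k, ∀ t, 0 ≤ t → HalfHolder M (u k t))
    (hB : ∀ T, 0 < T → ∃ B, 0 < B ∧ ∀ k, TimeHolder B T (u k)) (h0 : ∀ k, u k 0 = γ₀) :
    ∃ (φ : ℕ → ℕ) (γ : ℝ → ℝ → Plane), StrictMono φ ∧ (∀ t, 0 ≤ t → HalfHolder M (γ t)) ∧
      (∀ T, 0 < T → ∃ B, 0 < B ∧ (∀ k, TimeHolder B T (u k)) ∧ TimeHolder B T γ) ∧
      ∀ T, 0 < T → ∀ δ, 0 < δ → ∀ᶠ k in atTop, ∀ t ∈ Icc 0 T, ∀ s ∈ I,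
        ‖u (φ k) t s - γ t s‖ ≤ δ ∧ ‖vel (u (φ k) t) s - vel (γ t) s‖ ≤ δ := by
  have hγ₀ : ContDiffOn ℝ 1 γ₀ I := by rw [← h0 0]; exact (hu 0 0 le_rfl).1
  obtain ⟨P, hP⟩ : ∃ P : ℝ → ℝ, P = fun s => (projIcc (0 : ℝ) 1 zero_le_one s : ℝ) := ⟨_, rfl⟩
  have hPI : ∀ s, P s ∈ I := fun s => by rw [hP]; exact Subtype.mem _
  have hPs : ∀ s ∈ I, P s = s := fun s hs => by simp [hP, projIcc_of_mem _ hs]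
  have hPc : Continuous P := by rw [hP]; exact continuous_subtype_val.comp continuous_projIcc
  -- Position and velocity are handled together, so one extraction gives both limits. Clamping time
  -- at `0` and projecting the parameter to `I` define the maps on all of `ℝ × ℝ`.
  set F : ℕ → ℝ × ℝ → Plane × Plane := fun k p =>
    (u k (max p.1 0) (P p.2), vel (u k (max p.1 0)) (P p.2)) with hFdef
  have hFe : Equicontinuous F := by
    intro p₀
    obtain ⟨T, hT, hpT⟩ : ∃ T : ℝ, 0 < T ∧ p₀.1 < T :=
      ⟨|p₀.1| + 1, by positivity, by linarith [le_abs_self p₀.1]⟩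
    obtain ⟨B, hBp, hBu⟩ := hB T hT
    obtain ⟨V, hV0, hV⟩ := TimeHolder.exists_bound hBp hT hγ₀
    refine Metric.equicontinuousAt_of_continuity_modulus (fun p =>
      B * |max p.1 0 - max p₀.1 0| ^ (1 / 8 : ℝ) + V * |P p.2 - P p₀.2| + M * √|P p.2 - P p₀.2|)
      ?_ F ?_
    · have hc : Continuous fun p : ℝ × ℝ => B * |max p.1 0 - max p₀.1 0| ^ (1 / 8 : ℝ)
          + V * |P p.2 - P p₀.2| + M * √|P p.2 - P p₀.2| := by
        have h1 : Continuous fun p : ℝ × ℝ => |max p.1 0 - max p₀.1 0| ^ (1 / 8 : ℝ) :=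
          (by fun_prop : Continuous fun p : ℝ × ℝ => |max p.1 0 - max p₀.1 0|).rpow_const
            fun _ => Or.inr (by norm_num)
        fun_prop
      have := hc.tendsto p₀
      simpa using this
    · filter_upwards [continuous_fst.continuousAt.eventually_lt_const hpT] with p hp k
      have ha : max p₀.1 0 ∈ Icc 0 T := ⟨le_max_right _ _, max_le hpT.le hT.le⟩
      have hb : max p.1 0 ∈ Icc 0 T := ⟨le_max_right _ _, max_le hp.le hT.le⟩
      have hk := hu k _ ha.1
      obtain ⟨e1, e2⟩ := hBu k _ ha _ hb (P p.2) (hPI _)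
      have e3 := norm_sub_le_of_vel_le hk.1
        (fun s hs => (hV (u k) (hBu k) (h0 k) _ ha s hs).2) (hPI p₀.2) (hPI p.2)
      have e4 := hk.2 _ (hPI p₀.2) _ (hPI p.2)
      have e5 : 0 ≤ V * |P p.2 - P p₀.2| := by positivity
      have e6 : 0 ≤ M * √|P p.2 - P p₀.2| := by positivity
      rw [dist_comm, Prod.dist_eq, dist_eq_norm, dist_eq_norm]
      refine max_le ?_ ?_
      · refine (norm_sub_le_norm_sub_add_norm_sub _ (u k (max p₀.1 0) (P p.2)) _).trans ?_
        linarith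
      · refine (norm_sub_le_norm_sub_add_norm_sub _ (vel (u k (max p₀.1 0)) (P p.2)) _).trans ?_
        linarith
  have hFb : ∀ p, ∃ K, IsCompact K ∧ ∀ k, F k p ∈ K := by
    intro p
    obtain ⟨T, hT, hpT⟩ : ∃ T : ℝ, 0 < T ∧ p.1 < T :=
      ⟨|p.1| + 1, by positivity, by linarith [le_abs_self p.1]⟩
    obtain ⟨B, hBp, hBu⟩ := hB T hT
    obtain ⟨V, hV0, hV⟩ := TimeHolder.exists_bound hBp hT hγ₀
    refine ⟨Metric.closedBall 0 V, isCompact_closedBall _ _, fun k => ?_⟩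
    have := hV (u k) (hBu k) (h0 k) (max p.1 0) ⟨le_max_right _ _, max_le hpT.le hT.le⟩ _ (hPI p.2)
    rw [mem_closedBall_zero_iff]
    exact max_le this.1 this.2
  obtain ⟨φ, G, hφ, hG⟩ := exists_subseq_tendstoLocallyUniformly hFe hFb
  have hFs : ∀ k, ∀ t, 0 ≤ t → ∀ s ∈ I, F k (t, s) = (u k t s, vel (u k t) s) := by
    intro k t ht s hs
    simp only [hFdef, max_eq_left ht, hPs s hs]
  have hpt : ∀ t, 0 ≤ t → ∀ s ∈ I, Tendsto (fun k => u (φ k) t s) atTop (𝓝 (G (t, s)).1) ∧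
      Tendsto (fun k => vel (u (φ k) t) s) atTop (𝓝 (G (t, s)).2) := by
    intro t ht s hs
    have h := (hG.tendstoLocallyUniformlyOn (s := univ)).tendsto_at (mem_univ (t, s))
    simp only [hFs _ t ht s hs] at h
    exact ⟨(continuous_fst.tendsto _).comp h, (continuous_snd.tendsto _).comp h⟩
  obtain ⟨γ, hγ⟩ : ∃ γ : ℝ → ℝ → Plane, γ = fun t s => (G (t, s)).1 := ⟨_, rfl⟩
  have hwH : ∀ t, 0 ≤ t → ∀ a ∈ I, ∀ b ∈ I, ‖(G (t, b)).2 - (G (t, a)).2‖ ≤ M * √|b - a| :=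
    fun t ht a ha b hb => le_of_tendsto (((hpt t ht b hb).2.sub (hpt t ht a ha).2).norm)
      (Eventually.of_forall fun k => (hu (φ k) t ht).2 a ha b hb)
  have hwc : ∀ t, 0 ≤ t → ContinuousOn (fun s => (G (t, s)).2) I := by
    intro t ht a ha
    refine tendsto_iff_norm_sub_tendsto_zero.2 ?_
    have hc : Tendsto (fun b => M * √|b - a|) (𝓝[I] a) (𝓝 0) := by
      have : Continuous fun b => M * √|b - a| := by fun_prop
      simpa using (this.tendsto a).mono_left nhdsWithin_le_nhds
    refine squeeze_zero' (Eventually.of_forall fun _ => norm_nonneg _) ?_ hc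
    filter_upwards [self_mem_nhdsWithin] with b hb using hwH t ht a ha b hb
  -- The limit of the velocities is the velocity of the limit: pass to the limit in the fundamental
  -- theorem of calculus by dominated convergence.
  have hγp : ∀ t, 0 ≤ t → IsPrimitive (γ t) (fun s => (G (t, s)).2) := by
    intro t ht
    have h00 : (0 : ℝ) ∈ I := ⟨le_rfl, zero_le_one⟩
    refine ⟨(hwc t ht).intervalIntegrable_of_Icc zero_le_one, fun s hs => ?_⟩
    obtain ⟨B, hBp, hBu⟩ := hB (t + 1) (by positivity)
    obtain ⟨V, hV0, hV⟩ := TimeHolder.exists_bound hBp (by positivity : 0 < t + 1) hγ₀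
    have hsub : uIoc 0 s ⊆ I := uIoc_subset_uIcc.trans (uIcc_subset_Icc h00 hs)
    have hint : Tendsto (fun k => ∫ x in (0 : ℝ)..s, vel (u (φ k) t) x) atTop
        (𝓝 (∫ x in (0 : ℝ)..s, (G (t, x)).2)) := by
      refine intervalIntegral.tendsto_integral_filter_of_dominated_convergence (fun _ => V)
        (Eventually.of_forall fun k => ?_) (Eventually.of_forall fun k => ?_)
        intervalIntegrable_const (ae_of_all _ fun x hx => (hpt t ht x (hsub hx)).2)
      · exact ((ContDiffOn.continuousOn_vel (hu (φ k) t ht).1).mono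
          hsub).aestronglyMeasurable measurableSet_uIoc
      · exact ae_of_all _ fun x hx => (hV _ (hBu (φ k)) (h0 _) t ⟨ht, by linarith⟩ x (hsub hx)).2
    have h1 := (hpt t ht 0 h00).1.add hint
    have h2 : (fun k => u (φ k) t 0 + ∫ x in (0 : ℝ)..s, vel (u (φ k) t) x)
        = fun k => u (φ k) t s := by
      funext k
      exact ((ContDiffOn.isPrimitive (hu (φ k) t ht).1).2 s hs).symm
    rw [h2] at h1
    rw [hγ]
    exact tendsto_nhds_unique (hpt t ht s hs).1 h1
  have hγv : ∀ t, 0 ≤ t → ∀ s ∈ I, vel (γ t) s = (G (t, s)).2 := fun t ht s hs =>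
    ((hγp t ht).hasDerivWithinAt (hwc t ht) hs).derivWithin (uniqueDiffOn_Icc zero_lt_one s hs)
  have hγ1 : ∀ t, 0 ≤ t → ContDiffOn ℝ 1 (γ t) I := by
    intro t ht
    rw [← zero_add (1 : WithTop ℕ∞), contDiffOn_succ_iff_derivWithin (uniqueDiffOn_Icc zero_lt_one)]
    refine ⟨fun s hs => ((hγp t ht).hasDerivWithinAt (hwc t ht) hs).differentiableWithinAt,
      by simp, ?_⟩
    rw [contDiffOn_zero]
    exact (hwc t ht).congr (hγv t ht)
  refine ⟨φ, γ, hφ, fun t ht => ⟨hγ1 t ht, fun a ha b hb => ?_⟩, fun T hT => ?_,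
    fun T hT δ hδ => ?_⟩
  · rw [hγv t ht a ha, hγv t ht b hb]
    exact hwH t ht a ha b hb
  · obtain ⟨B, hBp, hBu⟩ := hB T hT
    refine ⟨B, hBp, hBu, fun a ha b hb s hs => ⟨?_, ?_⟩⟩
    · rw [hγ]
      exact le_of_tendsto (((hpt b hb.1 s hs).1.sub (hpt a ha.1 s hs).1).norm)
        (Eventually.of_forall fun k => (hBu (φ k) a ha b hb s hs).1)
    · rw [hγv b hb.1 s hs, hγv a ha.1 s hs]
      exact le_of_tendsto (((hpt b hb.1 s hs).2.sub (hpt a ha.1 s hs).2).norm)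
        (Eventually.of_forall fun k => (hBu (φ k) a ha b hb s hs).2)
  · have hcomp : IsCompact (Icc (0 : ℝ) T ×ˢ I) := isCompact_Icc.prod isCompact_Icc
    have hun := (tendstoLocallyUniformlyOn_iff_tendstoUniformlyOn_of_compact hcomp).1
      hG.tendstoLocallyUniformlyOn
    filter_upwards [Metric.tendstoUniformlyOn_iff.1 hun δ hδ] with k hk t ht s hs
    have h := hk (t, s) ⟨ht, hs⟩
    rw [hFs _ t ht.1 s hs, dist_comm, Prod.dist_eq, dist_eq_norm, dist_eq_norm] at h
    rw [hγv t ht.1 s hs, hγ]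
    exact ⟨(le_max_left _ _).trans h.le, (le_max_right _ _).trans h.le⟩

/-! ### Convergence in Hölder spaces -/

section Norms

variable {α β : ℝ≥0}

/-- A velocity increment `x` satisfies `x ≤ 2η` and `x ≤ M |s-t|^(1/2)`; writing `x = x^(1-2α)
x^(2α)` and using one bound in each factor produces the exponent `α`. -/
theorem c1Norm_le {M η : ℝ} {f : ℝ → Plane} (hM : 0 ≤ M) (hη : 0 ≤ η) (hα0 : 0 < α)
    (hα : (α : ℝ) < 1 / 2) (hf : HalfHolder M f) (hb : ∀ s ∈ I, ‖f s‖ ≤ η ∧ ‖vel f s‖ ≤ η) :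
    c1Norm α f ≤ ENNReal.ofReal
      (2 * η + (2 * η) ^ (1 - 2 * α : ℝ) * M ^ (2 * α : ℝ)) := by
  have hα0' : (0 : ℝ) < α := hα0
  set C := (2 * η) ^ (1 - 2 * α : ℝ) * M ^ (2 * α : ℝ) with hC
  have hC0 : 0 ≤ C := by positivity
  have hhol : HolderWith C.toNNReal α (I.domRestrict (vel f)) := by
    intro s t
    have h1 : ‖vel f s - vel f t‖ ≤ 2 * η := by
      refine (norm_sub_le _ _).trans ?_
      linarith [(hb s s.2).2, (hb t t.2).2]
    have h2 := hf.2 t t.2 s s.2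
    have h3 : ‖vel f s - vel f t‖ ≤ C * |(s : ℝ) - t| ^ (α : ℝ) := by
      rcases (norm_nonneg (vel f s - vel f t)).eq_or_lt with h | h
      · rw [← h]; positivity
      calc ‖vel f s - vel f t‖
          = ‖vel f s - vel f t‖ ^ (1 - 2 * α : ℝ) * ‖vel f s - vel f t‖ ^ (2 * α : ℝ) := by
            rw [← Real.rpow_add h]; simp
        _ ≤ (2 * η) ^ (1 - 2 * α : ℝ) * (M * √|(s : ℝ) - t|) ^ (2 * α : ℝ) := by
            have : (0 : ℝ) ≤ 1 - 2 * α := by linarith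
            gcongr
        _ = C * |(s : ℝ) - t| ^ (α : ℝ) := by
            rw [Real.mul_rpow hM (Real.sqrt_nonneg _), Real.sqrt_eq_rpow,
              ← Real.rpow_mul (abs_nonneg _), hC]
            rw [show (1 / 2 : ℝ) * (2 * α) = α by ring]
            ring
    have e1 : edist (I.domRestrict (vel f) s) (I.domRestrict (vel f) t)
        = ENNReal.ofReal ‖vel f s - vel f t‖ := by
      rw [edist_dist, dist_eq_norm]; rfl
    have e2 : edist s t = ENNReal.ofReal |(s : ℝ) - t| := by
      rw [edist_dist, Subtype.dist_eq, Real.dist_eq]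
    rw [e1, e2, ENNReal.ofReal_rpow_of_nonneg (abs_nonneg _) hα0'.le]
    change _ ≤ ENNReal.ofReal C * _
    rw [← ENNReal.ofReal_mul hC0]
    exact ENNReal.ofReal_le_ofReal h3
  rw [c1Norm, if_pos hf.1, ENNReal.ofReal_add (by positivity) hC0, two_mul,
    ENNReal.ofReal_add hη hη]
  refine add_le_add (add_le_add ?_ ?_) hhol.eHolderNorm_le
  · refine iSup₂_le fun s hs => ?_
    rw [← ofReal_norm]
    exact ENNReal.ofReal_le_ofReal (hb s hs).1
  · refine iSup₂_le fun s hs => ?_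
    rw [← ofReal_norm]
    exact ENNReal.ofReal_le_ofReal (hb s hs).2

theorem HalfHolder.c1Norm_lt_top {M : ℝ} {f : ℝ → Plane} (hM : 0 ≤ M) (hα0 : 0 < α)
    (hα : (α : ℝ) < 1 / 2) (hf : HalfHolder M f) : c1Norm α f < ⊤ := by
  obtain ⟨V, hV0, hV⟩ := exists_c1_bound hf.1
  exact (c1Norm_le hM hV0 hα0 hα hf hV).trans_lt ENNReal.ofReal_lt_top

theorem c1Norm_zero (hα0 : 0 < α) (hα : (α : ℝ) < 1 / 2) : c1Norm α (0 : ℝ → Plane) = 0 := by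
  have hv : ∀ s, vel (0 : ℝ → Plane) s = 0 := fun s => by simp [vel]
  have h := c1Norm_le (M := 0) (η := 0) (f := 0) le_rfl le_rfl hα0 hα
    ⟨contDiffOn_const, fun s _ t _ => by simp [hv]⟩ fun s _ => by simp [hv]
  have h1 : (1 - 2 * α : ℝ) ≠ 0 := by linarith
  simpa [Real.zero_rpow h1] using h

/-- Finiteness of `Ψ` gives membership in the space; its limit at zero turns `C¹` convergence into
`C^{1,α}` convergence. -/
theorem exists_c1Norm_bound {M : ℝ} (hM : 0 ≤ M) (hα0 : 0 < α) (hα : (α : ℝ) < 1 / 2) :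
    ∃ Ψ : ℝ → ℝ≥0∞, Tendsto Ψ (𝓝 0) (𝓝 0) ∧ (∀ η, Ψ η < ⊤) ∧ ∀ η, 0 ≤ η → ∀ f, HalfHolder M f →
      (∀ s ∈ I, ‖f s‖ ≤ η ∧ ‖vel f s‖ ≤ η) → c1Norm α f ≤ Ψ η := by
  refine ⟨_, ?_, fun η => ENNReal.ofReal_lt_top,
    fun η hη f hf hb => c1Norm_le hM hη hα0 hα hf hb⟩
  have h1 : (0 : ℝ) < 1 - 2 * α := by linarith
  have hc : Continuous fun η : ℝ => 2 * η + (2 * η) ^ (1 - 2 * α : ℝ) * M ^ (2 * α : ℝ) := by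
    have : Continuous fun η : ℝ => (2 * η) ^ (1 - 2 * α : ℝ) :=
      (by fun_prop : Continuous fun η : ℝ => 2 * η).rpow_const fun _ => Or.inr h1.le
    fun_prop
  have := (ENNReal.continuous_ofReal.comp hc).tendsto 0
  simpa [Function.comp_def, Real.zero_rpow h1.ne'] using this

/-- A time increment is at most `2η` and at most `B |b-a|^(1/8)` in `C¹`. A geometric mean of weight
`θ` gives `(2η)^(1-θ) B^θ |b-a|^(θ/8)`, and `c1Norm_le` multiplies the time exponent by `1-2α`. -/
theorem exists_holderC1Norm_bound {M B T : ℝ} (hM : 0 ≤ M) (hB : 0 < B) (hα0 : 0 < α)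
    (hα : (α : ℝ) < 1 / 2) (hβ0 : 0 < β) (hβ : (β : ℝ) < (1 - 2 * (α : ℝ)) / 8) :
    ∃ Ψ : ℝ → ℝ≥0∞, Tendsto Ψ (𝓝 0) (𝓝 0) ∧ (∀ η, Ψ η < ⊤) ∧ ∀ η, 0 ≤ η → ∀ w : ℝ → ℝ → Plane,
      (∀ t, 0 ≤ t → HalfHolder M (w t)) → TimeHolder B T w →
      (∀ t ∈ Icc 0 T, ∀ s ∈ I, ‖w t s‖ ≤ η ∧ ‖vel (w t) s‖ ≤ η) →
      holderC1Norm T β α w ≤ Ψ η := by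
  obtain ⟨Ψ₁, h1, h1t, hΨ₁⟩ := exists_c1Norm_bound (α := α) hM hα0 hα
  have hp : (0 : ℝ) < 1 - 2 * α := by linarith
  obtain ⟨p, hpd⟩ : ∃ p : ℝ, p = 1 - 2 * α := ⟨_, rfl⟩
  rw [← hpd] at hp hβ
  have hβ0' : (0 : ℝ) < β := hβ0
  -- Chosen so that `(θ/8) p = β`. The strict upper bound on `β` is exactly `θ < 1`, which leaves a
  -- positive power of `η`.
  obtain ⟨θ, hθ⟩ : ∃ θ : ℝ, θ = 8 * β / p := ⟨_, rfl⟩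
  have hθ0 : 0 < θ := by rw [hθ]; positivity
  have hθ1 : θ < 1 := by rw [hθ, div_lt_one hp]; linarith
  have hp1 : p ≤ 1 := by rw [hpd]; have : (0 : ℝ) ≤ α := α.2; linarith
  have hθp : θ / 8 * p = β := by rw [hθ]; field_simp
  have hθβ : 0 ≤ θ / 8 - β := by rw [← hθp]; nlinarith
  obtain ⟨D, hD⟩ : ∃ D : ℝ → ℝ, D = fun η => (2 * η) ^ (1 - θ) * B ^ θ := ⟨_, rfl⟩
  have hDc : Continuous D := by
    have : Continuous fun η : ℝ => (2 * η) ^ (1 - θ) :=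
      (by fun_prop : Continuous fun η : ℝ => 2 * η).rpow_const fun _ => Or.inr (by linarith)
    rw [hD]
    fun_prop
  have hD0 : D 0 = 0 := by
    have : (1 - θ) ≠ 0 := by linarith
    simp [hD, Real.zero_rpow this]
  obtain ⟨Q, hQ⟩ : ∃ Q : ℝ → ℝ, Q = fun η =>
      2 * D η * T ^ (θ / 8 - β) + (2 * D η) ^ p * (M + M) ^ (2 * α : ℝ) := ⟨_, rfl⟩
  have hQc : Continuous Q := by
    have : Continuous fun η : ℝ => (2 * D η) ^ p :=
      (by fun_prop : Continuous fun η : ℝ => 2 * D η).rpow_const fun _ => Or.inr hp.le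
    rw [hQ]
    fun_prop
  have hQ0 : Q 0 = 0 := by simp [hQ, hD0, Real.zero_rpow hp.ne']
  refine ⟨fun η => Ψ₁ η + ENNReal.ofReal (Q η), ?_, fun η => ?_, fun η hη w hw hwT hwb => ?_⟩
  · have := (ENNReal.continuous_ofReal.comp hQc).tendsto 0
    simp only [Function.comp, hQ0, ENNReal.ofReal_zero] at this
    simpa using h1.add this
  · exact ENNReal.add_lt_top.2 ⟨h1t η, ENNReal.ofReal_lt_top⟩
  refine add_le_add (iSup₂_le fun t ht => hΨ₁ η hη (w t) (hw t ht.1) (hwb t ht)) ?_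
  refine iSup₂_le fun a ha => iSup₂_le fun b hb => iSup_le fun hab => ?_
  have hd : 0 < b - a := sub_pos.2 hab
  have hdT : b - a ≤ T := by linarith [ha.1, hb.2]
  have hT : 0 ≤ T := hd.le.trans hdT
  have hDη : 0 ≤ D η := by rw [hD]; positivity
  have hf := (hw b hb.1).sub (hw a ha.1)
  have hmin : ∀ x : ℝ, 0 ≤ x → x ≤ 2 * η → x ≤ B * |b - a| ^ (1 / 8 : ℝ) →
      x ≤ D η * (b - a) ^ (θ / 8) := by
    intro x hx h2 h3
    rcases hx.eq_or_lt with h | h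
    · rw [← h]; positivity
    rw [abs_of_pos hd] at h3
    calc x = x ^ (1 - θ) * x ^ θ := by rw [← Real.rpow_add h]; simp
      _ ≤ (2 * η) ^ (1 - θ) * (B * (b - a) ^ (1 / 8 : ℝ)) ^ θ := by
        have : 0 ≤ 1 - θ := by linarith
        gcongr
      _ = D η * (b - a) ^ (θ / 8) := by
        rw [Real.mul_rpow hB.le (by positivity), ← Real.rpow_mul hd.le, hD,
          show (1 / 8 : ℝ) * θ = θ / 8 by ring]
        ring
  have hfb : ∀ s ∈ I, ‖(w b - w a) s‖ ≤ D η * (b - a) ^ (θ / 8) ∧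
      ‖vel (w b - w a) s‖ ≤ D η * (b - a) ^ (θ / 8) := by
    intro s hs
    rw [ContDiffOn.vel_sub (hw b hb.1).1 (hw a ha.1).1 hs]
    obtain ⟨c1, c2⟩ := hwT a ha b hb s hs
    obtain ⟨d1, d2⟩ := hwb a ha s hs
    obtain ⟨e1, e2⟩ := hwb b hb s hs
    exact ⟨hmin _ (norm_nonneg _) ((norm_sub_le _ _).trans (by linarith)) c1,
      hmin _ (norm_nonneg _) ((norm_sub_le _ _).trans (by linarith)) c2⟩
  have hc := c1Norm_le (α := α) (by positivity : 0 ≤ M + M) (by positivity) hα0 hα hf hfb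
  have hdβ : 0 < (b - a) ^ (β : ℝ) := by positivity
  rw [ENNReal.ofReal_rpow_of_pos hd]
  refine ENNReal.div_le_of_le_mul (hc.trans ?_)
  rw [← ENNReal.ofReal_mul' hdβ.le]
  refine ENNReal.ofReal_le_ofReal ?_
  rw [← hpd, hQ]
  have e1 : (b - a) ^ (θ / 8) ≤ T ^ (θ / 8 - β) * (b - a) ^ (β : ℝ) := by
    calc (b - a) ^ (θ / 8) = (b - a) ^ (θ / 8 - β) * (b - a) ^ (β : ℝ) := by
          rw [← Real.rpow_add hd]; simp
      _ ≤ _ := by gcongr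
  have e2 : (2 * (D η * (b - a) ^ (θ / 8))) ^ p = (2 * D η) ^ p * (b - a) ^ (β : ℝ) := by
    rw [← mul_assoc, Real.mul_rpow (by positivity) (by positivity), ← Real.rpow_mul hd.le, hθp]
  rw [e2]
  calc _ ≤ 2 * (D η * (T ^ (θ / 8 - β) * (b - a) ^ (β : ℝ)))
        + (2 * D η) ^ p * (b - a) ^ (β : ℝ) * (M + M) ^ (2 * α : ℝ) := by gcongr
    _ = _ := by ring

/-- A quantity bounded by `Ψ δ` for all large `k`, where `Ψ δ → 0` as `δ → 0`, tends to zero. -/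
theorem tendsto_zero_of_eventually_le {Ψ : ℝ → ℝ≥0∞} (hΨ : Tendsto Ψ (𝓝 0) (𝓝 0)) {x : ℕ → ℝ≥0∞}
    (h : ∀ δ, 0 < δ → ∀ᶠ k in atTop, x k ≤ Ψ δ) : Tendsto x atTop (𝓝 0) := by
  refine ENNReal.tendsto_nhds_zero.2 fun ε hε => ?_
  have h1 : ∀ᶠ δ in 𝓝[>] (0 : ℝ), Ψ δ ≤ ε :=
    (hΨ.mono_left nhdsWithin_le_nhds).eventually (ENNReal.tendsto_nhds_zero.1 tendsto_id ε hε)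
  obtain ⟨δ, hδ, hpos⟩ := (h1.and self_mem_nhdsWithin).exists
  exact (h δ hpos).mono fun k hk => hk.trans hδ

theorem TimeHolder.sub {B C T : ℝ} {u w : ℝ → ℝ → Plane} (hu : TimeHolder B T u)
    (hw : TimeHolder C T w) (hu1 : ∀ t, 0 ≤ t → ContDiffOn ℝ 1 (u t) I)
    (hw1 : ∀ t, 0 ≤ t → ContDiffOn ℝ 1 (w t) I) : TimeHolder (B + C) T (u - w) := by
  intro a ha b hb s hs
  obtain ⟨c1, c2⟩ := hu a ha b hb s hs
  obtain ⟨d1, d2⟩ := hw a ha b hb s hs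
  rw [add_mul]
  constructor
  · have e : (u - w) b s - (u - w) a s = (u b s - u a s) - (w b s - w a s) := by
      simp only [Pi.sub_apply]; abel
    rw [e]
    exact (norm_sub_le _ _).trans (add_le_add c1 d1)
  · have e : vel ((u - w) b) s - vel ((u - w) a) s
        = (vel (u b) s - vel (u a) s) - (vel (w b) s - vel (w a) s) := by
      rw [Pi.sub_apply, Pi.sub_apply, ContDiffOn.vel_sub (hu1 b hb.1) (hw1 b hb.1) hs,
        ContDiffOn.vel_sub (hu1 a ha.1) (hw1 a ha.1) hs]
      abel
    rw [e]
    exact (norm_sub_le _ _).trans (add_le_add c2 d2)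

end Norms

/-! ### Convergence of both interpolations -/

section Convergence

variable {α β : ℝ≥0} {M : ℝ}

theorem TimeHolder.holderC1Norm_lt_top {B T : ℝ} (hM : 0 ≤ M) (hB : 0 < B) (hT : 0 < T)
    (hα0 : 0 < α) (hα : (α : ℝ) < 1 / 2) (hβ0 : 0 < β) (hβ : (β : ℝ) < (1 - 2 * (α : ℝ)) / 8)
    {w : ℝ → ℝ → Plane} (hw : ∀ t, 0 ≤ t → HalfHolder M (w t)) (hwT : TimeHolder B T w) :
    holderC1Norm T β α w < ⊤ := by
  obtain ⟨Ψ, -, hΨt, hΨ⟩ := exists_holderC1Norm_bound (T := T) hM hB hα0 hα hβ0 hβ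
  obtain ⟨V, hV0, hV⟩ := TimeHolder.exists_bound hB hT (hw 0 le_rfl).1
  exact (hΨ V hV0 w hw hwT (hV w hwT rfl)).trans_lt (hΨt V)

theorem tendstoHolderC1 {B T : ℝ} (hM : 0 ≤ M) (hB : 0 < B) (hT : 0 < T)
    (hα0 : 0 < α) (hα : (α : ℝ) < 1 / 2) (hβ0 : 0 < β) (hβ : (β : ℝ) < (1 - 2 * (α : ℝ)) / 8)
    {u : ℕ → ℝ → ℝ → Plane} {γ : ℝ → ℝ → Plane} (hu : ∀ k, ∀ t, 0 ≤ t → HalfHolder M (u k t))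
    (hγ : ∀ t, 0 ≤ t → HalfHolder M (γ t)) (huT : ∀ k, TimeHolder B T (u k))
    (hγT : TimeHolder B T γ)
    (hconv : ∀ δ, 0 < δ → ∀ᶠ k in atTop, ∀ t ∈ Icc 0 T, ∀ s ∈ I,
        ‖u k t s - γ t s‖ ≤ δ ∧ ‖vel (u k t) s - vel (γ t) s‖ ≤ δ) :
    TendstoHolderC1 T β α u γ := by
  refine ⟨fun k => (huT k).holderC1Norm_lt_top hM hB hT hα0 hα hβ0 hβ (hu k),
    hγT.holderC1Norm_lt_top hM hB hT hα0 hα hβ0 hβ hγ, ?_⟩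
  obtain ⟨Ψ, hΨ0, -, hΨ⟩ := exists_holderC1Norm_bound (T := T) (by positivity : 0 ≤ M + M)
    (by positivity : 0 < B + B) hα0 hα hβ0 hβ
  refine tendsto_zero_of_eventually_le hΨ0 fun δ hδ => ?_
  filter_upwards [hconv δ hδ] with k hk
  refine hΨ δ hδ.le (u k - γ) (fun t ht => (hu k t ht).sub (hγ t ht))
    ((huT k).sub hγT (fun t ht => (hu k t ht).1) fun t ht => (hγ t ht).1) fun t ht s hs => ?_
  rw [Pi.sub_apply, ContDiffOn.vel_sub (hu k t ht.1).1 (hγ t ht.1).1 hs]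
  exact hk t ht s hs

/-- The simple function with values `g 0, …, g N` selected by a measurable index. -/
noncomputable def natSimpleFunc {Y : Type*} {q : ℝ → ℕ} (hq : Measurable q) (N : ℕ) (g : ℕ → Y) :
    SimpleFunc ℝ Y where
  toFun t := g (min (q t) N)
  measurableSet_fiber' x :=
    (hq.min measurable_const : Measurable fun t => min (q t) N) (MeasurableSet.of_discrete
      (s := g ⁻¹' {x}))
  finite_range' := ((finite_Iic N).image g).subset <| by
    rintro _ ⟨t, rfl⟩
    exact ⟨min (q t) N, mem_Iic.2 (min_le_right _ _), rfl⟩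

theorem natSimpleFunc_apply {Y : Type*} {q : ℝ → ℕ} (hq : Measurable q) (N : ℕ) (g : ℕ → Y)
    (t : ℝ) : natSimpleFunc hq N g t = g (min (q t) N) := rfl

theorem linftyC1Norm_le {T : ℝ} {u : ℝ → ℝ → Plane} {C : ℝ≥0∞}
    (h : ∀ t ∈ Ioo 0 T, c1Norm α (u t) ≤ C) : linftyC1Norm T α u ≤ C := by
  refine essSup_le_of_ae_le _ ?_
  filter_upwards [ae_restrict_mem measurableSet_Ioo] with t ht using h t ht

/-- Only finitely many iterates occur before `T`, so on `(0, T)` the evolution is itself a simple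
function; truncating the index makes this hold for all times. -/
theorem memLinftyC1_pwConst {T τ : ℝ} (hτ : 0 < τ) (hM : 0 ≤ M) (hα0 : 0 < α)
    (hα : (α : ℝ) < 1 / 2) {c : ℕ → ℝ → Plane} (hc : ∀ n, HalfHolder M (c n)) :
    MemLinftyC1 T α (pwConst τ c) := by
  have hq : Measurable fun t : ℝ => ⌈t / τ⌉₊ := Nat.measurable_ceil.comp (measurable_id.div_const τ)
  have hle : ∀ t ∈ Ioo 0 T, ⌈t / τ⌉₊ ≤ ⌈T / τ⌉₊ := fun t ht =>
    Nat.ceil_le_ceil (div_le_div_of_nonneg_right ht.2.le hτ.le)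
  refine ⟨⟨fun _ => natSimpleFunc hq ⌈T / τ⌉₊ c, fun j t => (hc _).c1Norm_lt_top hM hα0 hα, ?_⟩, ?_⟩
  · filter_upwards [ae_restrict_mem measurableSet_Ioo] with t ht
    have : natSimpleFunc hq ⌈T / τ⌉₊ c t - pwConst τ c t = 0 := by
      rw [natSimpleFunc_apply, min_eq_left (hle t ht), pwConst, sub_self]
    simp only [this, c1Norm_zero hα0 hα]
    exact tendsto_const_nhds
  · refine (linftyC1Norm_le (C := ∑ n ∈ Finset.range (⌈T / τ⌉₊ + 1), c1Norm α (c n))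
      fun t ht => ?_).trans_lt (ENNReal.sum_lt_top.2 fun n _ => (hc n).c1Norm_lt_top hM hα0 hα)
    exact Finset.single_le_sum (f := fun n => c1Norm α (c n)) (fun _ _ => zero_le)
      (Finset.mem_range.2 (Nat.lt_succ_of_le (hle t ht)))

/-- Sampling on a grid of mesh `1/(j+1)` gives simple functions, which converge by continuity in
time. -/
theorem TimeHolder.memLinftyC1 {B T : ℝ} (hM : 0 ≤ M) (hB : 0 < B) (hT : 0 < T) (hα0 : 0 < α)
    (hα : (α : ℝ) < 1 / 2) {γ : ℝ → ℝ → Plane} (hγ : ∀ t, 0 ≤ t → HalfHolder M (γ t))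
    (hγT : TimeHolder B T γ) : MemLinftyC1 T α γ := by
  have hq : ∀ j : ℕ, Measurable fun t : ℝ => ⌊t * (j + 1)⌋₊ := fun j =>
    Nat.measurable_floor.comp (measurable_id.mul_const _)
  refine ⟨⟨fun j => natSimpleFunc (hq j) ⌈T * (j + 1)⌉₊ fun n => γ (n / (j + 1)),
    fun j t => (hγ _ (by positivity)).c1Norm_lt_top hM hα0 hα, ?_⟩, ?_⟩
  · filter_upwards [ae_restrict_mem measurableSet_Ioo] with t ht
    obtain ⟨Ψ, hΨ0, -, hΨ⟩ := exists_c1Norm_bound (α := α) (by positivity : 0 ≤ M + M) hα0 hα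
    have hlim : Tendsto (fun j : ℕ => Ψ (B * (1 / ((j : ℝ) + 1)) ^ (1 / 8 : ℝ))) atTop (𝓝 0) := by
      refine hΨ0.comp ?_
      have h1 := (tendsto_one_div_add_atTop_nhds_zero_nat (𝕜 := ℝ)).rpow_const
        (p := 1 / 8) (Or.inr (by norm_num))
      have h2 := h1.const_mul B
      rwa [Real.zero_rpow (by norm_num), mul_zero] at h2
    refine tendsto_of_tendsto_of_tendsto_of_le_of_le tendsto_const_nhds hlim
      (fun _ => zero_le) fun j => ?_
    have hj : (0 : ℝ) < j + 1 := by positivity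
    have hfl : ⌊t * (j + 1)⌋₊ ≤ ⌈T * (j + 1)⌉₊ :=
      (Nat.floor_le_floor (by have := ht.2; gcongr)).trans (Nat.floor_le_ceil _)
    simp only
    rw [natSimpleFunc_apply, min_eq_left hfl]
    have ht0 := ht.1.le
    have hx1 : (⌊t * (j + 1)⌋₊ : ℝ) / (j + 1) ≤ t := by
      rw [div_le_iff₀ hj]; exact Nat.floor_le (by positivity)
    have hx2 : t - (⌊t * (j + 1)⌋₊ : ℝ) / (j + 1) ≤ 1 / (j + 1) := by
      rw [sub_le_iff_le_add, ← add_div, le_div_iff₀ hj]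
      linarith [Nat.lt_floor_add_one (t * ((j : ℝ) + 1))]
    have hx0 : 0 ≤ (⌊t * (j + 1)⌋₊ : ℝ) / (j + 1) := by positivity
    refine hΨ _ (by positivity) _ ((hγ _ hx0).sub (hγ t ht0)) fun s hs => ?_
    rw [Pi.sub_apply, ContDiffOn.vel_sub (hγ _ hx0).1 (hγ t ht0).1 hs]
    obtain ⟨e1, e2⟩ := hγT t ⟨ht0, ht.2.le⟩ _ ⟨hx0, hx1.trans ht.2.le⟩ s hs
    have hmono : B * |(⌊t * (j + 1)⌋₊ : ℝ) / (j + 1) - t| ^ (1 / 8 : ℝ)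
        ≤ B * (1 / ((j : ℝ) + 1)) ^ (1 / 8 : ℝ) := by
      gcongr
      rw [abs_sub_comm, abs_of_nonneg (by linarith)]
      exact hx2
    exact ⟨e1.trans hmono, e2.trans hmono⟩
  · obtain ⟨V, hV0, hV⟩ := TimeHolder.exists_bound hB hT (hγ 0 le_rfl).1
    obtain ⟨Ψ, -, hΨt, hΨ⟩ := exists_c1Norm_bound (α := α) hM hα0 hα
    refine (linftyC1Norm_le (C := Ψ V) fun t ht => ?_).trans_lt (hΨt V)
    exact hΨ V hV0 _ (hγ t ht.1.le) (hV γ hγT rfl t (Ioo_subset_Icc_self ht))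

theorem pwConst_eq_pwAffine {τ : ℝ} (hτ : 0 < τ) (c : ℕ → ℝ → Plane) (t : ℝ) :
    pwConst τ c t = pwAffine τ c (⌈t / τ⌉₊ * τ) := by
  have : (⌈t / τ⌉₊ * τ) / τ = ⌈t / τ⌉₊ := by field_simp
  simp [pwConst, pwAffine, this]

/-- The constant interpolant at `t` is the affine one at the next node, at most `τ` later, so they
differ by at most `B τ^(1/8)` in `C¹`. That node may lie beyond `T`, but not beyond `T + 1`, as `τ <
1`. -/
theorem tendstoLinftyC1 {B T : ℝ} (hM : 0 ≤ M) (hB : 0 < B) (hT : 0 < T)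
    (hα0 : 0 < α) (hα : (α : ℝ) < 1 / 2) {τ : ℕ → ℝ} (hτ : ∀ k, τ k ∈ Ioo (0 : ℝ) 1)
    (hτ0 : Tendsto τ atTop (𝓝 0)) {c : ℕ → ℕ → ℝ → Plane} {γ : ℝ → ℝ → Plane}
    (hc : ∀ k n, HalfHolder M (c k n)) (hγ : ∀ t, 0 ≤ t → HalfHolder M (γ t))
    (huT : ∀ k, TimeHolder B (T + 1) (pwAffine (τ k) (c k))) (hγT : TimeHolder B T γ)
    (hconv : ∀ δ, 0 < δ → ∀ᶠ k in atTop, ∀ t ∈ Icc 0 T, ∀ s ∈ I,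
        ‖pwAffine (τ k) (c k) t s - γ t s‖ ≤ δ ∧
        ‖vel (pwAffine (τ k) (c k) t) s - vel (γ t) s‖ ≤ δ) :
    TendstoLinftyC1 T α (fun k => pwConst (τ k) (c k)) γ := by
  refine ⟨fun k => memLinftyC1_pwConst (hτ k).1 hM hα0 hα (hc k),
    hγT.memLinftyC1 hM hB hT hα0 hα hγ, ?_⟩
  obtain ⟨Ψ, hΨ0, -, hΨ⟩ := exists_c1Norm_bound (α := α) (by positivity : 0 ≤ M + M) hα0 hα
  refine tendsto_zero_of_eventually_le hΨ0 fun δ hδ => ?_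
  have hsmall : ∀ᶠ k in atTop, B * (τ k) ^ (1 / 8 : ℝ) ≤ δ / 2 := by
    have h2 := (hτ0.rpow_const (p := 1 / 8) (Or.inr (by norm_num))).const_mul B
    rw [Real.zero_rpow (by norm_num), mul_zero] at h2
    exact h2.eventually_le_const (half_pos hδ)
  filter_upwards [hconv (δ / 2) (half_pos hδ), hsmall] with k hk hs
  refine linftyC1Norm_le fun t ht => ?_
  have hτk := (hτ k).1
  have ht0 := ht.1.le
  have hx1 : t ≤ ⌈t / τ k⌉₊ * τ k := by rw [← div_le_iff₀ hτk]; exact Nat.le_ceil _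
  have hx2 : ⌈t / τ k⌉₊ * τ k - t ≤ τ k := by
    have := Nat.ceil_lt_add_one (div_nonneg ht0 hτk.le)
    have h3 : (⌈t / τ k⌉₊ : ℝ) * τ k ≤ (t / τ k + 1) * τ k := by gcongr
    rw [add_mul, div_mul_cancel₀ _ hτk.ne'] at h3
    linarith
  have hu := fun t ht => halfHolder_pwAffine (t := t) hτk (hc k) ht
  rw [Pi.sub_apply, pwConst_eq_pwAffine hτk]
  refine hΨ δ hδ.le _ ((hu _ (ht0.trans hx1)).sub (hγ t ht0)) fun s hs' => ?_
  rw [Pi.sub_apply, ContDiffOn.vel_sub (hu _ (ht0.trans hx1)).1 (hγ t ht0).1 hs']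
  obtain ⟨e1, e2⟩ := huT k t ⟨ht0, by linarith [ht.2]⟩ (⌈t / τ k⌉₊ * τ k)
    ⟨ht0.trans hx1, by linarith [ht.2, (hτ k).2]⟩ s hs'
  obtain ⟨d1, d2⟩ := hk t (Ioo_subset_Icc_self ht) s hs'
  have hmono : B * |⌈t / τ k⌉₊ * τ k - t| ^ (1 / 8 : ℝ) ≤ δ / 2 := by
    refine le_trans ?_ hs
    gcongr
    rw [abs_of_nonneg (by linarith)]
    exact hx2
  constructor
  · refine (norm_sub_le_norm_sub_add_norm_sub _ (pwAffine (τ k) (c k) t s) _).trans ?_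
    linarith
  · refine (norm_sub_le_norm_sub_add_norm_sub _ (vel (pwAffine (τ k) (c k) t) s) _).trans ?_
    linarith

end Convergence

/-! ### Weak convergence in `H¹(0, T; X)` -/

section Weak

/-- A bounded sequence in a Hilbert space converges weakly as soon as its inner products with the
elements of a total set converge. -/
theorem exists_weak_limit {H : Type*} [NormedAddCommGroup H] [InnerProductSpace ℝ H]
    [CompleteSpace H] {V : ℕ → H} {C : ℝ} (hC : ∀ k, ‖V k‖ ≤ C) {S : Set H}
    (hS : ∀ z : H, (∀ s ∈ S, inner ℝ s z = 0) → z = 0)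
    (hV : ∀ s ∈ S, ∃ a, Tendsto (fun k => inner ℝ s (V k)) atTop (𝓝 a)) :
    ∃ Z : H, ∀ z, Tendsto (fun k => inner ℝ z (V k)) atTop (𝓝 (inner ℝ z Z)) := by
  have hC0 : 0 ≤ C := (norm_nonneg _).trans (hC 0)
  -- The vectors against which the sequence converges form a subspace. It contains `S`, so it is
  -- dense; boundedness of the sequence then extends convergence to all of `H`, and Riesz represents
  -- the limit functional.
  let E : Submodule ℝ H :=
    { carrier := {z | ∃ a, Tendsto (fun k => inner ℝ z (V k)) atTop (𝓝 a)}
      zero_mem' := ⟨0, by simp⟩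
      add_mem' := by
        rintro z w ⟨a, ha⟩ ⟨b, hb⟩
        exact ⟨a + b, by simpa only [inner_add_left] using ha.add hb⟩
      smul_mem' := by
        rintro r z ⟨a, ha⟩
        exact ⟨r * a, by simpa only [real_inner_smul_left] using ha.const_mul r⟩ }
  have hdense : E.topologicalClosure = ⊤ := by
    rw [Submodule.topologicalClosure_eq_top_iff, Submodule.eq_bot_iff]
    intro z hz
    exact hS z fun s hs => (Submodule.mem_orthogonal E z).1 hz s (hV s hs)
  have hall : ∀ z, ∃ a, Tendsto (fun k => inner ℝ z (V k)) atTop (𝓝 a) := by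
    intro z
    refine cauchySeq_tendsto_of_complete (Metric.cauchySeq_iff'.2 fun ε hε => ?_)
    have hz : z ∈ closure (E : Set H) := by
      rw [← Submodule.topologicalClosure_coe, hdense]; trivial
    obtain ⟨w, ⟨a, ha⟩, hw⟩ := Metric.mem_closure_iff.1 hz (ε / (3 * (C + 1))) (by positivity)
    obtain ⟨N, hN⟩ := Metric.cauchySeq_iff'.1 ha.cauchySeq (ε / 3) (by positivity)
    have hclose : ∀ k, |inner ℝ z (V k) - inner ℝ w (V k)| < ε / 3 := fun k => by
      rw [← inner_sub_left]
      refine (abs_real_inner_le_norm _ _).trans_lt ?_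
      rw [dist_eq_norm] at hw
      calc ‖z - w‖ * ‖V k‖ ≤ ‖z - w‖ * (C + 1) := by gcongr; linarith [hC k]
        _ < ε / (3 * (C + 1)) * (C + 1) := by gcongr
        _ = ε / 3 := by field_simp
    refine ⟨N, fun n hn => ?_⟩
    have h1 := hclose n
    have h2 := hclose N
    have h3 := hN n hn
    rw [Real.dist_eq] at h3 ⊢
    rw [abs_lt] at *
    constructor <;> linarith [h1.1, h1.2, h2.1, h2.2, h3.1, h3.2]
  choose L hL using hall
  let Λ : H →ₗ[ℝ] ℝ :=
    { toFun := L
      map_add' := fun z w => tendsto_nhds_unique (hL (z + w))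
        (by simpa only [inner_add_left] using (hL z).add (hL w))
      map_smul' := fun r z => by
        refine tendsto_nhds_unique (hL (r • z)) ?_
        simp only [real_inner_smul_left, RingHom.id_apply, smul_eq_mul]
        exact (hL z).const_mul r }
  have hΛ : ∀ z, ‖Λ z‖ ≤ C * ‖z‖ := fun z => by
    refine le_of_tendsto (hL z).norm (Eventually.of_forall fun k => ?_)
    refine (norm_inner_le_norm _ _).trans ?_
    rw [mul_comm]
    gcongr
    exact hC k
  refine ⟨(InnerProductSpace.toDual ℝ H).symm (Λ.mkContinuous C hΛ), fun z => ?_⟩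
  rw [real_inner_comm, InnerProductSpace.toDual_symm_apply]
  exact hL z

variable {X : Type*} [NormedAddCommGroup X] [InnerProductSpace ℝ X] {T : ℝ}

theorem memLp_test_smul {φ : ℝ → ℝ} (h1 : Continuous φ) (h2 : HasCompactSupport φ) (x : X) :
    MemLp (fun t => φ t • x) 2 (volume.restrict (Ioo 0 T)) := by
  obtain ⟨C, hC⟩ := h1.bounded_above_of_compact_support h2
  refine MemLp.of_bound (h1.smul continuous_const).aestronglyMeasurable (C * ‖x‖)
    (Eventually.of_forall fun t => ?_)
  rw [norm_smul]
  gcongr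
  exact hC t

/-- The function `t ↦ φ t • x` as an element of `L²(0, T; X)`. -/
noncomputable def testLp (T : ℝ) {φ : ℝ → ℝ} (h1 : Continuous φ) (h2 : HasCompactSupport φ)
    (x : X) : L2Time T X :=
  (memLp_test_smul h1 h2 x).toLp _

variable [CompleteSpace X]

theorem inner_testLp {φ : ℝ → ℝ} (h1 : Continuous φ) (h2 : HasCompactSupport φ) (x : X)
    (V : L2Time T X) : inner ℝ (testLp T h1 h2 x) V = inner ℝ x (∫ t in Ioo 0 T, φ t • V t) := by
  rw [L2.inner_def, ← integral_inner (integrable_test_smul h1 h2 V)]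
  refine integral_congr_ae ?_
  filter_upwards [(memLp_test_smul h1 h2 x).coeFn_toLp] with t ht
  rw [testLp, ht, real_inner_smul_left, inner_smul_right]

theorem eq_zero_of_inner_testLp {V : L2Time T X}
    (h : ∀ φ : ℝ → ℝ, ∀ h1 : ContDiff ℝ ∞ φ, ∀ h2 : HasCompactSupport φ, tsupport φ ⊆ Ioo 0 T →
      ∀ x : X, inner ℝ (testLp T h1.continuous h2 x) V = 0) : V = 0 := by
  rw [Lp.eq_zero_iff_ae_eq_zero, EventuallyEq, ae_restrict_iff' measurableSet_Ioo]
  refine isOpen_Ioo.ae_eq_zero_of_integral_contDiff_smul_eq_zero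
    (L2Time.integrableOn V).locallyIntegrableOn fun φ h1 h2 h3 => ?_
  rw [← setIntegral_eq_integral_of_forall_compl_eq_zero (s := Ioo 0 T) fun t ht => by
    rw [image_eq_zero_of_notMem_tsupport (fun h => ht (h3 h)), zero_smul]]
  refine ext_inner_left ℝ fun x => ?_
  rw [← inner_testLp h1.continuous h2 x V, h φ h1 h2 h3 x, inner_zero_right]

/-- In this form, being a weak derivative is a family of scalar identities between `L²` pairings,
stable under weak limits. -/
theorem hasWeakDeriv_iff_inner_testLp {U V : L2Time T X} : HasWeakDeriv 0 T U V ↔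
    ∀ φ : ℝ → ℝ, ∀ h1 : ContDiff ℝ ∞ φ, ∀ h2 : HasCompactSupport φ, tsupport φ ⊆ Ioo 0 T →
      ∀ x : X, inner ℝ (testLp T h1.continuous h2 x) V
        = - inner ℝ (testLp T (h1.continuous_deriv (by simp)) h2.deriv x) U := by
  constructor
  · intro h φ h1 h2 h3 x
    rw [inner_testLp, inner_testLp, h.2.2 φ h1 h2 h3, inner_neg_right, neg_neg]
  · intro h
    refine ⟨(L2Time.integrableOn U).locallyIntegrableOn, (L2Time.integrableOn V).locallyIntegrableOn,
      fun φ h1 h2 h3 => ext_inner_left ℝ fun x => ?_⟩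
    have := h φ h1 h2 h3 x
    rw [inner_testLp, inner_testLp] at this
    rw [inner_neg_right, this, neg_neg]

/-- Uniform convergence and a uniform `L²` bound of the derivatives imply weak convergence in
`H¹(0, T; X)`. -/
theorem tendstoWeaklyH1_of_uniform {u v : ℕ → ℝ → X} {w : ℝ → X} {C : ℝ}
    (hu : ∀ k, MemLp (u k) 2 (volume.restrict (Ioo 0 T)))
    (hv : ∀ k, MemLp (v k) 2 (volume.restrict (Ioo 0 T)))
    (hw : MemLp w 2 (volume.restrict (Ioo 0 T))) (huv : ∀ k, HasWeakDeriv 0 T (u k) (v k))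
    (hC : ∀ k, ∫ t in Ioo 0 T, ‖v k t‖ ^ 2 ≤ C)
    (hconv : ∀ δ, 0 < δ → ∀ᶠ k in atTop, ∀ t ∈ Ioo 0 T, ‖u k t - w t‖ ≤ δ) :
    TendstoWeaklyH1 T u w := by
  obtain ⟨U, hU⟩ : ∃ U : ℕ → L2Time T X, U = fun k => (hu k).toLp (u k) := ⟨_, rfl⟩
  obtain ⟨V, hV⟩ : ∃ V : ℕ → L2Time T X, V = fun k => (hv k).toLp (v k) := ⟨_, rfl⟩
  obtain ⟨W, hW⟩ : ∃ W : L2Time T X, W = hw.toLp w := ⟨_, rfl⟩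
  have hUu : ∀ k, U k =ᵐ[volume.restrict (Ioo 0 T)] u k := fun k => by
    rw [hU]; exact (hu k).coeFn_toLp
  have hVv : ∀ k, V k =ᵐ[volume.restrict (Ioo 0 T)] v k := fun k => by
    rw [hV]; exact (hv k).coeFn_toLp
  have hWw : W =ᵐ[volume.restrict (Ioo 0 T)] w := by
    rw [hW]; exact hw.coeFn_toLp
  have hUV : ∀ k, HasWeakDeriv 0 T (U k) (V k) := fun k =>
    hasWeakDeriv_congr (hUu k).symm (hVv k).symm (L2Time.integrableOn _).locallyIntegrableOn
      (L2Time.integrableOn _).locallyIntegrableOn (huv k)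
  have hVb : ∀ k, ‖V k‖ ≤ √C := fun k => by
    rw [hV, norm_toLp_two]
    exact Real.sqrt_le_sqrt (hC k)
  have hUW : Tendsto U atTop (𝓝 W) := by
    refine tendsto_iff_norm_sub_tendsto_zero.2 ?_
    -- No sign of `T` is assumed, so the measure of the time interval is `T ⊔ 0`.
    have key : ∀ δ, 0 < δ → ∀ᶠ k in atTop, ‖U k - W‖ ≤ √(T ⊔ 0) * δ := by
      intro δ hδ
      filter_upwards [hconv δ hδ] with k hk
      rw [hU, hW]
      simp only
      rw [← MemLp.toLp_sub, norm_toLp_two]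
      have h1 := norm_setIntegral_le_of_norm_le_const (μ := volume) (s := Ioo 0 T)
        (f := fun t => ‖(u k - w) t‖ ^ 2) (C := δ ^ 2) (by simp) fun t ht => by
          rw [Real.norm_of_nonneg (by positivity)]
          have := hk t ht
          simp only [Pi.sub_apply]
          gcongr
      rw [measureReal_def, Real.volume_Ioo, sub_zero, ENNReal.toReal_ofReal'] at h1
      calc √(∫ t in Ioo 0 T, ‖(u k - w) t‖ ^ 2) ≤ √(δ ^ 2 * (T ⊔ 0)) :=
            Real.sqrt_le_sqrt ((le_abs_self _).trans h1)
        _ = √(T ⊔ 0) * δ := by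
            rw [Real.sqrt_mul (by positivity), Real.sqrt_sq hδ.le, mul_comm]
    refine Metric.tendsto_nhds.2 fun ε hε => ?_
    filter_upwards [key (ε / (2 * (√(T ⊔ 0) + 1))) (by positivity)] with k hk
    rw [dist_zero_right, norm_norm]
    refine hk.trans_lt ?_
    rw [mul_div_assoc', div_lt_iff₀ (by positivity)]
    nlinarith [Real.sqrt_nonneg (T ⊔ 0)]
  -- Integration by parts moves the derivative onto the test function, where strong convergence of
  -- `U` applies. The whole sequence of derivatives therefore converges weakly.
  obtain ⟨Z, hZ⟩ := exists_weak_limit (V := V) hVb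
    (S := {z | ∃ (φ : ℝ → ℝ) (h1 : ContDiff ℝ ∞ φ) (h2 : HasCompactSupport φ)
      (_ : tsupport φ ⊆ Ioo 0 T) (x : X), z = testLp T h1.continuous h2 x})
    (fun z hz => eq_zero_of_inner_testLp fun φ h1 h2 h3 x => hz _ ⟨φ, h1, h2, h3, x, rfl⟩) (by
      rintro _ ⟨φ, h1, h2, h3, x, rfl⟩
      refine ⟨- inner ℝ (testLp T (h1.continuous_deriv (by simp)) h2.deriv x) W, ?_⟩
      simp only [hasWeakDeriv_iff_inner_testLp.1 (hUV _) φ h1 h2 h3 x]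
      exact (tendsto_const_nhds.inner hUW).neg)
  have hWZ : HasWeakDeriv 0 T W Z := hasWeakDeriv_iff_inner_testLp.2 fun φ h1 h2 h3 x => by
    refine tendsto_nhds_unique (hZ (testLp T h1.continuous h2 x)) ?_
    simp only [hasWeakDeriv_iff_inner_testLp.1 (hUV _) φ h1 h2 h3 x]
    exact (tendsto_const_nhds.inner hUW).neg
  refine ⟨fun k => ⟨WithLp.toLp 2 (U k, V k), hUV k⟩, ⟨WithLp.toLp 2 (W, Z), hWZ⟩, hUu,
    hWw, fun l => ?_⟩
  -- Hahn-Banach extends the functional to the full product of `L²` spaces, where Riesz applies;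
  -- closedness of `H1Time` is then not needed.
  obtain ⟨g, hg, -⟩ := exists_extension_norm_eq _ l
  simp only [← hg]
  have hr : ∀ z, g z = inner ℝ ((InnerProductSpace.toDual ℝ _).symm g) z := fun z => by
    rw [InnerProductSpace.toDual_symm_apply]
  simp only [hr, WithLp.prod_inner_apply]
  exact (tendsto_const_nhds.inner hUW).add (hZ _)

end Weak

/-- Serves for the curves in `L²(I)` and for the two endpoints in the plane alike. -/
theorem tendstoWeaklyH1_affInterp {X : Type*} [NormedAddCommGroup X] [InnerProductSpace ℝ X]
    [CompleteSpace X] {T : ℝ} (hT : 0 < T) {τ : ℕ → ℝ} (hτ : ∀ k, 0 < τ k) {x : ℕ → ℕ → X} {C : ℝ}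
    (hC : ∀ k N, ∑ n ∈ Finset.range N, ‖x k (n + 1) - x k n‖ ^ 2 ≤ C * τ k) {w : ℝ → X}
    (hconv : ∀ δ, 0 < δ → ∀ᶠ k in atTop, ∀ t ∈ Icc 0 T, ‖affInterp (τ k) (x k) t - w t‖ ≤ δ) :
    TendstoWeaklyH1 T (fun k t => affInterp (τ k) (x k) t) w := by
  have hc := fun k => continuousOn_affInterp (hτ k) (x k) T
  have hw : ContinuousOn w (Icc 0 T) := by
    have hu : TendstoUniformlyOn (fun k t => affInterp (τ k) (x k) t) w atTop (Icc 0 T) :=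
      Metric.tendstoUniformlyOn_iff.2 fun ε hε => by
        filter_upwards [hconv (ε / 2) (half_pos hε)] with k hk t ht
        rw [dist_comm, dist_eq_norm]
        linarith [hk t ht]
    exact hu.continuousOn (Frequently.of_forall hc)
  exact tendstoWeaklyH1_of_uniform (fun k => memLp_of_continuousOn (hc k))
    (fun k => memLp_affDeriv (hτ k) (x k) T) (memLp_of_continuousOn hw)
    (fun k => hasWeakDeriv_affInterp (hτ k) (x k) hT)
    (fun k => integral_affDeriv_sq_le (hτ k) (x k) (hC k) T)
    fun δ hδ => (hconv δ hδ).mono fun k hk t ht => hk t (Ioo_subset_Icc_self ht)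

end ElasticFlow

/-! ### The compactness theorem -/

open ElasticFlow in
theorem theorem2p4 (ε : ℝ) (hε : 0 < ε)
    (γ₀ : ℝ → ElasticFlow.Plane) (hγ₀ : γ₀ ∈ ElasticFlow.AC)
    (c : ℝ → ℕ → ℝ → ElasticFlow.Plane)
    (hc : ∀ τ ∈ Ioo (0 : ℝ) 1, ElasticFlow.IsMinimizingMovement ε τ γ₀ (c τ))
    (τ : ℕ → ℝ) (hτ : ∀ k, τ k ∈ Ioo (0 : ℝ) 1) (hτ0 : Tendsto τ atTop (𝓝 0)) :
    ∃ (φ : ℕ → ℕ) (γ : ℝ → ℝ → ElasticFlow.Plane), StrictMono φ ∧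
      (∀ α β : ℝ≥0, 0 < α → (α : ℝ) < 1 / 2 → 0 < β → (β : ℝ) < (1 - 2 * (α : ℝ)) / 8 →
        ∀ T : ℝ, 0 < T →
          ElasticFlow.TendstoHolderC1 T β α
            (fun k => ElasticFlow.pwAffine (τ (φ k)) (c (τ (φ k)))) γ) ∧
      (∀ α : ℝ≥0, 0 < α → (α : ℝ) < 1 / 2 → ∀ T : ℝ, 0 < T →
          ElasticFlow.TendstoLinftyC1 T α
            (fun k => ElasticFlow.pwConst (τ (φ k)) (c (τ (φ k)))) γ) ∧
      (∀ T : ℝ, 0 < T →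
          ElasticFlow.TendstoWeaklyH1 T
            (fun k t => ElasticFlow.toL2 (ElasticFlow.pwAffine (τ (φ k)) (c (τ (φ k))) t))
            (fun t => ElasticFlow.toL2 (γ t)) ∧
          ElasticFlow.TendstoWeaklyH1 T
            (fun k t => ElasticFlow.pwAffine (τ (φ k)) (c (τ (φ k))) t 0) (fun t => γ t 0) ∧
          ElasticFlow.TendstoWeaklyH1 T
            (fun k t => ElasticFlow.pwAffine (τ (φ k)) (c (τ (φ k))) t 1) (fun t => γ t 1)) := by
  obtain ⟨M, C, hM, hC, hbd⟩ := exists_minimizingMovement_bounds hε hγ₀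
  have hb := fun k => hbd (τ k) (hτ k).1 (c (τ k)) (hc (τ k) (hτ k))
  have hH : ∀ k n, HalfHolder M (c (τ k) n) := fun k n => ⟨(hb k).1 n, (hb k).2.1 n⟩
  have hu : ∀ k t, 0 ≤ t → HalfHolder M (pwAffine (τ k) (c (τ k)) t) := fun k t ht =>
    halfHolder_pwAffine (hτ k).1 (hH k) ht
  obtain ⟨φ, γ, hφ, hγ, hhol, hconv⟩ := exists_subseq_limit (γ₀ := γ₀) hM hu
    (fun T hT => by
      obtain ⟨B, hB, h⟩ := exists_pwAffine_holder hM hC hT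
      exact ⟨B, hB, fun k => h (τ k) (hτ k).1 (c (τ k)) (hH k) (hb k).2.2.1⟩)
    (fun k => (affInterp_zero (τ k) (c (τ k))).trans (hc (τ k) (hτ k)).1)
  refine ⟨φ, γ, hφ, fun α β hα0 hα hβ0 hβ T hT => ?_, fun α hα0 hα T hT => ?_,
    fun T hT => ⟨?_, ?_, ?_⟩⟩
  · obtain ⟨B, hB, huT, hγT⟩ := hhol T hT
    exact tendstoHolderC1 hM.le hB hT hα0 hα hβ0 hβ (fun k => hu (φ k)) hγ (fun k => huT (φ k)) hγT
      (hconv T hT)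
  -- One extra unit of time leaves room for the node following `t`.
  · obtain ⟨B, hB, huT, hγT⟩ := hhol (T + 1) (by positivity)
    exact tendstoLinftyC1 hM.le hB hT hα0 hα (fun k => hτ (φ k)) (hτ0.comp hφ.tendsto_atTop)
      (fun k => hH (φ k)) hγ (fun k => huT (φ k))
      (fun a ha b hb => hγT a ⟨ha.1, by linarith [ha.2]⟩ b ⟨hb.1, by linarith [hb.2]⟩) (hconv T hT)
  · have hcd : ∀ k n, ContDiffOn ℝ 1 (c (τ k) n) I := fun k n => (hH k n).1
    simp only [toL2_pwAffine _ (hcd _)]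
    refine tendstoWeaklyH1_affInterp hT (fun k => (hτ (φ k)).1) (C := C) (fun k N => ?_)
      fun δ hδ => ?_
    · refine le_trans (le_of_eq (Finset.sum_congr rfl fun n _ => ?_)) ((hb (φ k)).2.2.1 N)
      exact norm_toL2_sub_sq (hcd _ _).continuousOn (hcd _ _).continuousOn
    · filter_upwards [hconv T hT δ hδ] with k hk t ht
      rw [← toL2_pwAffine _ (hcd _), ← toL2_sub (hu _ t ht.1).1.continuousOn
        (hγ t ht.1).1.continuousOn]
      exact norm_toL2_le ((hu _ t ht.1).1.continuousOn.sub (hγ t ht.1).1.continuousOn) hδ.le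
        fun s hs => (hk t ht s hs).1
  · exact tendstoWeaklyH1_affInterp (x := fun k n => c (τ (φ k)) n 0) hT (fun k => (hτ (φ k)).1)
      (fun k => (hb (φ k)).2.2.2.1) fun δ hδ =>
        (hconv T hT δ hδ).mono fun k hk t ht => (hk t ht 0 ⟨le_rfl, zero_le_one⟩).1
  · exact tendstoWeaklyH1_affInterp (x := fun k n => c (τ (φ k)) n 1) hT (fun k => (hτ (φ k)).1)
      (fun k => (hb (φ k)).2.2.2.2) fun δ hδ =>
        (hconv T hT δ hδ).mono fun k hk t ht => (hk t ht 1 ⟨zero_le_one, le_rfl⟩).1
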